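/- A simple binary matroid is a pair $M=(E,G)$, where $G=\mathrm{PG}(r-1,2)$ is a finite binary projective geometry, identified with $\mathbb F_2^r\setminus\{0\}$, and $E\subseteq G$ is any set of points; $r$ is the dimension of $M$. Flats of $G$ are the sets of nonzero vectors of linear subspaces of $\mathbb F_2^r$, and the induced restriction of $M$ to a flat $F$ is the matroid $(E\cap F,F)$. Two matroids are isomorphic if an isomorphism of the ambient geometries maps one ground set onto the other. $M$ is full-rank if $E$ spans $G$; it is triangle-free if $E$ contains no two-dimensional flat of $G$; and it is $I_5$-free if no induced restriction of $M$ is isomorphic to $I_5$, the $5$-dimensional matroid whose ground set is a basis of its ambient geometry. An affine geometry of dimension $n$ is a matroid $(G'\setminus H,G')$ with $G'$ of dimension $n$ and $H$ a maximal proper flat of $G'$. $M$ is the direct sum of two affine geometries of dimensions $m$ and $n$ if $\mathbb F_2^r=V_1\oplus V_2$ with $\dim V_1=m$ and $\dim V_2=n$, $E\subseteq V_1\cup V_2$, and the induced restrictions of $M$ to the flats $V_1\setminus\{0\}$ and $V_2\setminus\{0\}$ are affine geometries. Theorem. Let $M=(E,G)$ be a full-rank, $I_5$-free and triangle-free simple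 binary matroid of dimension $r\ge 2$. Then $$|E|\ \ge\ 2^{\lfloor r/2\rfloor-1}+2^{\lceil r/2\rceil-1}.$$ Moreover, when $r\ge 6$, equality holds if and only if $M$ is the direct sum of two affine geometries of dimensions $\lfloor r/2\rfloor$ and $\lceil r/2\rceil$ respectively. -/

import Mathlib

/-- A simple binary matroid `M = (E, G)`: the ambient geometry `G` is the binary projective geometry
`PG(V)`, whose points are the nonzero vectors of a vector space `V` over `𝔽₂`, and the ground set
`E` is an arbitrary set of points of `G`.  The dimension of `M` is that of `V` over `𝔽₂`. -/
@[ext]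
structure BinMatroid (V : Type*) [AddCommGroup V] [Module (ZMod 2) V] where
  /-- The ground set `E`. -/
  ground : Set V
  /-- Points of the projective geometry are nonzero vectors. -/
  zero_notMem : (0 : V) ∉ ground

namespace BinMatroid

variable {V W : Type*} [AddCommGroup V] [Module (ZMod 2) V] [AddCommGroup W] [Module (ZMod 2) W]

/-- The induced restriction `M | F = (E ∩ F, F)` to a flat `F` of `G`. Flats of `G` are the sets of
nonzero vectors of the linear subspaces of `V`. -/
def restrict (M : BinMatroid V) (F : Submodule (ZMod 2) V) : BinMatroid F where
  ground := {x : F | (x : V) ∈ M.ground}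
  zero_notMem := M.zero_notMem

/-- Two matroids are isomorphic if an isomorphism between the ambient geometries carries
one ground set onto the other. (Over `𝔽₂` a point is a single nonzero vector and a line is a triple
`x, y, x + y`, so isomorphisms of geometries are the linear isomorphisms.) -/
def Isomorphic (M : BinMatroid V) (N : BinMatroid W) : Prop :=
  ∃ e : V ≃ₗ[ZMod 2] W, e '' M.ground = N.ground

/-- `M` is `N`-free: no induced restriction of `M` is isomorphic to `N`. -/
def IsFree (M : BinMatroid V) (N : BinMatroid W) : Prop :=
  ∀ F : Submodule (ZMod 2) V, ¬ (M.restrict F).Isomorphic N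

/-- The matroid `I_n = (B, G)`, where `G` is `n`-dimensional and `B` is a basis of `G`
(here the standard basis of `𝔽₂ⁿ`). -/
def indep (n : ℕ) : BinMatroid (Fin n → ZMod 2) where
  ground := Set.range fun i => Pi.single i (1 : ZMod 2)
  zero_notMem := by
    rintro ⟨i, hi⟩
    have h := congrFun hi i
    simp at h

/-- `M` is full-rank: its ground set spans the ambient geometry. -/
def FullRank (M : BinMatroid V) : Prop :=
  Submodule.span (ZMod 2) M.ground = ⊤

/-- `M` is triangle-free: the ground set contains no triangle, i.e. no two-dimensional flat. -/
def TriangleFree (M : BinMatroid V) : Prop :=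
  ∀ F : Submodule (ZMod 2) V, Module.finrank (ZMod 2) F = 2 →
    ¬ ((F : Set V) \ {0} ⊆ M.ground)

/-- `M` is an affine geometry: its ground set is the complement of a hyperplane, i.e. of a
maximal proper flat of the ambient geometry. -/
def IsAffineGeometry (M : BinMatroid V) : Prop :=
  ∃ H : Submodule (ZMod 2) V, IsCoatom H ∧ M.ground = (H : Set V)ᶜ

/-- `M` is the (internal) direct sum of its induced restrictions `M | F₁` and `M | F₂`: the ambient
space is the direct sum of `F₁` and `F₂`, and `E` is the union of `E ∩ F₁` and `E ∩ F₂`. -/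
def IsDirectSum (M : BinMatroid V) (F₁ F₂ : Submodule (ZMod 2) V) : Prop :=
  IsCompl F₁ F₂ ∧ M.ground = (M.ground ∩ F₁) ∪ (M.ground ∩ F₂)

/-- `M` is the direct sum of two affine geometries, of dimensions `m` and `n`. -/
def IsSumOfAffineGeometries (M : BinMatroid V) (m n : ℕ) : Prop :=
  ∃ F₁ F₂ : Submodule (ZMod 2) V, M.IsDirectSum F₁ F₂ ∧
    Module.finrank (ZMod 2) F₁ = m ∧ (M.restrict F₁).IsAffineGeometry ∧
    Module.finrank (ZMod 2) F₂ = n ∧ (M.restrict F₂).IsAffineGeometry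

end BinMatroid

/-! Choose a coset `a + W` of largest dimension inside the ground set `E`, and let `F = flat W a` be
its span. Triangle-freeness gives `E ∩ F = a + W`, and by maximality no coset of `W` outside `F`
lies in `E`. The other points are counted by cosets of `F`. Call two cosets adjacent if their sum
meets `E`. Since `I₅` is excluded, five points of `E` always have some sum of three or more of them
in `E` (`FiveSum`); taking two of the five in `a + W` controls triples of cosets of `F`.

The engine is `weighted_lower_bound`. Suppose that modulo `U` there is no free triple, that each
coset outside `U` meeting `E` has at least `p` points, and that each nonadjacent pair has at least
`p + q` together. Then at least `p (2^α - 1) + q (2^β - 1)` points lie outside `U`, with `α + β` the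
codimension of `U`: adjoining a nonadjacent pair to `U` lowers the codimension by two and doubles
both weights. The final bounds have the form `2^i + 2^j` with `i + j = r - 2`, and by convexity the
balanced choice is the least (`minCard_le`).

It remains to find good weights. If there is no free triple modulo `F` and `dim W ≥ 2`, either every
coset with a non-neighbour has at least `|W|/2` points, and weights `1`, `|W|/2` modulo `F` give a
strict bound (`minCard_lt_card_of_large`), or a smallest such coset `c` with non-neighbour `x` is
adjoined to `F`, and weights `2`, `|W|` work (`minCard_le_card_of_small`). If `dim W = 1`, weights
`2`, `3` suffice (`minCard_le_card_of_finrank_le_one`). If there is a free triple modulo `F`, the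
stabilisers in `W` of its cosets are three proper subspaces covering `W`, so each has index two;
adjoining two of the cosets removes all free triples, and weights `2`, `|W|` give a strict bound
(`minCard_lt_card_of_freeTriple`).

For `r ≥ 6` equality survives only in the case of `minCard_le_card_of_small`. There every coset
outside `F` that meets `E` has one point, distinct ones are nonadjacent, and `FiveSum` makes these
points closed under triple sums: they form a second affine geometry, complementary to the first. -/

open Module

namespace BinMatroid
variable {V : Type*} [AddCommGroup V] [Module (ZMod 2) V]

/-! ### Vector spaces over the field with two elements -/

/-- Rewriting rules that normalise sums in a group of exponent two. -/
theorem char_two (V : Type*) [AddCommGroup V] [Module (ZMod 2) V] :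
    (∀ a b : V, a + b = b + a) ∧ (∀ a b c : V, a + (b + c) = b + (a + c)) ∧
    (∀ a b c : V, a + b + c = a + (b + c)) ∧ (∀ a : V, a + a = 0) ∧
    (∀ a b : V, a + (a + b) = b) ∧ (∀ a : V, a + 0 = a) ∧ (∀ a : V, 0 + a = a) := by
  refine ⟨add_comm, add_left_comm, add_assoc, ZModModule.add_self, fun a b => ?_, add_zero,
    zero_add⟩
  rw [← add_assoc, ZModModule.add_self, zero_add]

theorem add_eq_zero_iff_eq_of_char_two {a b : V} : a + b = 0 ↔ a = b := by
  rw [← ZModModule.sub_eq_add, sub_eq_zero]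

theorem mem_sup_span_singleton_iff {U : Submodule (ZMod 2) V} {u x : V} :
    x ∈ U ⊔ (ZMod 2) ∙ u ↔ x ∈ U ∨ x + u ∈ U := by
  rw [Submodule.mem_sup]
  constructor
  · rintro ⟨y, hy, z, hz, rfl⟩
    obtain ⟨c, rfl⟩ := Submodule.mem_span_singleton.1 hz
    obtain rfl | rfl : c = 0 ∨ c = 1 := by clear hz; revert c; decide
    · left; simpa using hy
    · right; simpa only [char_two V, one_smul] using hy
  · rintro (h | h)
    · exact ⟨x, h, 0, zero_mem _, add_zero _⟩
    · exact ⟨_, h, u, Submodule.mem_span_singleton_self u, by simp only [char_two V]⟩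

/-- The subspace generated by `U` and two further vectors. -/
def ext2 (U : Submodule (ZMod 2) V) (u v : V) : Submodule (ZMod 2) V :=
  (U ⊔ (ZMod 2) ∙ u) ⊔ (ZMod 2) ∙ v

theorem mem_ext2 {U : Submodule (ZMod 2) V} {u v x : V} :
    x ∈ ext2 U u v ↔ x ∈ U ∨ x + u ∈ U ∨ x + v ∈ U ∨ x + u + v ∈ U := by
  simp only [ext2, mem_sup_span_singleton_iff, or_assoc]
  rw [add_right_comm x v u]

theorem le_ext2 (U : Submodule (ZMod 2) V) (u v : V) : U ≤ ext2 U u v :=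
  le_sup_left.trans le_sup_left

/-! ### Cosets met by a set of points -/

/-- The coset `x + U` contains a point of `E`. -/
def Hit (E : Finset V) (U : Submodule (ZMod 2) V) (x : V) : Prop := ∃ h ∈ E, h + x ∈ U

open Classical in
/-- The points of `E` in the coset `x + U`. -/
noncomputable def cls (E : Finset V) (U : Submodule (ZMod 2) V) (x : V) : Finset V :=
  {e ∈ E | e + x ∈ U}

open Classical in
/-- The points of `E` outside of `U`. -/
noncomputable def outside (E : Finset V) (U : Submodule (ZMod 2) V) : Finset V :=
  {e ∈ E | e ∉ U}

theorem mem_cls {E : Finset V} {U : Submodule (ZMod 2) V} {x e : V} :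
    e ∈ cls E U x ↔ e ∈ E ∧ e + x ∈ U := by simp [cls]

theorem mem_outside {E : Finset V} {U : Submodule (ZMod 2) V} {e : V} :
    e ∈ outside E U ↔ e ∈ E ∧ e ∉ U := by simp [outside]

variable {E : Finset V} {U : Submodule (ZMod 2) V}

theorem Hit.congr {x y : V} (h : Hit E U x) (hxy : x + y ∈ U) : Hit E U y := by
  obtain ⟨e, he, hx⟩ := h
  exact ⟨e, he, by simpa only [char_two V] using U.add_mem hx hxy⟩

theorem Hit.mono {U' : Submodule (ZMod 2) V} {x : V} (h : Hit E U x) (hU : U ≤ U') :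
    Hit E U' x := by
  obtain ⟨e, he, hx⟩ := h
  exact ⟨e, he, hU hx⟩

theorem cls_congr {x y : V} (hxy : x + y ∈ U) : cls E U x = cls E U y := by
  ext e
  simp only [mem_cls]
  refine and_congr_right fun _ => ⟨fun h => ?_, fun h => ?_⟩
  · simpa only [char_two V] using U.add_mem h hxy
  · simpa only [char_two V] using U.add_mem h hxy

theorem hit_iff_card_pos {x : V} : Hit E U x ↔ 0 < (cls E U x).card := by
  rw [Finset.card_pos]
  constructor
  · rintro ⟨e, he, hx⟩; exact ⟨e, mem_cls.2 ⟨he, hx⟩⟩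
  · rintro ⟨e, he⟩; exact ⟨e, mem_cls.1 he⟩

theorem hit_self {e : V} (he : e ∈ E) : Hit E U e :=
  ⟨e, he, by simp only [char_two V, U.zero_mem]⟩

theorem Hit.ext2_iff {u v x : V} : Hit E (ext2 U u v) x ↔
    Hit E U x ∨ Hit E U (x + u) ∨ Hit E U (x + v) ∨ Hit E U (x + u + v) := by
  simp only [Hit, mem_ext2, ← exists_or, ← and_or_left, add_assoc]

/-- Independent triples of cosets met by `E` have another coset met by `E` in their span. -/
def NoFreeTriple (E : Finset V) (U : Submodule (ZMod 2) V) : Prop :=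
  ∀ e ∈ E, ∀ f ∈ E, ∀ g ∈ E,
    Hit E U (e + f) ∨ Hit E U (e + g) ∨ Hit E U (f + g) ∨ Hit E U (e + f + g)

theorem NoFreeTriple.mono {U' : Submodule (ZMod 2) V} (h : NoFreeTriple E U) (hU : U ≤ U') :
    NoFreeTriple E U' := by
  intro e he f hf g hg
  rcases h e he f hf g hg with h | h | h | h
  · exact Or.inl (h.mono hU)
  · exact Or.inr (Or.inl (h.mono hU))
  · exact Or.inr (Or.inr (Or.inl (h.mono hU)))
  · exact Or.inr (Or.inr (Or.inr (h.mono hU)))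

theorem not_mem_of_not_hit {e f : V} (hf : f ∈ E) (h : ¬ Hit E U (e + f)) : e ∉ U := fun he =>
  h ⟨f, hf, by simpa only [char_two V] using he⟩

theorem not_mem_of_not_hit' {e f : V} (he : e ∈ E) (h : ¬ Hit E U (e + f)) : f ∉ U := fun hf =>
  h ⟨e, he, by simpa only [char_two V] using hf⟩

theorem add_not_mem_of_not_hit {x : V} (hU : ∃ a ∈ E, a ∈ U) (h : ¬ Hit E U x) : x ∉ U :=
  fun hx => by
    obtain ⟨a, ha, haU⟩ := hU
    exact h ⟨a, ha, U.add_mem haU hx⟩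

/-- A coset of the larger subspace splits into four distinct cosets of `U`. -/
theorem card_cls_ext2 {u v x : V} (hu : u ∉ U) (hv : v ∉ U) (huv : u + v ∉ U) :
    (cls E (ext2 U u v) x).card = (cls E U x).card + (cls E U (x + u)).card +
      (cls E U (x + v)).card + (cls E U (x + u + v)).card := by
  classical
  have h1 : cls E (ext2 U u v) x =
      ((cls E U x ∪ cls E U (x + u)) ∪ cls E U (x + v)) ∪ cls E U (x + u + v) := by
    ext e
    simp only [mem_cls, mem_ext2, Finset.mem_union, ← and_or_left, or_assoc, add_assoc]
  have key : ∀ y z : V, y + z ∉ U → Disjoint (cls E U y) (cls E U z) := by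
    intro y z hyz
    rw [Finset.disjoint_left]
    intro e he he'
    exact hyz (by simpa only [char_two V] using U.add_mem (mem_cls.1 he).2 (mem_cls.1 he').2)
  rw [h1, Finset.card_union_of_disjoint, Finset.card_union_of_disjoint,
    Finset.card_union_of_disjoint]
  · exact key _ _ (by simpa only [char_two V] using hu)
  · rw [Finset.disjoint_union_left]
    exact ⟨key _ _ (by simpa only [char_two V] using hv),
      key _ _ (by simpa only [char_two V] using huv)⟩
  · simp only [Finset.disjoint_union_left]
    exact ⟨⟨key _ _ (by simpa only [char_two V] using huv),
      key _ _ (by simpa only [char_two V] using hv)⟩,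
      key _ _ (by simpa only [char_two V] using hu)⟩

/-- Of the three nontrivial cosets of `U` in the larger subspace, that of `u + v` contains no point
of `E`. -/
theorem card_outside_ext2 {u v : V} (hU : ∃ a ∈ E, a ∈ U) (hu : u ∈ E) (hv : v ∈ E)
    (huv : ¬ Hit E U (u + v)) :
    (outside E U).card =
      (cls E U u).card + (cls E U v).card + (outside E (ext2 U u v)).card := by
  classical
  have hu' := not_mem_of_not_hit hv huv
  have hv' := not_mem_of_not_hit' hu huv
  have huv' := add_not_mem_of_not_hit hU huv
  have h1 : outside E U = (cls E U u ∪ cls E U v) ∪ outside E (ext2 U u v) := by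
    ext e
    simp only [mem_outside, mem_ext2, Finset.mem_union, mem_cls, ← and_or_left]
    refine and_congr_right fun he => ?_
    have h3 : e + u + v ∉ U := fun h => huv ⟨e, he, by rwa [← add_assoc]⟩
    have h4 : e + u ∈ U → e ∉ U := fun h h' =>
      hu' (by simpa only [char_two V] using U.add_mem h h')
    have h5 : e + v ∈ U → e ∉ U := fun h h' =>
      hv' (by simpa only [char_two V] using U.add_mem h h')
    tauto
  rw [h1, Finset.card_union_of_disjoint, Finset.card_union_of_disjoint]
  · rw [Finset.disjoint_left]
    intro e he he'
    exact huv' (by simpa only [char_two V] using U.add_mem (mem_cls.1 he).2 (mem_cls.1 he').2)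
  · rw [Finset.disjoint_left]
    intro e he he'
    have h := (mem_outside.1 he').2
    rw [mem_ext2] at h
    rcases Finset.mem_union.1 he with h' | h'
    · exact h (Or.inr (Or.inl (mem_cls.1 h').2))
    · exact h (Or.inr (Or.inr (Or.inl (mem_cls.1 h').2)))

/-- The cosets that meet `E` are closed under addition, so they form a subspace of the quotient; it
contains the image of the spanning set `E`. -/
theorem forall_hit_of_forall_hit_add (hspan : Submodule.span (ZMod 2) (E : Set V) = ⊤)
    (hU : ∃ a ∈ E, a ∈ U) (h : ∀ e ∈ E, ∀ f ∈ E, Hit E U (e + f)) (x : V) : Hit E U x := by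
  have hx : x ∈ Submodule.span (ZMod 2) (E : Set V) := hspan ▸ Submodule.mem_top
  obtain ⟨a, ha, haU⟩ := hU
  induction hx using Submodule.span_induction with
  | mem x hx => exact hit_self hx
  | zero => exact ⟨a, ha, by simpa using haU⟩
  | add x y _ _ hx hy =>
    obtain ⟨e, he, hex⟩ := hx
    obtain ⟨f, hf, hfy⟩ := hy
    refine (h e he f hf).congr ?_
    simpa only [char_two V] using U.add_mem hex hfy
  | smul c x _ hx =>
    obtain rfl | rfl : c = 0 ∨ c = 1 := by revert c; decide
    · exact ⟨a, ha, by simpa using haU⟩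
    · simpa using hx

/-! ### Counting points outside a subspace without free triples -/

variable [FiniteDimensional (ZMod 2) V]

theorem finrank_ext2 {u v : V} (hu : u ∉ U) (hv : v ∉ U) (huv : u + v ∉ U) :
    finrank (ZMod 2) (ext2 U u v) = finrank (ZMod 2) U + 2 := by
  have h1 : v ∉ U ⊔ (ZMod 2) ∙ u := by
    rw [mem_sup_span_singleton_iff, not_or, add_comm v u]; exact ⟨hv, huv⟩
  rw [ext2, Submodule.finrank_sup_span_singleton h1, Submodule.finrank_sup_span_singleton hu]

theorem mul_le_card_outside {k p : ℕ} (hk : finrank (ZMod 2) V = finrank (ZMod 2) U + k)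
    (h : ∀ x ∉ U, p ≤ (cls E U x).card) : p * (2 ^ k - 1) ≤ (outside E U).card := by
  classical
  have : Finite V := Module.finite_of_finite (ZMod 2)
  have : Finite (V ⧸ U) := Module.finite_of_finite (ZMod 2)
  have : Fintype (V ⧸ U) := Fintype.ofFinite _
  have hc : Fintype.card (V ⧸ U) = 2 ^ k := by
    rw [Module.card_eq_pow_finrank (K := ZMod 2), ZMod.card]
    congr 1
    have := U.finrank_quotient_add_finrank
    omega
  have h1 : (outside E U).card = ∑ b ∈ Finset.univ.erase (0 : V ⧸ U),
      {e ∈ outside E U | U.mkQ e = b}.card := by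
    apply Finset.card_eq_sum_card_fiberwise
    intro e he
    simpa using (mem_outside.1 he).2
  rw [h1]
  have h2 : (Finset.univ.erase (0 : V ⧸ U)).card • p ≤ ∑ b ∈ Finset.univ.erase (0 : V ⧸ U),
      {e ∈ outside E U | U.mkQ e = b}.card := by
    apply Finset.card_nsmul_le_sum
    intro b hb
    obtain ⟨x, rfl⟩ := U.mkQ_surjective b
    have hx : x ∉ U := by simpa using hb
    refine (h x hx).trans (Finset.card_le_card ?_)
    intro e he
    have he' := mem_cls.1 he
    simp only [Finset.mem_filter, mem_outside, Submodule.mkQ_apply, Submodule.Quotient.eq,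
      ZModModule.sub_eq_add]
    exact ⟨⟨he'.1, fun h => hx (by simpa only [char_two V] using U.add_mem h he'.2)⟩, he'.2⟩
  rw [Finset.card_erase_of_mem (Finset.mem_univ _), Finset.card_univ, hc, smul_eq_mul,
    mul_comm] at h2
  exact h2

/-- A weighted version of the lower bound of Nelson and Norin for simple binary matroids without
three-element independent flats. -/
theorem weighted_lower_bound (hspan : Submodule.span (ZMod 2) (E : Set V) = ⊤) :
    ∀ (k : ℕ) (U : Submodule (ZMod 2) V) (p q : ℕ), finrank (ZMod 2) V = finrank (ZMod 2) U + k →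
      (∃ a ∈ E, a ∈ U) → NoFreeTriple E U → (∀ e ∈ E, e ∉ U → p ≤ (cls E U e).card) →
      (∀ e ∈ E, ∀ f ∈ E, ¬ Hit E U (e + f) → p + q ≤ (cls E U e).card + (cls E U f).card) →
      ∃ α β, α + β = k ∧ p * 2 ^ α + q * 2 ^ β ≤ (outside E U).card + p + q ∧
        ((∃ e ∈ E, ∃ f ∈ E, ¬ Hit E U (e + f)) → 1 ≤ β) := by
  intro k
  induction k using Nat.strong_induction_on with
  | _ k ih =>
  intro U p q hk hU h3 h1 h2
  by_cases hex : ∃ e ∈ E, ∃ f ∈ E, ¬ Hit E U (e + f)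
  -- Adjoin a nonadjacent pair `u`, `v`. For `e` outside the new subspace, the absence of free
  -- triples makes one of `e + u`, `e + v`, `e + u + v` meet `E`, so its coset contains a second
  -- coset of `U` meeting `E`, and the weights double.
  · obtain ⟨u, hu, v, hv, huv⟩ := hex
    have hu' := not_mem_of_not_hit hv huv
    have hv' := not_mem_of_not_hit' hu huv
    have huv' := add_not_mem_of_not_hit hU huv
    have hr := finrank_ext2 hu' hv' huv'
    have hle : finrank (ZMod 2) (ext2 U u v) ≤ finrank (ZMod 2) V := Submodule.finrank_le _
    have hcard : ∀ e ∈ E, e ∉ ext2 U u v → ¬ Hit E U (e + u) → ¬ Hit E U (e + v) →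
        Hit E U (e + u + v) := by
      intro e he _ h4 h5
      rcases h3 e he u hu v hv with h | h | h | h
      · exact absurd h h4
      · exact absurd h h5
      · exact absurd h huv
      · exact h
    have hw : ∀ x, Hit E U x → x ∉ U → p ≤ (cls E U x).card := by
      rintro x ⟨e, he, hex⟩ hx
      rw [← cls_congr hex]
      exact h1 e he fun h => hx (by simpa only [char_two V] using U.add_mem h hex)
    -- a second coset inside every coset of the larger subspace
    have hsnd : ∀ e ∈ E, e ∉ ext2 U u v → ∃ y, Hit E U y ∧ y + e ∈ ext2 U u v ∧
        (cls E U e).card + (cls E U y).card ≤ (cls E (ext2 U u v) e).card ∧ y ∉ U := by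
      intro e he heU
      have heU' := heU
      rw [mem_ext2] at heU'
      push Not at heU'
      rw [card_cls_ext2 hu' hv' huv']
      by_cases h4 : Hit E U (e + u)
      · exact ⟨e + u, h4, mem_ext2.2 (Or.inr (Or.inl (by simp only [char_two V, U.zero_mem]))),
          by omega, heU'.2.1⟩
      by_cases h5 : Hit E U (e + v)
      · exact ⟨e + v, h5, mem_ext2.2 (Or.inr (Or.inr (Or.inl
          (by simp only [char_two V, U.zero_mem])))), by omega, heU'.2.2.1⟩
      exact ⟨e + u + v, hcard e he heU h4 h5, mem_ext2.2 (Or.inr (Or.inr (Or.inr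
          (by simp only [char_two V, U.zero_mem])))), by omega, heU'.2.2.2⟩
    obtain ⟨α, β, hαβ, hle', -⟩ := ih (k - 2) (by omega) (ext2 U u v) (2 * p) (2 * q)
      (by omega) (by obtain ⟨a, ha, haU⟩ := hU; exact ⟨a, ha, le_ext2 U u v haU⟩)
      (h3.mono (le_ext2 U u v))
      (by
        intro e he heU
        obtain ⟨y, hy, -, hc, hyU⟩ := hsnd e he heU
        have := hw y hy hyU
        have := h1 e he fun h => heU (le_ext2 U u v h)
        omega)
      -- Nonadjacency modulo the larger subspace passes to all cosets of `U` inside, so `e`, `f` and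
      -- the second cosets `y`, `z` give two nonadjacent pairs.
      (by
        intro e he f hf hef
        have hU' : ∃ a ∈ E, a ∈ ext2 U u v := by
          obtain ⟨a, ha, haU⟩ := hU; exact ⟨a, ha, le_ext2 U u v haU⟩
        obtain ⟨y, ⟨y', hy', hyy⟩, hye, hc, hyU⟩ := hsnd e he (not_mem_of_not_hit hf hef)
        obtain ⟨z, ⟨z', hz', hzz⟩, hzf, hc', hzU⟩ := hsnd f hf (not_mem_of_not_hit' he hef)
        have e1 := h2 e he f hf fun h => hef (h.mono (le_ext2 U u v))
        have e2 := h2 y' hy' z' hz' fun h => hef ((h.mono (le_ext2 U u v)).congr (by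
          simpa only [char_two V] using (ext2 U u v).add_mem
            ((ext2 U u v).add_mem (le_ext2 U u v hyy) hye)
            ((ext2 U u v).add_mem (le_ext2 U u v hzz) hzf)))
        rw [cls_congr hyy, cls_congr hzz] at e2
        omega)
    -- The cosets of `u` and `v` supply the `p + q` by which the doubled correction terms exceed the
    -- original ones.
    refine ⟨α + 1, β + 1, by omega, ?_, fun _ => by omega⟩
    have := h2 u hu v hv huv
    have hout := card_outside_ext2 hU hu hv huv
    rw [pow_succ, pow_succ]
    have e1 : p * (2 ^ α * 2) = 2 * p * 2 ^ α := by ring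
    have e2 : q * (2 ^ β * 2) = 2 * q * 2 ^ β := by ring
    omega
  -- If all pairs are adjacent, all `2 ^ k - 1` nonzero cosets meet `E`; with `β = 0` the `q` terms
  -- cancel.
  · refine ⟨k, 0, rfl, ?_, fun h => absurd h hex⟩
    push Not at hex
    have hall := forall_hit_of_forall_hit_add hspan hU hex
    have := mul_le_card_outside (E := E) hk (p := p) (by
      intro x hx
      obtain ⟨e, he, hex⟩ := hall x
      rw [← cls_congr hex]
      exact h1 e he fun h => hx (by simpa only [char_two V] using U.add_mem h hex))
    have h2k : 1 ≤ 2 ^ k := Nat.one_le_two_pow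
    have : p * (2 ^ k - 1) + p = p * 2 ^ k := by
      rw [← Nat.mul_succ]; congr 1; omega
    simp only [pow_zero, mul_one]
    omega

end BinMatroid

namespace BinMatroid
variable {V : Type*} [AddCommGroup V] [Module (ZMod 2) V]

/-! ### Five points of a triangle-free matroid without induced `I₅` -/

/-- No two points of `E` have their sum in `E`. -/
def SumFree (E : Finset V) : Prop := ∀ x ∈ E, ∀ y ∈ E, x + y ∉ E

/-- Among any five points of `E`, some three, four or five of them have their sum in `E`. -/
def FiveSum (E : Finset V) : Prop :=
  ∀ a ∈ E, ∀ b ∈ E, ∀ c ∈ E, ∀ d ∈ E, ∀ e ∈ E,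
    a + b + c ∈ E ∨ a + b + d ∈ E ∨ a + b + e ∈ E ∨ a + c + d ∈ E ∨ a + c + e ∈ E ∨
    a + d + e ∈ E ∨ b + c + d ∈ E ∨ b + c + e ∈ E ∨ b + d + e ∈ E ∨ c + d + e ∈ E ∨
    a + b + c + d ∈ E ∨ a + b + c + e ∈ E ∨ a + b + d + e ∈ E ∨ a + c + d + e ∈ E ∨
    b + c + d + e ∈ E ∨ a + b + c + d + e ∈ E

theorem TriangleFree.sumFree [FiniteDimensional (ZMod 2) V] {M : BinMatroid V} (hT : M.TriangleFree) {E : Finset V}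
    (hE : (E : Set V) = M.ground) : SumFree E := by
  intro x hx y hy hxy
  have h0 : (0 : V) ∉ E := by
    rw [← Finset.mem_coe, hE]; exact M.zero_notMem
  have hne : x ≠ y := by
    rintro rfl
    rw [ZModModule.add_self] at hxy
    exact h0 hxy
  have hx0 : x ≠ 0 := by rintro rfl; exact h0 hx
  have hyx : y ∉ (ZMod 2) ∙ x := by
    intro h
    obtain ⟨c, rfl⟩ := Submodule.mem_span_singleton.1 h
    obtain rfl | rfl : c = 0 ∨ c = 1 := by clear h hxy hy hne; revert c; decide
    · rw [zero_smul] at hy; exact h0 hy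
    · rw [one_smul] at hne; exact hne rfl
  apply hT ((ZMod 2) ∙ x ⊔ (ZMod 2) ∙ y)
  · rw [Submodule.finrank_sup_span_singleton hyx, finrank_span_singleton hx0]
  · rintro z ⟨hz, hz0⟩
    rw [← hE, Finset.mem_coe]
    rw [SetLike.mem_coe, mem_sup_span_singleton_iff] at hz
    have key : ∀ w ∈ (ZMod 2) ∙ x, w = 0 ∨ w = x := by
      intro w hw
      obtain ⟨c, rfl⟩ := Submodule.mem_span_singleton.1 hw
      obtain rfl | rfl : c = 0 ∨ c = 1 := by clear hw; revert c; decide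
      · left; simp
      · right; simp
    rcases hz with hz | hz
    · rcases key _ hz with rfl | rfl
      · exact absurd rfl hz0
      · exact hx
    · rcases key _ hz with h | h
      · rw [add_eq_zero_iff_eq_of_char_two] at h; rwa [h]
      · have : z = x + y := by rw [← h]; simp only [char_two V]
        rwa [this]

/-- A vanishing sum of three or more of the points makes a shorter sum equal to a point of `E`, and
a vanishing sum of two makes a sum of three equal to a point of `E`. Both are excluded. -/
theorem SumFree.eq_zero_of_sum_eq_zero {E : Finset V} (hS : SumFree E) (h0 : (0 : V) ∉ E)
    {a b c d e : V} (ha : a ∈ E) (hb : b ∈ E) (hc : c ∈ E) (hd : d ∈ E) (he : e ∈ E)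
    (n1 : a + b + c ∉ E) (n2 : a + b + d ∉ E) (n3 : a + b + e ∉ E) (n4 : a + c + d ∉ E)
    (n7 : b + c + d ∉ E) (n9 : b + d + e ∉ E) (n10 : c + d + e ∉ E)
    (n11 : a + b + c + d ∉ E) (g0 g1 g2 g3 g4 : ZMod 2)
    (h : g0 • a + g1 • b + g2 • c + g3 • d + g4 • e = 0) :
    g0 = 0 ∧ g1 = 0 ∧ g2 = 0 ∧ g3 = 0 ∧ g4 = 0 := by
  have z : ∀ {x y : V}, x ∉ E → y ∈ E → x + y ≠ 0 := fun hx hy h =>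
    hx (by rwa [add_eq_zero_iff_eq_of_char_two.1 h])
  have z1 : ∀ {x : V}, x ∈ E → x ≠ 0 := fun hx h => h0 (h ▸ hx)
  have z2 : ∀ {x y w : V}, x + y + w ∉ E → w ∈ E → x + y ≠ 0 := fun hx hw h =>
    hx (by rwa [h, zero_add])
  have m1 := z1 ha
  have m2 := z1 hb
  have m3 := z1 hc
  have m4 := z1 hd
  have m5 := z1 he
  have q1 := z2 n1 hc
  have q2 : a + c ≠ 0 := z2 (by rwa [add_right_comm]) hb
  have q3 : a + d ≠ 0 := z2 (by rwa [add_right_comm]) hb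
  have q4 : a + e ≠ 0 := z2 (by rwa [add_right_comm]) hb
  have q5 : b + c ≠ 0 := z2 n7 hd
  have q6 : b + d ≠ 0 := z2 n9 he
  have q7 : b + e ≠ 0 := z2 (by rwa [add_right_comm]) hd
  have q8 : c + d ≠ 0 := z2 n10 he
  have q9 : c + e ≠ 0 := z2 (by rwa [add_right_comm]) hd
  have q10 : d + e ≠ 0 := z2 (w := c) (by rwa [add_comm, ← add_assoc]) hc
  have t1 := z (hS a ha b hb) hc
  have t2 := z (hS a ha b hb) hd
  have t3 := z (hS a ha b hb) he
  have t4 := z (hS a ha c hc) hd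
  have t5 := z (hS a ha c hc) he
  have t6 := z (hS a ha d hd) he
  have t7 := z (hS b hb c hc) hd
  have t8 := z (hS b hb c hc) he
  have t9 := z (hS b hb d hd) he
  have t10 := z (hS c hc d hd) he
  have r1 := z n1 hd
  have r2 := z n1 he
  have r3 := z n2 he
  have r4 := z n4 he
  have r5 := z n7 he
  have s1 := z n11 he
  have key : ∀ g : ZMod 2, g = 0 ∨ g = 1 := by decide
  rcases key g0 with rfl | rfl <;> rcases key g1 with rfl | rfl <;>
    rcases key g2 with rfl | rfl <;> rcases key g3 with rfl | rfl <;>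
    rcases key g4 with rfl | rfl <;>
    simp only [zero_smul, one_smul, zero_add, add_zero] at h <;>
    first
      | exact ⟨rfl, rfl, rfl, rfl, rfl⟩
      | exact absurd h ‹_›

/-- Sums of two points are excluded by `SumFree`, longer ones by `hcon`. Hence the span of the five
points meets `E` in these points only. -/
theorem SumFree.exists_eq_single {E : Finset V} (hS : SumFree E) (h0 : (0 : V) ∉ E)
    {a b c d e : V} (ha : a ∈ E) (hb : b ∈ E) (hc : c ∈ E) (hd : d ∈ E) (he : e ∈ E)
    (hcon : ¬ (a + b + c ∈ E ∨ a + b + d ∈ E ∨ a + b + e ∈ E ∨ a + c + d ∈ E ∨ a + c + e ∈ E ∨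
    a + d + e ∈ E ∨ b + c + d ∈ E ∨ b + c + e ∈ E ∨ b + d + e ∈ E ∨ c + d + e ∈ E ∨
    a + b + c + d ∈ E ∨ a + b + c + e ∈ E ∨ a + b + d + e ∈ E ∨ a + c + d + e ∈ E ∨
    b + c + d + e ∈ E ∨ a + b + c + d + e ∈ E)) (g0 g1 g2 g3 g4 : ZMod 2)
    (h : g0 • a + g1 • b + g2 • c + g3 • d + g4 • e ∈ E) :
    ∃ i : Fin 5, ![g0, g1, g2, g3, g4] = Pi.single i 1 := by
  push Not at hcon
  obtain ⟨n1, n2, n3, n4, n5, n6, n7, n8, n9, n10, n11, n12, n13, n14, n15, n16⟩ := hcon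
  have t1 := hS a ha b hb
  have t2 := hS a ha c hc
  have t3 := hS a ha d hd
  have t4 := hS a ha e he
  have t5 := hS b hb c hc
  have t6 := hS b hb d hd
  have t7 := hS b hb e he
  have t8 := hS c hc d hd
  have t9 := hS c hc e he
  have t10 := hS d hd e he
  have hk : (g0 = 1 ∧ g1 = 0 ∧ g2 = 0 ∧ g3 = 0 ∧ g4 = 0) ∨
      (g0 = 0 ∧ g1 = 1 ∧ g2 = 0 ∧ g3 = 0 ∧ g4 = 0) ∨
      (g0 = 0 ∧ g1 = 0 ∧ g2 = 1 ∧ g3 = 0 ∧ g4 = 0) ∨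
      (g0 = 0 ∧ g1 = 0 ∧ g2 = 0 ∧ g3 = 1 ∧ g4 = 0) ∨
      (g0 = 0 ∧ g1 = 0 ∧ g2 = 0 ∧ g3 = 0 ∧ g4 = 1) := by
    have key : ∀ g : ZMod 2, g = 0 ∨ g = 1 := by decide
    rcases key g0 with rfl | rfl <;> rcases key g1 with rfl | rfl <;>
      rcases key g2 with rfl | rfl <;> rcases key g3 with rfl | rfl <;>
      rcases key g4 with rfl | rfl <;>
      simp only [zero_smul, one_smul, zero_add, add_zero] at h <;>
      first
        | exact absurd h ‹_›
        | decide
  obtain ⟨rfl, rfl, rfl, rfl, rfl⟩ | ⟨rfl, rfl, rfl, rfl, rfl⟩ | ⟨rfl, rfl, rfl, rfl, rfl⟩ |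
    ⟨rfl, rfl, rfl, rfl, rfl⟩ | ⟨rfl, rfl, rfl, rfl, rfl⟩ := hk
  · exact ⟨0, by ext j; fin_cases j <;> rfl⟩
  · exact ⟨1, by ext j; fin_cases j <;> rfl⟩
  · exact ⟨2, by ext j; fin_cases j <;> rfl⟩
  · exact ⟨3, by ext j; fin_cases j <;> rfl⟩
  · exact ⟨4, by ext j; fin_cases j <;> rfl⟩

theorem IsFree.fiveSum [FiniteDimensional (ZMod 2) V] {M : BinMatroid V}
    (hI : M.IsFree (BinMatroid.indep 5))
    (hT : M.TriangleFree) {E : Finset V} (hE : (E : Set V) = M.ground) : FiveSum E := by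
  have hS := hT.sumFree hE
  have h0 : (0 : V) ∉ E := by
    rw [← Finset.mem_coe, hE]; exact M.zero_notMem
  intro a ha b hb c hc d hd e he
  by_contra hcon
  have p2 := hS.exists_eq_single h0 ha hb hc hd he hcon
  have p1 : ∀ g0 g1 g2 g3 g4 : ZMod 2,
      g0 • a + g1 • b + g2 • c + g3 • d + g4 • e = 0 →
      g0 = 0 ∧ g1 = 0 ∧ g2 = 0 ∧ g3 = 0 ∧ g4 = 0 := by
    push Not at hcon
    obtain ⟨n1, n2, n3, n4, n5, n6, n7, n8, n9, n10, n11, n12, n13, n14, n15, n16⟩ := hcon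
    exact hS.eq_zero_of_sum_eq_zero h0 ha hb hc hd he n1 n2 n3 n4 n7 n9 n10 n11
  let v : Fin 5 → V := ![a, b, c, d, e]
  have hv : ∀ i, v i ∈ E := by
    intro i; fin_cases i <;> assumption
  have hli : LinearIndependent (ZMod 2) v := by
    rw [Fintype.linearIndependent_iff]
    intro g hg
    rw [Fin.sum_univ_five] at hg
    obtain ⟨k0, k1, k2, k3, k4⟩ := p1 _ _ _ _ _ hg
    intro i; fin_cases i <;> assumption
  apply hI (Submodule.span (ZMod 2) (Set.range v))
  refine ⟨(Basis.span hli).equivFun, ?_⟩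
  have hsum : ∀ y : Submodule.span (ZMod 2) (Set.range v),
      ∑ i, (Basis.span hli).equivFun y i • v i = y := by
    intro y
    have := congrArg Subtype.val ((Basis.span hli).sum_equivFun y)
    rw [← this]
    simp [Basis.span_apply]
  ext g
  constructor
  · rintro ⟨y, hy, rfl⟩
    have hy' : (y : V) ∈ E := by
      rw [← Finset.mem_coe, hE]; exact hy
    rw [← hsum y, Fin.sum_univ_five] at hy'
    obtain ⟨i, hi⟩ := p2 _ _ _ _ _ hy'
    refine ⟨i, hi.symm.trans ?_⟩
    ext j
    fin_cases j <;> rfl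
  · rintro ⟨i, rfl⟩
    refine ⟨Basis.span hli i, ?_, ?_⟩
    · show ((Basis.span hli i : Submodule.span (ZMod 2) (Set.range v)) : V) ∈ M.ground
      rw [Basis.span_apply, ← hE]
      exact hv i
    · ext j
      simp [Finsupp.single_apply, Pi.single_apply, eq_comm]

/-! ### Covering a vector space by three proper subspaces -/

/-- Translation by `x ∈ A` outside `B ∪ C` moves vectors of `B` outside `A` into `C`. If two such
vectors had their sum outside `A`, then adding the three translates would put `x` into `C`. -/
theorem add_mem_of_cover {W : Type*} [AddCommGroup W] [Module (ZMod 2) W]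
    {A B C : Submodule (ZMod 2) W} (hcov : ∀ x, x ∈ A ∨ x ∈ B ∨ x ∈ C) (hB : B ≠ ⊤) (hC : C ≠ ⊤)
    {v w : W} (hv : v ∉ A) (hw : w ∉ A) : v + w ∈ A := by
  -- a vector outside of `B ∪ C`
  obtain ⟨x, hxB, hxC⟩ : ∃ x, x ∉ B ∧ x ∉ C := by
    obtain ⟨b, hb⟩ : ∃ b, b ∉ B := by
      by_contra h; push Not at h; exact hB (Submodule.eq_top_iff'.2 h)
    obtain ⟨c, hc⟩ : ∃ c, c ∉ C := by
      by_contra h; push Not at h; exact hC (Submodule.eq_top_iff'.2 h)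
    by_cases hbC : b ∈ C
    · by_cases hcB : c ∈ B
      · refine ⟨b + c, fun h => hb ?_, fun h => hc ?_⟩
        · simpa only [char_two W] using B.add_mem h hcB
        · simpa only [char_two W] using C.add_mem h hbC
      · exact ⟨c, hcB, hc⟩
    · exact ⟨b, hb, hbC⟩
  have hxA : x ∈ A := by have := hcov x; tauto
  have both : ∀ v w, v ∉ A → w ∉ A → v ∈ B → w ∈ B → v + w ∈ A := by
    intro v w hv hw hvB hwB
    have h1 : ∀ y, y ∉ A → y ∈ B → x + y ∈ C := by
      intro y hy hyB
      have e1 : x + y ∉ A := fun h => hy (by simpa only [char_two W] using A.add_mem h hxA)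
      have e2 : x + y ∉ B := fun h => hxB (by simpa only [char_two W] using B.add_mem h hyB)
      have := hcov (x + y); tauto
    by_contra hvw
    have e1 := h1 _ hvw (B.add_mem hvB hwB)
    have e2 := h1 _ hv hvB
    have e3 := h1 _ hw hwB
    exact hxC (by simpa only [char_two W] using C.add_mem e1 (C.add_mem e2 e3))
  have toB : ∀ v, v ∉ A → ∃ v' ∉ A, v' ∈ B ∧ v + v' ∈ A := by
    intro v hv
    by_cases hvB : v ∈ B
    · exact ⟨v, hv, hvB, by simp only [char_two W, A.zero_mem]⟩
    · have hvC : v ∈ C := by have := hcov v; tauto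
      have e1 : v + x ∉ A := fun h => hv (by simpa only [char_two W] using A.add_mem h hxA)
      have e2 : v + x ∉ C := fun h => hxC (by simpa only [char_two W] using C.add_mem h hvC)
      refine ⟨v + x, e1, ?_, by simpa only [char_two W] using hxA⟩
      have := hcov (v + x); tauto
  obtain ⟨v', hv', hvB, hvv⟩ := toB v hv
  obtain ⟨w', hw', hwB, hww⟩ := toB w hw
  simpa only [char_two W] using
    A.add_mem (both v' w' hv' hw' hvB hwB) (A.add_mem hvv hww)

end BinMatroid

namespace BinMatroid
variable {V : Type*} [AddCommGroup V] [Module (ZMod 2) V]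

/-! ### Maximal affine geometries -/

/-- The flat spanned by the coset `a + W`. -/
def flat (W : Submodule (ZMod 2) V) (a : V) : Submodule (ZMod 2) V := W ⊔ (ZMod 2) ∙ a

theorem mem_flat {W : Submodule (ZMod 2) V} {a x : V} : x ∈ flat W a ↔ x ∈ W ∨ x + a ∈ W :=
  mem_sup_span_singleton_iff

theorem le_flat (W : Submodule (ZMod 2) V) (a : V) : W ≤ flat W a := le_sup_left

theorem base_mem_flat (W : Submodule (ZMod 2) V) (a : V) : a ∈ flat W a :=
  le_sup_right (a := W) (Submodule.mem_span_singleton_self a)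

/-- `a + W` is an affine geometry of largest dimension contained in `E`, where `E` is the ground
set of a triangle-free matroid without induced `I₅`. -/
structure Frame (E : Finset V) (W : Submodule (ZMod 2) V) (a : V) : Prop where
  sumFree : SumFree E
  fiveSum : FiveSum E
  affine : ∀ w ∈ W, a + w ∈ E
  maximal : ∀ (b : V) (W' : Submodule (ZMod 2) V), (∀ w ∈ W', b + w ∈ E) →
    finrank (ZMod 2) W' ≤ finrank (ZMod 2) W

/-- The vectors of `W` that leave the part of `E` in `x + flat W a` invariant. -/
def stab (E : Finset V) (W : Submodule (ZMod 2) V) (a x : V) : Submodule (ZMod 2) V where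
  carrier := {u | u ∈ W ∧ ∀ e ∈ E, e + x ∈ flat W a → e + u ∈ E}
  zero_mem' := ⟨W.zero_mem, fun e he _ => by rwa [add_zero]⟩
  add_mem' := by
    rintro u v ⟨hu, hu'⟩ ⟨hv, hv'⟩
    refine ⟨W.add_mem hu hv, fun e he hex => ?_⟩
    rw [← add_assoc]
    exact hv' _ (hu' e he hex) (by
      simpa only [char_two V] using (flat W a).add_mem hex (le_flat W a hu))
  smul_mem' := by
    rintro c u ⟨hu, hu'⟩
    obtain rfl | rfl : c = 0 ∨ c = 1 := by revert c; decide
    · rw [zero_smul]; exact ⟨W.zero_mem, fun e he _ => by rwa [add_zero]⟩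
    · rw [one_smul]; exact ⟨hu, hu'⟩

/-- The vectors `w` of `W` with `y + w ∈ E`. -/
noncomputable def slice [FiniteDimensional (ZMod 2) V] (E : Finset V)
    (W : Submodule (ZMod 2) V) (y : V) : Finset V :=
  (cls E W y).map (addRightEmbedding y)

/-- A version of `add_mem_of_cover` for a subspace covered by three subspaces. -/
theorem add_mem_of_subset_cover {W A B C : Submodule (ZMod 2) V}
    (hcov : ∀ x ∈ W, x ∈ A ∨ x ∈ B ∨ x ∈ C) (hB : ∃ x ∈ W, x ∉ B) (hC : ∃ x ∈ W, x ∉ C)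
    {v w : V} (hv : v ∈ W) (hw : w ∈ W) (hvA : v ∉ A) (hwA : w ∉ A) : v + w ∈ A := by
  have := add_mem_of_cover (W := W) (A := A.comap W.subtype) (B := B.comap W.subtype)
    (C := C.comap W.subtype) (fun x => hcov x x.2)
    (by obtain ⟨x, hx, hxB⟩ := hB
        exact fun h => hxB (Submodule.eq_top_iff'.1 h ⟨x, hx⟩))
    (by obtain ⟨x, hx, hxB⟩ := hC
        exact fun h => hxB (Submodule.eq_top_iff'.1 h ⟨x, hx⟩))
    (v := ⟨v, hv⟩) (w := ⟨w, hw⟩) hvA hwA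
  exact this

section slice
variable [FiniteDimensional (ZMod 2) V] {E : Finset V} {W : Submodule (ZMod 2) V} {a : V}

theorem mem_slice {y w : V} : w ∈ slice E W y ↔ w ∈ W ∧ y + w ∈ E := by
  simp only [slice, Finset.mem_map, mem_cls, addRightEmbedding_apply]
  constructor
  · rintro ⟨e, ⟨he, hw⟩, rfl⟩
    exact ⟨hw, by simpa only [char_two V] using he⟩
  · rintro ⟨hw, he⟩
    exact ⟨y + w, ⟨he, by simpa only [char_two V] using hw⟩, by simp only [char_two V]⟩

theorem card_slice_le {x y : V} (hxy : y + x ∈ flat W a) :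
    (slice E W y).card ≤ (cls E (flat W a) x).card := by
  classical
  refine Finset.card_le_card_of_injOn (y + ·) ?_ (fun _ _ _ _ h => add_left_cancel h)
  intro w hw
  rw [Finset.mem_coe, mem_slice] at hw
  rw [Finset.mem_coe, mem_cls]
  exact ⟨hw.2, by simpa only [char_two V] using (flat W a).add_mem hxy (le_flat W a hw.1)⟩

/-- The points of a subspace as a finite set. -/
noncomputable def pts (W : Submodule (ZMod 2) V) : Finset V :=
  have : Finite V := Module.finite_of_finite (ZMod 2)
  (W : Set V).toFinite.toFinset

theorem mem_pts {w : V} : w ∈ pts W ↔ w ∈ W := by simp [pts]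

theorem card_pts : (pts W).card = 2 ^ finrank (ZMod 2) W := by
  have : Finite V := Module.finite_of_finite (ZMod 2)
  have : Fintype W := Fintype.ofFinite _
  rw [← Set.ncard_coe_finset]
  have : ((pts W : Finset V) : Set V) = W := by ext; simp [mem_pts]
  rw [this, ← Nat.card_coe_set_eq]
  change Nat.card W = _
  rw [Module.natCard_eq_pow_finrank (K := ZMod 2), Nat.card_zmod]

theorem pts_mono {W' : Submodule (ZMod 2) V} (h : W ≤ W') : pts W ⊆ pts W' := fun _ hx =>
  mem_pts.2 (h (mem_pts.1 hx))

/-- A subspace `A` of `W` of index at most two contains at least half of the points. -/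
theorem card_pts_le_two_mul {A : Submodule (ZMod 2) V}
    (h : ∀ v ∈ W, ∀ w ∈ W, v ∉ A → w ∉ A → v + w ∈ A) :
    (pts W).card ≤ 2 * (pts A).card := by
  classical
  by_cases h0 : ∃ v ∈ W, v ∉ A
  · obtain ⟨v, hv, hvA⟩ := h0
    have hsub : pts W ⊆ pts A ∪ (pts A).image (v + ·) := by
      intro w hw
      rw [mem_pts] at hw
      rw [Finset.mem_union, mem_pts, Finset.mem_image]
      by_cases hwA : w ∈ A
      · exact Or.inl hwA
      · exact Or.inr ⟨v + w, mem_pts.2 (h v hv w hw hvA hwA), by simp only [char_two V]⟩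
    have h1 := Finset.card_le_card hsub
    have h2 := Finset.card_union_le (pts A) ((pts A).image (v + ·))
    have h3 : ((pts A).image (v + ·)).card ≤ (pts A).card := Finset.card_image_le
    omega
  · push Not at h0
    have := Finset.card_le_card (pts_mono h0)
    omega

end slice

/-! ### Consequences of maximality and of the five-point condition -/

namespace Frame
variable {E : Finset V} {W : Submodule (ZMod 2) V} {a : V}

theorem zero_not_mem (h : Frame E W a) : (0 : V) ∉ E := fun h0 =>
  h.sumFree 0 h0 0 h0 (by rwa [add_zero])

theorem base_mem (h : Frame E W a) : a ∈ E := by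
  simpa using h.affine 0 W.zero_mem

theorem exists_mem (h : Frame E W a) : ∃ b ∈ E, b ∈ flat W a :=
  ⟨a, h.base_mem, base_mem_flat W a⟩

theorem base_not_mem (h : Frame E W a) : a ∉ W := fun ha =>
  h.zero_not_mem (by simpa only [char_two V] using h.affine a ha)

theorem not_mem_of_mem (h : Frame E W a) {e : V} (he : e ∈ E) : e ∉ W := fun hW =>
  h.sumFree a h.base_mem e he (h.affine e hW)

/-- The other half of the flat is `a + W ⊆ E`, and a sum there would complete a triangle. So within
a coset of `flat W a`, the set `E` meets only one of the two cosets of `W`. -/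
theorem add_mem (h : Frame E W a) {e f : V} (he : e ∈ E) (hf : f ∈ E)
    (hef : e + f ∈ flat W a) : e + f ∈ W := by
  rcases mem_flat.1 hef with h1 | h1
  · exact h1
  · exfalso
    have h2 := h.affine _ h1
    exact h.sumFree e he f hf (by simpa only [char_two V] using h2)

/-- Otherwise `a + W` and `x + W` would together be a larger coset inside `E`, with direction space
spanned by `W` and `a + x`. -/
theorem exists_add_not_mem [FiniteDimensional (ZMod 2) V] (h : Frame E W a) {x : V}
    (hx : x ∉ flat W a) : ∃ w ∈ W, x + w ∉ E := by
  by_contra hcon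
  push Not at hcon
  have h1 : a + x ∉ W := fun h1 => hx (mem_flat.2 (Or.inr (by rwa [add_comm])))
  have h2 := h.maximal a (W ⊔ (ZMod 2) ∙ (a + x)) (by
    intro w hw
    rcases mem_sup_span_singleton_iff.1 hw with hw | hw
    · exact h.affine w hw
    · simpa only [char_two V] using hcon _ hw)
  rw [Submodule.finrank_sup_span_singleton h1] at h2
  omega

/-- The possible sums of `x`, `y`, `z` and two points of the affine geometry. -/
theorem fiveSum_affine (h : Frame E W a) {x y z u b : V} (hx : x ∈ E) (hy : y ∈ E) (hz : z ∈ E)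
    (hu : u ∈ W) (hb : b + a ∈ W) :
    (x + u ∈ E ∨ y + u ∈ E ∨ z + u ∈ E) ∨
    (x + y + u ∈ E ∨ x + y + b ∈ E ∨ x + y + b + u ∈ E) ∨
    (x + z + u ∈ E ∨ x + z + b ∈ E ∨ x + z + b + u ∈ E) ∨
    (y + z + u ∈ E ∨ y + z + b ∈ E ∨ y + z + b + u ∈ E) ∨
    (x + y + z ∈ E ∨ x + y + z + u ∈ E ∨ x + y + z + b ∈ E ∨ x + y + z + b + u ∈ E) := by
  have hb1 : b ∈ E := by simpa only [char_two V] using h.affine _ hb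
  have hb2 : b + u ∈ E := by simpa only [char_two V] using h.affine _ (W.add_mem hb hu)
  -- The last two points lie in `a + W` and differ by `u`.
  have := h.fiveSum x hx y hy z hz b hb1 (b + u) hb2
  simp only [char_two V] at this ⊢
  tauto

theorem fiveSum_of_not_hit (h : Frame E W a) {c s t u b : V} (hc : c ∈ E) (hs : s ∈ E)
    (ht : t ∈ E) (hst : ¬ Hit E (flat W a) (s + t)) (hstc : ¬ Hit E (flat W a) (s + t + c))
    (hu : u ∈ W) (hb : b + a ∈ W) :
    (c + u ∈ E ∨ s + u ∈ E ∨ t + u ∈ E) ∨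
    (s + c + u ∈ E ∨ s + c + b ∈ E ∨ s + c + b + u ∈ E) ∨
    (t + c + u ∈ E ∨ t + c + b ∈ E ∨ t + c + b + u ∈ E) := by
  have huF : u ∈ flat W a := le_flat W a hu
  have hbF : b ∈ flat W a := mem_flat.2 (Or.inr hb)
  have hbuF := (flat W a).add_mem hbF huF
  have key : ∀ x f, ¬ Hit E (flat W a) x → f ∈ flat W a → x + f ∉ E := fun x f hx hf hxf =>
    hx ⟨_, hxf, by simpa only [char_two V] using hf⟩
  have k1 := key _ _ hst huF
  have k2 := key _ _ hst hbF
  have k3 := key _ _ hst hbuF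
  have k4 := key _ _ hstc huF
  have k5 := key _ _ hstc hbF
  have k6 := key _ _ hstc hbuF
  have k7 := key _ _ hstc (flat W a).zero_mem
  have := h.fiveSum_affine hc hs ht hu hb
  simp only [char_two V] at this k1 k2 k3 k4 k5 k6 k7 ⊢
  tauto

theorem fiveSum_of_free (h : Frame E W a) {c s t u : V} (hc : c ∈ E) (hs : s ∈ E)
    (ht : t ∈ E) (hst : ¬ Hit E (flat W a) (s + t)) (hstc : ¬ Hit E (flat W a) (s + t + c))
    (hsc : ¬ Hit E (flat W a) (s + c)) (htc : ¬ Hit E (flat W a) (t + c)) (hu : u ∈ W) :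
    c + u ∈ E ∨ s + u ∈ E ∨ t + u ∈ E := by
  have huF : u ∈ flat W a := le_flat W a hu
  have hbF := base_mem_flat W a
  have hbuF := (flat W a).add_mem hbF huF
  have key : ∀ x f, ¬ Hit E (flat W a) x → f ∈ flat W a → x + f ∉ E := fun x f hx hf hxf =>
    hx ⟨_, hxf, by simpa only [char_two V] using hf⟩
  have k1 := key _ _ hsc huF
  have k2 := key _ _ hsc hbF
  have k3 := key _ _ hsc hbuF
  have k4 := key _ _ htc huF
  have k5 := key _ _ htc hbF
  have k6 := key _ _ htc hbuF
  have := h.fiveSum_of_not_hit (b := a) hc hs ht hst hstc hu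
    (by simp only [char_two V, W.zero_mem])
  simp only [char_two V] at this k1 k2 k3 k4 k5 k6 ⊢
  tauto

end Frame
end BinMatroid

namespace BinMatroid
variable {V : Type*} [AddCommGroup V] [Module (ZMod 2) V]

/-! ### Counting points in pairs of cosets -/

/-- The inequalities of `Frame.pairCond` between the numbers of points in two pairs of cosets. -/
def PairCond (M C S₀ S₁ T₀ T₁ : ℕ) : Prop :=
  (0 < S₀ → 0 < T₀ → (0 < S₁ ∨ 0 < T₁) ∧ (M ≤ 2 * S₁ + 2 * T₁ ∨ M + 2 ≤ C + S₀ + S₁ + T₀ + T₁)) ∧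
  (0 < S₁ → 0 < T₀ → (0 < S₀ ∨ 0 < T₁) ∧ (M ≤ 2 * S₀ + 2 * T₁ ∨ M + 2 ≤ C + S₀ + S₁ + T₀ + T₁)) ∧
  (0 < S₀ → 0 < T₁ → (0 < S₁ ∨ 0 < T₀) ∧ (M ≤ 2 * S₁ + 2 * T₀ ∨ M + 2 ≤ C + S₀ + S₁ + T₀ + T₁)) ∧
  (0 < S₁ → 0 < T₁ → (0 < S₀ ∨ 0 < T₀) ∧ (M ≤ 2 * S₀ + 2 * T₀ ∨ M + 2 ≤ C + S₀ + S₁ + T₀ + T₁))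

/-- Replaces the implications by four alternatives, which can then be combined over several
pairings. -/
theorem PairCond.bound {M C S₀ S₁ T₀ T₁ : ℕ} (h : PairCond M C S₀ S₁ T₀ T₁)
    (hS : 0 < S₀ + S₁) (hT : 0 < T₀ + T₁) :
    (M + 2 ≤ C + (S₀ + S₁) + (T₀ + T₁) ∧ ((0 < S₀ ∧ 0 < S₁) ∨ (0 < T₀ ∧ 0 < T₁))) ∨
    (0 < S₀ ∧ 0 < S₁ ∧ 0 < T₀ ∧ 0 < T₁ ∧ M ≤ (S₀ + S₁) + (T₀ + T₁)) ∨
    (0 < S₀ ∧ 0 < S₁ ∧ M ≤ S₀ + S₁) ∨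
    (0 < T₀ ∧ 0 < T₁ ∧ M ≤ T₀ + T₁) := by
  unfold PairCond at h
  omega

/-- The `Sᵢ` will count `E` in the cosets of `e`, `e + c`, `e + x`, `e + c + x`, and the `Tᵢ`
likewise for `f`. The conditions come from pairing cosets that differ by `c`. -/
theorem PairCond.add_two_le {M C S₀ S₁ S₂ S₃ T₀ T₁ T₂ T₃ : ℕ} (h0 : 0 < S₀) (h0' : 0 < T₀)
    (hS : 0 < S₁ + S₂ + S₃) (hT : 0 < T₁ + T₂ + T₃) (hSC : C ≤ S₀)
    (h : (0 < S₁ → C ≤ S₁) ∧ (0 < S₂ → C ≤ S₂) ∧ (0 < S₃ → C ≤ S₃) ∧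
      (0 < T₁ → C ≤ T₁) ∧ (0 < T₂ → C ≤ T₂) ∧ (0 < T₃ → C ≤ T₃) ∧ C ≤ T₀ ∧ (0 < S₂ ∨ 0 < T₂))
    (h1 : PairCond M C S₀ S₁ T₀ T₁) (h2 : PairCond M C S₀ S₁ T₂ T₃)
    (h3 : PairCond M C S₂ S₃ T₀ T₁) (h4 : PairCond M C S₂ S₃ T₂ T₃) :
    M + 2 ≤ S₀ + S₁ + S₂ + S₃ + T₀ + T₁ + T₂ + T₃ := by
  have k1 := h1.bound (by omega) (by omega)
  rcases Nat.eq_zero_or_pos (S₂ + S₃) with hs | hs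
  · rcases Nat.eq_zero_or_pos (T₂ + T₃) with ht | ht
    · omega
    · have k2 := h2.bound (by omega) ht
      clear h1 h2 h3 h4
      omega
  · have k3 := h3.bound hs (by omega)
    rcases Nat.eq_zero_or_pos (T₂ + T₃) with ht | ht
    · clear h1 h2 h3 h4
      omega
    · have k2 := h2.bound (by omega) ht
      have k4 := h4.bound hs ht
      clear h1 h2 h3 h4
      omega

/-- When `c` and `x` both have one-point cosets, the pairing by `x` is available besides that by
`c`, and the two together gain one more point. -/
theorem PairCond.add_three_le {M S₀ S₁ S₂ S₃ T₀ T₁ T₂ T₃ : ℕ} (hM : 4 ≤ M)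
    (h0 : 0 < S₀) (h0' : 0 < T₀)
    (hS : 0 < S₁ + S₂ + S₃) (hT : 0 < T₁ + T₂ + T₃)
    (h1 : PairCond M 1 S₀ S₁ T₀ T₁) (h2 : PairCond M 1 S₀ S₁ T₂ T₃)
    (h3 : PairCond M 1 S₂ S₃ T₀ T₁) (h4 : PairCond M 1 S₂ S₃ T₂ T₃)
    (h1' : PairCond M 1 S₀ S₂ T₀ T₂) (h2' : PairCond M 1 S₀ S₂ T₁ T₃)
    (h3' : PairCond M 1 S₁ S₃ T₀ T₂) (h4' : PairCond M 1 S₁ S₃ T₁ T₃) :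
    M + 3 ≤ S₀ + S₁ + S₂ + S₃ + T₀ + T₁ + T₂ + T₃ := by
  have k1 := h1.bound (by omega) (by omega)
  have k1' := h1'.bound (by omega) (by omega)
  rcases Nat.eq_zero_or_pos (S₂ + S₃) with hs | hs
  · rcases Nat.eq_zero_or_pos (T₂ + T₃) with ht | ht
    · clear h1 h2 h3 h4 h1' h2' h3' h4'
      omega
    · have k2 := h2.bound (by omega) ht
      have k3' := h3'.bound (by omega) (by omega)
      rcases Nat.eq_zero_or_pos (T₁ + T₃) with ht' | ht'
      · clear h1 h2 h3 h4 h1' h2' h3' h4'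
        omega
      · have k2' := h2'.bound (by omega) ht'
        have k4' := h4'.bound (by omega) ht'
        clear h1 h2 h3 h4 h1' h2' h3' h4'
        omega
  · have k3 := h3.bound hs (by omega)
    rcases Nat.eq_zero_or_pos (T₂ + T₃) with ht | ht
    · have k2' := h2'.bound (by omega) (by omega)
      rcases Nat.eq_zero_or_pos (S₁ + S₃) with ht' | ht'
      · clear h1 h2 h3 h4 h1' h2' h3' h4'
        omega
      · have k3' := h3'.bound (by omega) (by omega)
        have k4' := h4'.bound (by omega) (by omega)
        clear h1 h2 h3 h4 h1' h2' h3' h4'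
        omega
    · have k2 := h2.bound (by omega) ht
      have k4 := h4.bound hs ht
      rcases Nat.eq_zero_or_pos (S₁ + S₃) with hs' | hs' <;>
        rcases Nat.eq_zero_or_pos (T₁ + T₃) with ht' | ht'
      · clear h1 h2 h3 h4 h1' h2' h3' h4'
        omega
      · have k2' := h2'.bound (by omega) ht'
        clear h1 h2 h3 h4 h1' h2' h3' h4'
        omega
      · have k3' := h3'.bound hs' (by omega)
        clear h1 h2 h3 h4 h1' h2' h3' h4'
        omega
      · have k2' := h2'.bound (by omega) ht'
        have k3' := h3'.bound hs' (by omega)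
        have k4' := h4'.bound hs' ht'
        clear h1 h2 h3 h4 h1' h2' h3' h4'
        omega

/-! ### Stabilisers and counts for triples of cosets -/

variable {E : Finset V} {W : Submodule (ZMod 2) V} {a : V}

theorem mem_stab {x u : V} :
    u ∈ stab E W a x ↔ u ∈ W ∧ ∀ e ∈ E, e + x ∈ flat W a → e + u ∈ E := Iff.rfl

theorem stab_le (x : V) : stab E W a x ≤ W := fun _ h => h.1

theorem exists_of_not_mem_stab {x u : V} (hu : u ∈ W) (h : u ∉ stab E W a x) :
    ∃ e ∈ E, e + x ∈ flat W a ∧ e + u ∉ E := by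
  by_contra hcon
  push Not at hcon
  exact h ⟨hu, hcon⟩

theorem stab_congr {x y : V} (hxy : x + y ∈ flat W a) : stab E W a x = stab E W a y := by
  ext u
  simp only [mem_stab]
  refine and_congr_right fun _ => forall₂_congr fun e _ => ?_
  have : e + x ∈ flat W a ↔ e + y ∈ flat W a :=
    ⟨fun h => by simpa only [char_two V] using (flat W a).add_mem h hxy,
      fun h => by simpa only [char_two V] using (flat W a).add_mem h hxy⟩
  rw [this]

variable [FiniteDimensional (ZMod 2) V]

theorem card_stab_le {x : V} (hx : x ∈ E) :
    (pts (stab E W a x)).card ≤ (cls E (flat W a) x).card := by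
  refine Finset.card_le_card_of_injOn (x + ·) ?_ (fun _ _ _ _ h => add_left_cancel h)
  intro u hu
  rw [Finset.mem_coe, mem_pts, mem_stab] at hu
  rw [Finset.mem_coe, mem_cls]
  exact ⟨hu.2 x hx (by simp only [char_two V, zero_mem]), by
    simpa only [char_two V] using le_flat W a hu.1⟩

namespace Frame

theorem exists_not_mem_stab (h : Frame E W a) {x : V} (hx : x ∈ E) (hxF : x ∉ flat W a) :
    ∃ w ∈ W, w ∉ stab E W a x := by
  obtain ⟨w, hw, hxw⟩ := h.exists_add_not_mem hxF
  exact ⟨w, hw, fun hs => hxw (hs.2 x hx (by simp only [char_two V, zero_mem]))⟩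

-- A vector outside all three stabilisers moves some points `c'`, `s'`, `t'` of the three cosets out
-- of `E`, against `fiveSum_of_free`.
omit [FiniteDimensional (ZMod 2) V] in
theorem stab_cover (h : Frame E W a) {c s t u : V}
    (hst : ¬ Hit E (flat W a) (s + t)) (hstc : ¬ Hit E (flat W a) (s + t + c))
    (hsc : ¬ Hit E (flat W a) (s + c)) (htc : ¬ Hit E (flat W a) (t + c)) (hu : u ∈ W) :
    u ∈ stab E W a c ∨ u ∈ stab E W a s ∨ u ∈ stab E W a t := by
  by_contra hcon
  push Not at hcon
  obtain ⟨c', hc', hcF, hcu⟩ := exists_of_not_mem_stab hu hcon.1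
  obtain ⟨s', hs', hsF, hsu⟩ := exists_of_not_mem_stab hu hcon.2.1
  obtain ⟨t', ht', htF, htu⟩ := exists_of_not_mem_stab hu hcon.2.2
  have hstF := (flat W a).add_mem hsF htF
  have hscF := (flat W a).add_mem hsF hcF
  have htcF := (flat W a).add_mem htF hcF
  have hstcF := (flat W a).add_mem hstF hcF
  have := h.fiveSum_of_free hc' hs' ht' (u := u)
    (fun h => hst (h.congr (by simpa only [char_two V] using hstF)))
    (fun h => hstc (h.congr (by simpa only [char_two V] using hstcF)))
    (fun h => hsc (h.congr (by simpa only [char_two V] using hscF)))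
    (fun h => htc (h.congr (by simpa only [char_two V] using htcF))) hu
  tauto

/-- Three points of `E` that are independent and free modulo the flat spanned by the affine
geometry have stabilisers of index two. -/
theorem card_pts_le_two_mul_stab (h : Frame E W a) {c s t : V}
    (hs : s ∈ E) (ht : t ∈ E)
    (hst : ¬ Hit E (flat W a) (s + t)) (hstc : ¬ Hit E (flat W a) (s + t + c))
    (hsc : ¬ Hit E (flat W a) (s + c)) (htc : ¬ Hit E (flat W a) (t + c)) :
    (pts W).card ≤ 2 * (pts (stab E W a c)).card := by
  apply card_pts_le_two_mul
  intro v hv w hw hvc hwc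
  exact add_mem_of_subset_cover (fun u hu => h.stab_cover hst hstc hsc htc hu)
    (h.exists_not_mem_stab hs (not_mem_of_not_hit ht hst))
    (h.exists_not_mem_stab ht (not_mem_of_not_hit' hs hst)) hv hw hvc hwc

/-- With `u` fixed and `b = a + w` varying, the five-point condition leaves only the sums of `s + c`
or `t + c` with `b` or `b + u`. So `W` is covered by four slices, two from each of these cosets. -/
theorem card_pts_le_of_sums (h : Frame E W a) {c s t u : V} (hc : c ∈ E) (hs : s ∈ E) (ht : t ∈ E)
    (hst : ¬ Hit E (flat W a) (s + t)) (hstc : ¬ Hit E (flat W a) (s + t + c)) (hu : u ∈ W)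
    (n1 : c + u ∉ E) (n2 : s + u ∉ E) (n3 : t + u ∉ E) (n4 : s + c + u ∉ E)
    (n5 : t + c + u ∉ E) :
    (pts W).card ≤
      2 * (cls E (flat W a) (s + c)).card + 2 * (cls E (flat W a) (t + c)).card := by
  classical
  have hle : ∀ x : V, ∀ f ∈ flat W a, (slice E W (x + f)).card ≤ (cls E (flat W a) x).card :=
    fun x f hf => card_slice_le (by simpa only [char_two V] using hf)
  have hau := (flat W a).add_mem (base_mem_flat W a) (le_flat W a hu)
  have hsub : pts W ⊆ (slice E W (s + c + a) ∪ slice E W (s + c + (a + u))) ∪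
      (slice E W (t + c + a) ∪ slice E W (t + c + (a + u))) := by
    intro w hw
    rw [mem_pts] at hw
    simp only [Finset.mem_union, mem_slice]
    have := h.fiveSum_of_not_hit (b := a + w) hc hs ht hst hstc hu
      (by simpa only [char_two V] using hw)
    simp only [char_two V] at this n1 n2 n3 n4 n5 ⊢
    tauto
  have e1 := Finset.card_le_card hsub
  have e2 := Finset.card_union_le (slice E W (s + c + a) ∪ slice E W (s + c + (a + u)))
      (slice E W (t + c + a) ∪ slice E W (t + c + (a + u)))
  have e3 := Finset.card_union_le (slice E W (s + c + a)) (slice E W (s + c + (a + u)))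
  have e4 := Finset.card_union_le (slice E W (t + c + a)) (slice E W (t + c + (a + u)))
  have e5 := hle (s + c) _ (base_mem_flat W a)
  have e6 := hle (t + c) _ (base_mem_flat W a)
  have e7 := hle (s + c) _ hau
  have e8 := hle (t + c) _ hau
  omega

/-- Either some `u` fits `card_pts_le_of_sums`, or the slices at `c`, `s`, `t`, `s + c`, `t + c`
cover `W`. In the latter case `0` lies in the first three, and this overcount gives the `+ 2`. -/
theorem card_pts_le_or (h : Frame E W a) {c s t : V} (hc : c ∈ E) (hs : s ∈ E) (ht : t ∈ E)
    (hst : ¬ Hit E (flat W a) (s + t)) (hstc : ¬ Hit E (flat W a) (s + t + c)) :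
    (pts W).card ≤ 2 * (cls E (flat W a) (s + c)).card + 2 * (cls E (flat W a) (t + c)).card ∨
    (pts W).card + 2 ≤ (cls E (flat W a) c).card + (cls E (flat W a) s).card +
      (cls E (flat W a) (s + c)).card + (cls E (flat W a) t).card +
      (cls E (flat W a) (t + c)).card := by
  classical
  have hle : ∀ x : V, ∀ f ∈ flat W a, (slice E W (x + f)).card ≤ (cls E (flat W a) x).card :=
    fun x f hf => card_slice_le (by simpa only [char_two V] using hf)
  have h0 := (flat W a).zero_mem
  by_cases hex : ∃ u ∈ W, c + u ∉ E ∧ s + u ∉ E ∧ t + u ∉ E ∧ s + c + u ∉ E ∧ t + c + u ∉ E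
  · left
    obtain ⟨u, hu, n1, n2, n3, n4, n5⟩ := hex
    exact h.card_pts_le_of_sums hc hs ht hst hstc hu n1 n2 n3 n4 n5
  · right
    push Not at hex
    have hsub : (pts W).erase 0 ⊆ (((slice E W c).erase 0 ∪ (slice E W s).erase 0) ∪
        (slice E W t).erase 0) ∪ (slice E W (s + c) ∪ slice E W (t + c)) := by
      intro w hw
      rw [Finset.mem_erase, mem_pts] at hw
      simp only [Finset.mem_union, Finset.mem_erase, mem_slice]
      have := hex w hw.2
      tauto
    have z : ∀ x ∈ E, ((slice E W x).erase 0).card + 1 ≤ (cls E (flat W a) x).card := by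
      intro x hx
      have := hle x 0 h0
      rw [add_zero] at this
      rwa [Finset.card_erase_add_one (mem_slice.2 ⟨W.zero_mem, by rwa [add_zero]⟩)]
    have z0 := Finset.card_erase_add_one (mem_pts.2 W.zero_mem)
    have e1 := Finset.card_le_card hsub
    have e2 := Finset.card_union_le (((slice E W c).erase 0 ∪ (slice E W s).erase 0) ∪
        (slice E W t).erase 0) (slice E W (s + c) ∪ slice E W (t + c))
    have e3 := Finset.card_union_le ((slice E W c).erase 0 ∪ (slice E W s).erase 0)
        ((slice E W t).erase 0)
    have e4 := Finset.card_union_le ((slice E W c).erase 0) ((slice E W s).erase 0)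
    have e5 := Finset.card_union_le (slice E W (s + c)) (slice E W (t + c))
    have e6 := z c hc
    have e7 := z s hs
    have e8 := z t ht
    have e9 := hle (s + c) 0 h0
    have e10 := hle (t + c) 0 h0
    rw [add_zero] at e9 e10
    omega

/-- Otherwise `c`, `s`, `t` are free and the stabiliser of `c` has index two, so its coset has at
least `|W|/2` points. -/
theorem pos_or_pos (h : Frame E W a) {c s t : V} (hc : c ∈ E)
    (hC : 2 * (cls E (flat W a) c).card < (pts W).card) (hs : s ∈ E) (ht : t ∈ E)
    (hst : ¬ Hit E (flat W a) (s + t)) (hstc : ¬ Hit E (flat W a) (s + t + c)) :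
    0 < (cls E (flat W a) (s + c)).card ∨ 0 < (cls E (flat W a) (t + c)).card := by
  rw [← hit_iff_card_pos, ← hit_iff_card_pos]
  by_contra hcon
  push Not at hcon
  have h1 := h.card_pts_le_two_mul_stab hs ht hst hstc hcon.1 hcon.2
  have h2 := card_stab_le (W := W) (a := a) hc
  omega

theorem pairCond (h : Frame E W a) {c s t : V} (hc : c ∈ E)
    (hC : 2 * (cls E (flat W a) c).card < (pts W).card)
    (hst : ¬ Hit E (flat W a) (s + t)) (hstc : ¬ Hit E (flat W a) (s + t + c)) :
    PairCond (pts W).card (cls E (flat W a) c).card (cls E (flat W a) s).card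
      (cls E (flat W a) (s + c)).card (cls E (flat W a) t).card
      (cls E (flat W a) (t + c)).card := by
  have key : ∀ s t, ¬ Hit E (flat W a) (s + t) → ¬ Hit E (flat W a) (s + t + c) →
      0 < (cls E (flat W a) s).card → 0 < (cls E (flat W a) t).card →
      (0 < (cls E (flat W a) (s + c)).card ∨ 0 < (cls E (flat W a) (t + c)).card) ∧
      ((pts W).card ≤ 2 * (cls E (flat W a) (s + c)).card + 2 * (cls E (flat W a) (t + c)).card ∨
      (pts W).card + 2 ≤ (cls E (flat W a) c).card + (cls E (flat W a) s).card +
        (cls E (flat W a) (s + c)).card + (cls E (flat W a) t).card +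
        (cls E (flat W a) (t + c)).card) := by
    intro s t hst hstc hs ht
    rw [← hit_iff_card_pos] at hs ht
    obtain ⟨s', hs', hsF⟩ := hs
    obtain ⟨t', ht', htF⟩ := ht
    have hstF := (flat W a).add_mem hsF htF
    have n1 : ¬ Hit E (flat W a) (s' + t') := fun h =>
      hst (h.congr (by simpa only [char_two V] using hstF))
    have n2 : ¬ Hit E (flat W a) (s' + t' + c) := fun h =>
      hstc (h.congr (by simpa only [char_two V] using hstF))
    have k1 : s' + c + (s + c) ∈ flat W a := by simpa only [char_two V] using hsF
    have k2 : t' + c + (t + c) ∈ flat W a := by simpa only [char_two V] using htF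
    rw [← cls_congr hsF, ← cls_congr htF, ← cls_congr k1, ← cls_congr k2]
    exact ⟨h.pos_or_pos hc hC hs' ht' n1 n2, h.card_pts_le_or hc hs' ht' n1 n2⟩
  have e1 : s + c + c = s := by simp only [char_two V]
  have e2 : t + c + c = t := by simp only [char_two V]
  have e3 : s + c + t = s + t + c := by simp only [char_two V]
  have e4 : s + c + t + c = s + t := by simp only [char_two V]
  have e5 : s + (t + c) = s + t + c := by simp only [char_two V]
  have e6 : s + (t + c) + c = s + t := by simp only [char_two V]
  have e7 : s + c + (t + c) = s + t := by simp only [char_two V]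
  have e8 : s + c + (t + c) + c = s + t + c := by simp only [char_two V]
  have k1 := key s t hst hstc
  have k2 := key (s + c) t (by rwa [e3]) (by rwa [e4])
  have k3 := key s (t + c) (by rwa [e5]) (by rwa [e6])
  have k4 := key (s + c) (t + c) (by rwa [e7]) (by rwa [e8])
  rw [e1] at k2 k4
  rw [e2] at k3 k4
  refine ⟨k1, fun p q => (k2 p q).imp id fun h => ?_, fun p q => (k3 p q).imp id fun h => ?_,
    fun p q => (k4 p q).imp id fun h => ?_⟩ <;> omega

end Frame
end BinMatroid

namespace BinMatroid

/-! ### The extremal function -/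

/-- Convexity of `2 ^ n`: spreading two exponents apart with fixed sum increases the total. -/
theorem two_pow_add_two_pow_lt {i j p q : ℕ} (hip : i < p) (hpq : p ≤ q) (h : i + j = p + q) :
    2 ^ p + 2 ^ q < 2 ^ i + 2 ^ j := by
  obtain ⟨d, rfl⟩ := Nat.exists_eq_add_of_lt hip
  obtain rfl : j = q + (d + 1) := by omega
  rw [add_assoc i d 1, pow_add, pow_add 2 q]
  have h1 : 2 ^ i < 2 ^ q := Nat.pow_lt_pow_right (by norm_num) (by omega)
  have h2 : 2 ≤ 2 ^ (d + 1) := by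
    calc 2 = 2 ^ 1 := rfl
      _ ≤ 2 ^ (d + 1) := Nat.pow_le_pow_right (by norm_num) (by omega)
  nlinarith

/-- The minimum number of points of a full-rank, `I₅`-free and triangle-free matroid of
dimension `r`. -/
def minCard (r : ℕ) : ℕ := 2 ^ (r / 2 - 1) + 2 ^ ((r + 1) / 2 - 1)

theorem minCard_lt {r i j : ℕ} (h : i + j + 2 = r) (h' : ¬ (i + 1 = r / 2 ∧ j + 1 = (r + 1) / 2))
    (h'' : ¬ (j + 1 = r / 2 ∧ i + 1 = (r + 1) / 2)) : minCard r < 2 ^ i + 2 ^ j := by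
  unfold minCard
  rcases le_total i j with hij | hij
  · exact two_pow_add_two_pow_lt (by omega) (by omega) (by omega)
  · rw [add_comm (2 ^ i)]
    exact two_pow_add_two_pow_lt (by omega) (by omega) (by omega)

theorem minCard_le {r i j : ℕ} (h : i + j + 2 = r) : minCard r ≤ 2 ^ i + 2 ^ j := by
  by_cases h1 : i + 1 = r / 2 ∧ j + 1 = (r + 1) / 2
  · rw [minCard, ← h1.1, ← h1.2]; rfl
  by_cases h2 : j + 1 = r / 2 ∧ i + 1 = (r + 1) / 2
  · rw [minCard, ← h2.1, ← h2.2, add_comm]; rfl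
  exact (minCard_lt h h1 h2).le

variable {V : Type*} [AddCommGroup V] [Module (ZMod 2) V] [FiniteDimensional (ZMod 2) V]
variable {E : Finset V} {W U : Submodule (ZMod 2) V} {a : V}

/-! ### Many points when some small coset has a non-neighbour -/

-- As `c + x` is not hit, `NoFreeTriple` for `e`, `c`, `x` yields a second coset of `U` in the same
-- coset of the larger subspace that meets `E`.
omit [FiniteDimensional (ZMod 2) V] in
theorem two_le_card_cls_ext2 (h3 : NoFreeTriple E U) (hU : ∃ b ∈ E, b ∈ U) {c x e : V}
    (hc : c ∈ E) (hx : x ∈ E) (hcx : ¬ Hit E U (c + x)) (he : e ∈ E) :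
    (cls E U e).card + 1 ≤ (cls E (ext2 U c x) e).card := by
  rw [card_cls_ext2 (not_mem_of_not_hit hx hcx) (not_mem_of_not_hit' hc hcx)
    (add_not_mem_of_not_hit hU hcx)]
  have := h3 e he c hc x hx
  simp only [hit_iff_card_pos] at this hcx
  omega

namespace Frame

/-- No point of `E` lies in `W`, so `E` meets `flat W a` exactly in `a + W`. -/
theorem card_eq (h : Frame E W a) : E.card = (pts W).card + (outside E (flat W a)).card := by
  classical
  have h1 : E = (pts W).map (addLeftEmbedding a) ∪ outside E (flat W a) := by
    ext e
    simp only [Finset.mem_union, Finset.mem_map, mem_pts, mem_outside, addLeftEmbedding_apply]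
    constructor
    · intro he
      by_cases heF : e ∈ flat W a
      · left
        refine ⟨a + e, ?_, by simp only [char_two V]⟩
        rw [add_comm]
        exact (mem_flat.1 heF).resolve_left (h.not_mem_of_mem he)
      · exact Or.inr ⟨he, heF⟩
    · rintro (⟨w, hw, rfl⟩ | ⟨he, -⟩)
      · exact h.affine w hw
      · exact he
  have h2 : Disjoint ((pts W).map (addLeftEmbedding a)) (outside E (flat W a)) := by
    rw [Finset.disjoint_left]
    intro e he he'
    simp only [Finset.mem_map, mem_pts, addLeftEmbedding_apply] at he
    obtain ⟨w, hw, rfl⟩ := he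
    exact (mem_outside.1 he').2 ((flat W a).add_mem (base_mem_flat W a) (le_flat W a hw))
  conv_lhs => rw [h1]
  rw [Finset.card_union_of_disjoint h2, Finset.card_map]

theorem finrank_flat (h : Frame E W a) :
    finrank (ZMod 2) (flat W a) = finrank (ZMod 2) W + 1 :=
  Submodule.finrank_sup_span_singleton h.base_not_mem

/-- Each of the four cosets of `flat W a` around `e` is nonadjacent to each of the four around `f`,
also after adding `c` or `x`. So `pairCond` applies to every choice of pairs, and by minimality of
`c` each of these cosets that meets `E` has at least as many points as that of `c`. -/
theorem add_le_card_cls_add_card_cls (h : Frame E W a) (h3 : NoFreeTriple E (flat W a))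
    {c x : V} (hc : c ∈ E) (hx : x ∈ E)
    (hcx : ¬ Hit E (flat W a) (c + x)) (hC : 2 * (cls E (flat W a) c).card < (pts W).card)
    (hmin : ∀ e ∈ E, ∀ f ∈ E, ¬ Hit E (flat W a) (e + f) →
      (cls E (flat W a) c).card ≤ (cls E (flat W a) e).card)
    {e f : V} (he : e ∈ E) (hf : f ∈ E) (hef : ¬ Hit E (ext2 (flat W a) c x) (e + f)) :
    (pts W).card + 2 ≤ (cls E (ext2 (flat W a) c x) e).card +
      (cls E (ext2 (flat W a) c x) f).card ∧
    (4 ≤ (pts W).card → (cls E (flat W a) c).card = 1 → (cls E (flat W a) x).card = 1 →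
      (pts W).card + 3 ≤ (cls E (ext2 (flat W a) c x) e).card +
        (cls E (ext2 (flat W a) c x) f).card) := by
  have hcF := BinMatroid.not_mem_of_not_hit hx hcx
  have hxF := BinMatroid.not_mem_of_not_hit' hc hcx
  have hcxF := add_not_mem_of_not_hit h.exists_mem hcx
  have two_e := two_le_card_cls_ext2 h3 h.exists_mem hc hx hcx he
  have two_f := two_le_card_cls_ext2 h3 h.exists_mem hc hx hcx hf
  have nh : ∀ y, y + (e + f) ∈ ext2 (flat W a) c x → ¬ Hit E (flat W a) y := fun y hy hh =>
    hef ((hh.mono (le_ext2 _ _ _)).congr hy)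
  have cU : c ∈ ext2 (flat W a) c x :=
    mem_ext2.2 (Or.inr (Or.inl (by simp only [char_two V, zero_mem])))
  have xU : x ∈ ext2 (flat W a) c x :=
    mem_ext2.2 (Or.inr (Or.inr (Or.inl (by simp only [char_two V, zero_mem]))))
  have cxU := Submodule.add_mem _ cU xU
  have xcU := Submodule.add_mem _ xU cU
  have e0 : 0 < (cls E (flat W a) e).card := hit_iff_card_pos.1 (hit_self he)
  have f0 : 0 < (cls E (flat W a) f).card := hit_iff_card_pos.1 (hit_self hf)
  have mn : ∀ y z, y + z + (e + f) ∈ ext2 (flat W a) c x → 0 < (cls E (flat W a) z).card →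
      0 < (cls E (flat W a) y).card →
      (cls E (flat W a) c).card ≤ (cls E (flat W a) y).card := by
    intro y z hyz hz hy
    rw [← hit_iff_card_pos] at hy hz
    obtain ⟨y', hy', hyF⟩ := hy
    obtain ⟨z', hz', hzF⟩ := hz
    rw [← cls_congr hyF]
    refine hmin y' hy' z' hz' (nh _ ?_)
    simpa only [char_two V] using Submodule.add_mem _ hyz
      (le_ext2 _ c x ((flat W a).add_mem hyF hzF))
  have ecx : e + x + c = e + c + x := add_right_comm _ _ _
  have fcx : f + x + c = f + c + x := add_right_comm _ _ _
  have p1 := h.pairCond (s := e) (t := f) hc hC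
    (nh _ (by simp only [char_two V, zero_mem])) (nh _ (by simpa only [char_two V]))
  have p2 := h.pairCond (s := e) (t := f + x) hc hC
    (nh _ (by simpa only [char_two V])) (nh _ (by simpa only [char_two V]))
  have p3 := h.pairCond (s := e + x) (t := f) hc hC
    (nh _ (by simpa only [char_two V])) (nh _ (by simpa only [char_two V]))
  have p4 := h.pairCond (s := e + x) (t := f + x) hc hC
    (nh _ (by simp only [char_two V, zero_mem])) (nh _ (by simpa only [char_two V]))
  rw [ecx] at p3 p4
  rw [fcx] at p2 p4
  rw [card_cls_ext2 hcF hxF hcxF] at two_e two_f ⊢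
  rw [card_cls_ext2 hcF hxF hcxF]
  have hx' := h3 x hx e he f hf
  have nef := nh (e + f) (by simp only [char_two V, zero_mem])
  have nef' := nh (x + e + f) (by simpa only [char_two V])
  have hx2 : 0 < (cls E (flat W a) (e + x)).card ∨ 0 < (cls E (flat W a) (f + x)).card := by
    rw [← hit_iff_card_pos, ← hit_iff_card_pos, add_comm e, add_comm f]
    tauto
  constructor
  · have := PairCond.add_two_le e0 f0 (by omega) (by omega)
      (mn _ f (by simp only [char_two V, zero_mem]) f0 e0)
      ⟨mn _ f (by simpa only [char_two V]) f0, mn _ f (by simpa only [char_two V]) f0,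
       mn _ f (by simpa only [char_two V]) f0, mn _ e (by simpa only [char_two V]) e0,
       mn _ e (by simpa only [char_two V]) e0, mn _ e (by simpa only [char_two V]) e0,
       mn _ e (by simp only [char_two V, zero_mem]) e0 f0, hx2⟩ p1 p2 p3 p4
    omega
  · intro hM c1 x1
    have q1 := h.pairCond (s := e) (t := f) hx (by omega)
      (nh _ (by simp only [char_two V, zero_mem])) (nh _ (by simpa only [char_two V]))
    have q2 := h.pairCond (s := e) (t := f + c) hx (by omega)
      (nh _ (by simpa only [char_two V])) (nh _ (by simpa only [char_two V]))
    have q3 := h.pairCond (s := e + c) (t := f) hx (by omega)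
      (nh _ (by simpa only [char_two V])) (nh _ (by simpa only [char_two V]))
    have q4 := h.pairCond (s := e + c) (t := f + c) hx (by omega)
      (nh _ (by simp only [char_two V, zero_mem])) (nh _ (by simpa only [char_two V]))
    rw [c1] at p1 p2 p3 p4
    rw [x1] at q1 q2 q3 q4
    have := PairCond.add_three_le hM e0 f0 (by omega) (by omega) p1 p2 p3 p4 q1 q2 q3 q4
    omega

/-- The lower bound when some coset with few points has a non-neighbour, with the structure in
the case of equality. -/
theorem minCard_le_card_of_small (h : Frame E W a)
    (hspan : Submodule.span (ZMod 2) (E : Set V) = ⊤) (h3 : NoFreeTriple E (flat W a))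
    (hM : 4 ≤ (pts W).card) {c x : V} (hc : c ∈ E) (hx : x ∈ E)
    (hcx : ¬ Hit E (flat W a) (c + x)) (hC : 2 * (cls E (flat W a) c).card < (pts W).card)
    (hmin : ∀ e ∈ E, ∀ f ∈ E, ¬ Hit E (flat W a) (e + f) →
      (cls E (flat W a) c).card ≤ (cls E (flat W a) e).card) :
    minCard (finrank (ZMod 2) V) ≤ E.card ∧ (E.card = minCard (finrank (ZMod 2) V) →
      (∀ e ∈ E, e ∉ flat W a → (cls E (flat W a) e).card = 1) ∧
      ∀ y ∉ ext2 (flat W a) c x, (cls E (ext2 (flat W a) c x) y).card ≤ 2) := by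
  classical
  have hcF := BinMatroid.not_mem_of_not_hit hx hcx
  have hxF := BinMatroid.not_mem_of_not_hit' hc hcx
  have hcxF := add_not_mem_of_not_hit h.exists_mem hcx
  have hU : ∃ b ∈ E, b ∈ ext2 (flat W a) c x := by
    obtain ⟨b, hb, hbF⟩ := h.exists_mem; exact ⟨b, hb, le_ext2 _ _ _ hbF⟩
  have hfr := finrank_ext2 hcF hxF hcxF
  have hfl := h.finrank_flat
  have hle := Submodule.finrank_le (ext2 (flat W a) c x)
  obtain ⟨k, hk⟩ := Nat.exists_eq_add_of_le hle
  have hcard := h.card_eq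
  rw [card_outside_ext2 h.exists_mem hc hx hcx] at hcard
  have hM' := card_pts (W := W)
  have c1 := hit_iff_card_pos.1 (hit_self (U := flat W a) hc)
  have x1 := hit_iff_card_pos.1 (hit_self (U := flat W a) hx)
  have two : ∀ e ∈ E, 2 ≤ (cls E (ext2 (flat W a) c x) e).card := fun e he => by
    have := two_le_card_cls_ext2 h3 h.exists_mem hc hx hcx he
    have := hit_iff_card_pos.1 (hit_self (U := flat W a) he)
    omega
  have hnon : ∀ e ∈ E, ∀ f ∈ E, ¬ Hit E (ext2 (flat W a) c x) (e + f) → _ := fun e he f hf hef =>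
    h.add_le_card_cls_add_card_cls h3 hc hx hcx hC hmin he hf hef
  have low : minCard (finrank (ZMod 2) V) + (cls E (flat W a) c).card +
      (cls E (flat W a) x).card ≤ E.card + 2 := by
    -- Adding `|W|` and the cosets of `c` and `x` to this bound gives `2^(α+1) + 2^(dim W + β)`,
    -- plus the excess of those two cosets over one point each.
    obtain ⟨α, β, hαβ, hb, -⟩ := weighted_lower_bound hspan k _ 2 (pts W).card hk hU
      (h3.mono (le_ext2 _ _ _)) (fun e he _ => two e he)
      (fun e he f hf hef => by rw [add_comm]; exact (hnon e he f hf hef).1)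
    have := minCard_le (r := finrank (ZMod 2) V) (i := α + 1)
      (j := finrank (ZMod 2) W + β) (by omega)
    rw [pow_succ, pow_add, ← hM'] at this
    omega
  refine ⟨by omega, fun heq => ?_⟩
  have hc1 : (cls E (flat W a) c).card = 1 := by omega
  have hx1 : (cls E (flat W a) x).card = 1 := by omega
  have hadj : ∀ e ∈ E, ∀ f ∈ E, Hit E (ext2 (flat W a) c x) (e + f) := by
    by_contra hcon
    push Not at hcon
    -- A nonadjacent pair forces `β ≥ 1`, so raising the weight by one gains `2 ^ β - 1 > 0`,
    -- contradicting equality.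
    obtain ⟨α, β, hαβ, hb, hβ⟩ := weighted_lower_bound hspan k _ 2 ((pts W).card + 1) hk hU
      (h3.mono (le_ext2 _ _ _)) (fun e he _ => two e he)
      (fun e he f hf hef => by have := (hnon e he f hf hef).2 hM hc1 hx1; omega)
    have := minCard_le (r := finrank (ZMod 2) V) (i := α + 1)
      (j := finrank (ZMod 2) W + β) (by omega)
    rw [pow_succ, pow_add, ← hM'] at this
    have h2 : 2 ≤ 2 ^ β := by
      calc 2 = 2 ^ 1 := rfl
        _ ≤ 2 ^ β := Nat.pow_le_pow_right (by norm_num) (hβ hcon)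
    rw [add_mul] at hb
    omega
  have hall := forall_hit_of_forall_hit_add hspan hU hadj
  have htwo : ∀ y, 2 ≤ (cls E (ext2 (flat W a) c x) y).card := by
    intro y
    obtain ⟨e, he, hey⟩ := hall y
    rw [← cls_congr hey]
    exact two e he
  have hupper : ∀ y ∉ ext2 (flat W a) c x, (cls E (ext2 (flat W a) c x) y).card ≤ 2 := by
    intro y hy
    by_contra hcon
    obtain ⟨e, he, hey⟩ := hall y
    have hmem : e ∈ outside E (ext2 (flat W a) c x) := mem_outside.2 ⟨he, fun hh => hy (by
      simpa only [char_two V] using Submodule.add_mem _ hh hey)⟩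
    have hers : ∀ z, cls (E.erase e) (ext2 (flat W a) c x) z =
        (cls E (ext2 (flat W a) c x) z).erase e := by
      intro z; ext g; simp only [mem_cls, Finset.mem_erase]; tauto
    have hout : outside (E.erase e) (ext2 (flat W a) c x) =
        (outside E (ext2 (flat W a) c x)).erase e := by
      ext g; simp only [mem_outside, Finset.mem_erase]; tauto
    -- Deleting one point from a coset with three still leaves two in every coset, so such an `E`
    -- has a point more than the bound.
    have key := mul_le_card_outside (E := E.erase e) hk (p := 2) (by
      intro z _
      rw [hers]
      by_cases hez : e ∈ cls E (ext2 (flat W a) c x) z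
      · rw [Finset.card_erase_of_mem hez]
        have : y + z ∈ ext2 (flat W a) c x := by
          simpa only [char_two V] using Submodule.add_mem _ hey (mem_cls.1 hez).2
        rw [← cls_congr this]
        omega
      · rw [Finset.erase_eq_of_notMem hez]
        exact htwo z)
    rw [hout, Finset.card_erase_of_mem hmem] at key
    have h1 := Finset.card_pos.2 ⟨e, hmem⟩
    have h2k : 1 ≤ 2 ^ k := Nat.one_le_two_pow
    have := minCard_le (r := finrank (ZMod 2) V) (i := k + 1)
      (j := finrank (ZMod 2) W) (by omega)
    rw [pow_succ, ← hM'] at this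
    omega
  refine ⟨fun e he heF => ?_, hupper⟩
  have e1 := hit_iff_card_pos.1 (hit_self (U := flat W a) he)
  by_cases heU : e ∈ ext2 (flat W a) c x
  · rcases mem_ext2.1 heU with h' | h' | h' | h'
    · exact absurd h' heF
    · rw [cls_congr h', hc1]
    · rw [cls_congr h', hx1]
    · exact absurd ⟨e, he, by rwa [← add_assoc]⟩ hcx
  · have := hupper e heU
    have := two_le_card_cls_ext2 h3 h.exists_mem hc hx hcx he
    omega

end Frame
end BinMatroid

namespace BinMatroid
variable {V : Type*} [AddCommGroup V] [Module (ZMod 2) V]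
variable {E : Finset V} {W : Submodule (ZMod 2) V} {a : V}

/-! ### Direct sums of affine geometries -/

theorem isAffineGeometry_restrict_flat {M : BinMatroid V} (ha : a ∉ W)
    (h : ∀ x ∈ flat W a, x ∈ M.ground ↔ x ∉ W) :
    (M.restrict (flat W a)).IsAffineGeometry := by
  refine ⟨W.comap (flat W a).subtype, ⟨?_, ?_⟩, ?_⟩
  · intro htop
    exact ha (Submodule.eq_top_iff'.1 htop ⟨a, base_mem_flat W a⟩)
  · intro K hK
    obtain ⟨k, hk, hkW⟩ := SetLike.exists_of_lt hK
    have hle : ∀ w : flat W a, (w : V) ∈ W → w ∈ K := fun w hw => hK.le hw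
    rw [Submodule.eq_top_iff']
    intro y
    have hkW' : (k : V) ∉ W := hkW
    rcases mem_flat.1 y.2 with hy | hy
    · exact hle y hy
    · have hk' := (mem_flat.1 k.2).resolve_left hkW'
      have : y + k ∈ K := hle (y + k) (by
        simpa only [char_two V, Submodule.coe_add] using W.add_mem hy hk')
      simpa only [char_two (flat W a)] using K.add_mem this hk
  · ext x
    exact h x x.2

theorem IsSumOfAffineGeometries.symm {M : BinMatroid V} {m n : ℕ}
    (h : M.IsSumOfAffineGeometries m n) : M.IsSumOfAffineGeometries n m := by
  obtain ⟨F₁, F₂, ⟨hc, hg⟩, h1, h2, h3, h4⟩ := h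
  exact ⟨F₂, F₁, ⟨hc.symm, by rw [Set.union_comm]; exact hg⟩, h3, h4, h1, h2⟩

theorem IsAffineGeometry.ncard [FiniteDimensional (ZMod 2) V] {M : BinMatroid V}
    (h : M.IsAffineGeometry) :
    1 ≤ finrank (ZMod 2) V ∧ M.ground.ncard = 2 ^ (finrank (ZMod 2) V - 1) := by
  have : Finite V := Module.finite_of_finite (ZMod 2)
  obtain ⟨H, hH, hM⟩ := h
  have h1 : finrank (ZMod 2) H + 1 = finrank (ZMod 2) V := by
    obtain ⟨v, hv⟩ : ∃ v, v ∉ H := by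
      by_contra hcon; push Not at hcon; exact hH.1 (Submodule.eq_top_iff'.2 hcon)
    have h2 := hH.2 (H ⊔ (ZMod 2) ∙ v) (lt_of_le_of_ne le_sup_left fun h =>
      hv (h ▸ le_sup_right (a := H) (Submodule.mem_span_singleton_self v)))
    rw [← Submodule.finrank_sup_span_singleton hv, h2, finrank_top]
  have h2 := Set.ncard_add_ncard_compl (H : Set V)
  have h3 : (H : Set V).ncard = 2 ^ finrank (ZMod 2) H := by
    rw [← Nat.card_coe_set_eq]
    change Nat.card H = _
    rw [Module.natCard_eq_pow_finrank (K := ZMod 2), Nat.card_zmod]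
  rw [Module.natCard_eq_pow_finrank (K := ZMod 2), Nat.card_zmod, h3, ← h1, pow_succ] at h2
  refine ⟨by omega, ?_⟩
  rw [hM, ← h1, Nat.add_sub_cancel]
  omega

theorem IsSumOfAffineGeometries.ncard [FiniteDimensional (ZMod 2) V] {M : BinMatroid V} {m n : ℕ}
    (h : M.IsSumOfAffineGeometries m n) :
    1 ≤ m ∧ 1 ≤ n ∧ M.ground.ncard = 2 ^ (m - 1) + 2 ^ (n - 1) := by
  have : Finite V := Module.finite_of_finite (ZMod 2)
  obtain ⟨F₁, F₂, ⟨hc, hg⟩, rfl, h2, rfl, h4⟩ := h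
  have key : ∀ F : Submodule (ZMod 2) V, (M.ground ∩ F).ncard = (M.restrict F).ground.ncard := by
    intro F
    rw [← Set.ncard_image_of_injective _ (Subtype.val_injective (p := (· ∈ F)))]
    congr 1
    ext x
    simp [restrict, and_comm]
  refine ⟨h2.ncard.1, h4.ncard.1, ?_⟩
  rw [hg, Set.ncard_union_eq, key, key, h2.ncard.2, h4.ncard.2]
  rw [Set.disjoint_left]
  rintro x ⟨hx, hx1⟩ ⟨-, hx2⟩
  have := Submodule.disjoint_def.1 hc.disjoint x hx1 hx2
  exact M.zero_notMem (this ▸ hx)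

namespace Frame

variable [FiniteDimensional (ZMod 2) V]

omit [FiniteDimensional (ZMod 2) V] in
theorem eq_of_card_cls_eq_one (h1 : ∀ e ∈ E, e ∉ flat W a → (cls E (flat W a) e).card = 1)
    {e f : V} (he : e ∈ E) (hf : f ∈ E) (heF : e ∉ flat W a) (hef : e + f ∈ flat W a) :
    e = f := by
  obtain ⟨g, hg⟩ := Finset.card_eq_one.1 (h1 e he heF)
  have k1 : e ∈ cls E (flat W a) e := mem_cls.2 ⟨he, by simp only [char_two V, zero_mem]⟩
  have k2 : f ∈ cls E (flat W a) e := mem_cls.2 ⟨hf, by rwa [add_comm]⟩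
  rw [hg, Finset.mem_singleton] at k1 k2
  rw [k1, k2]

theorem exists_ne (hM : 4 ≤ (pts W).card) (p : V) :
    ∃ u ∈ W, u ≠ 0 ∧ u ≠ p ∧ ∃ v ∈ W, v ≠ 0 ∧ v ≠ u := by
  classical
  have key : ∀ x y : V, ∃ u ∈ W, u ≠ x ∧ u ≠ y := by
    intro x y
    obtain ⟨u, hu, hu'⟩ := Finset.exists_mem_notMem_of_card_lt_card
      (s := ({x, y} : Finset V)) (t := pts W) (by
        have := Finset.card_le_two (a := x) (b := y); omega)
    simp only [Finset.mem_insert, Finset.mem_singleton, not_or] at hu'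
    exact ⟨u, mem_pts.1 hu, hu'⟩
  obtain ⟨u, hu, hu0, hup⟩ := key 0 p
  obtain ⟨v, hv, hv0, hvu⟩ := key 0 u
  exact ⟨u, hu, hu0, hup, v, hv, hv0, hvu⟩

/-- A coset containing at most one point of `E` cannot close all sums in `fiveSum_affine`. -/
theorem exists_sums_not_mem (h : Frame E W a) (hM : 4 ≤ (pts W).card) {p y : V}
    (hp : ∀ q ∈ E, q + y ∈ flat W a → q = p) (hpy : p + y ∈ flat W a) :
    ∃ u ∈ W, u ≠ 0 ∧ ∃ b, b + a ∈ W ∧ y + u ∉ E ∧ y + b ∉ E ∧ y + b + u ∉ E := by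
  obtain ⟨u, hu, hu0, hup, v, hv, hv0, hvu⟩ := exists_ne hM (p + y)
  have hF := le_flat W a
  have aF := base_mem_flat W a
  have hua : y + u ∉ E := fun hh => hup (by
    have := hp _ hh (by simpa only [char_two V] using hF hu)
    rw [← this]; simp only [char_two V])
  -- If `p ∈ y + W`, then `b = a` moves `y` into the half of its coset without `p`. If `p ∈ y + a +
  -- W`, then `b = p + y + v` turns the two sums with `b` into `p + v` and `p + v + u`, both
  -- different from `p`.
  rcases mem_flat.1 hpy with hW | hW
  · refine ⟨u, hu, hu0, a, by simp only [char_two V, zero_mem], hua,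
      fun hh => ?_, fun hh => ?_⟩
    · have := hp _ hh (by simpa only [char_two V] using aF)
      rw [← this] at hW
      exact h.base_not_mem (by simpa only [char_two V] using hW)
    · have := hp _ hh (by simpa only [char_two V] using (flat W a).add_mem aF (hF hu))
      rw [← this] at hW
      exact h.base_not_mem (by simpa only [char_two V] using W.add_mem hW hu)
  · refine ⟨u, hu, hu0, p + y + v, by simpa only [char_two V] using W.add_mem hW hv, hua,
      fun hh => ?_, fun hh => ?_⟩
    · have := hp _ hh (by simpa only [char_two V] using (flat W a).add_mem hpy (hF hv))
      apply hv0
      have h2 : y + (p + y + v) + p = 0 := by rw [this, ZModModule.add_self]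
      simpa only [char_two V] using h2
    · have := hp _ hh (by
        simpa only [char_two V] using (flat W a).add_mem ((flat W a).add_mem hpy (hF hv)) (hF hu))
      apply hvu
      have h2 : y + (p + y + v) + u + p = 0 := by rw [this, ZModModule.add_self]
      rw [← add_eq_zero_iff_eq_of_char_two]
      simp only [char_two V] at h2 ⊢
      exact h2

/-- If `y + c` were hit, the two points allowed in the coset of `y` modulo `ext2 (flat W a) c x`
would be used up, so `x + y` and `x + y + c` are not hit. Then `fiveSum_of_not_hit` for `c`, `x`,
`y` fails, since all cosets involved have at most one point. -/
theorem not_hit_add_of_partner (h : Frame E W a) (hM : 4 ≤ (pts W).card)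
    (h1 : ∀ e ∈ E, e ∉ flat W a → (cls E (flat W a) e).card = 1) {c x y : V} (hc : c ∈ E)
    (hx : x ∈ E) (hcx : ¬ Hit E (flat W a) (c + x))
    (h2 : ∀ y ∉ ext2 (flat W a) c x, (cls E (ext2 (flat W a) c x) y).card ≤ 2)
    (hy : y ∈ E) (hyF : y ∉ flat W a) (hyc : y + c ∉ flat W a) :
    ¬ Hit E (flat W a) (y + c) := by
  intro hit
  have hcF := BinMatroid.not_mem_of_not_hit hx hcx
  have hxF := BinMatroid.not_mem_of_not_hit' hc hcx
  have hcxF := add_not_mem_of_not_hit h.exists_mem hcx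
  obtain ⟨p, hp, hpF⟩ := hit
  have hyU : y ∉ ext2 (flat W a) c x := by
    rw [mem_ext2]
    rintro (h' | h' | h' | h')
    · exact hyF h'
    · exact hyc h'
    · exact hcx ⟨p, hp, by simpa only [char_two V] using (flat W a).add_mem hpF h'⟩
    · exact hcx ⟨y, hy, by rwa [← add_assoc]⟩
  have k := h2 y hyU
  rw [card_cls_ext2 hcF hxF hcxF, h1 y hy hyF] at k
  have k1 := hit_iff_card_pos.1 (⟨p, hp, hpF⟩ : Hit E (flat W a) (y + c))
  have n1 : ¬ Hit E (flat W a) (x + y) := by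
    rw [hit_iff_card_pos, add_comm]; omega
  have n2 : ¬ Hit E (flat W a) (x + y + c) := by
    rw [hit_iff_card_pos, add_comm x, add_right_comm]; omega
  have hpu : ∀ q ∈ E, q + (y + c) ∈ flat W a → q = p := by
    intro q hq hqF
    refine eq_of_card_cls_eq_one h1 hq hp (fun hh => hyc ?_) ?_
    · simpa only [char_two V] using (flat W a).add_mem hh hqF
    · simpa only [char_two V] using (flat W a).add_mem hqF hpF
  obtain ⟨u, hu, hu0, b, hb, m1, m2, m3⟩ := h.exists_sums_not_mem hM hpu hpF
  have uniq : ∀ e ∈ E, e ∉ flat W a → e + u ∉ E := fun e he heF heu =>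
    hu0 (add_eq_left.1 (eq_of_card_cls_eq_one h1 he heu heF
      (by simpa only [char_two V] using le_flat W a hu)).symm)
  have nx : ∀ f ∈ flat W a, x + c + f ∉ E := fun f hf hh => hcx ⟨_, hh, by
    simpa only [char_two V] using hf⟩
  have huF := le_flat W a hu
  have hbF : b ∈ flat W a := mem_flat.2 (Or.inr hb)
  have := h.fiveSum_of_not_hit hc hx hy n1 n2 hu hb
  have := uniq c hc hcF
  have := uniq x hx hxF
  have := uniq y hy hyF
  have := nx u huF
  have := nx b hbF
  have := nx (b + u) ((flat W a).add_mem hbF huF)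
  rw [← add_assoc] at this
  tauto

/-- Closure under triple sums makes the points outside the flat a coset `c + W₂`. Its span meets
`flat W a` trivially because each coset of the flat contains at most one of these points. -/
theorem isSumOfAffineGeometries (h : Frame E W a)
    (hspan : Submodule.span (ZMod 2) (E : Set V) = ⊤) {M : BinMatroid V}
    (hE : (E : Set V) = M.ground)
    (h1 : ∀ e ∈ E, e ∉ flat W a → (cls E (flat W a) e).card = 1)
    (h2 : ∀ x ∈ E, ∀ y ∈ E, ∀ z ∈ E, x ∉ flat W a → y ∉ flat W a → z ∉ flat W a →
      x ≠ y → x ≠ z → y ≠ z → x + y + z ∈ E ∧ x + y + z ∉ flat W a) {c : V} (hc : c ∈ E)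
    (hcF : c ∉ flat W a) :
    ∃ m n, m + n = finrank (ZMod 2) V ∧ M.IsSumOfAffineGeometries m n := by
  have mem : ∀ x, x ∈ M.ground ↔ x ∈ E := fun x => by rw [← hE, Finset.mem_coe]
  have tri : ∀ x ∈ E, ∀ y ∈ E, ∀ z ∈ E, x ∉ flat W a → y ∉ flat W a → z ∉ flat W a →
      x + y + z ∈ E ∧ x + y + z ∉ flat W a := by
    intro x hx y hy z hz hxF hyF hzF
    by_cases hxy : x = y
    · subst hxy; simp only [char_two V]; exact ⟨hz, hzF⟩
    by_cases hxz : x = z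
    · subst hxz; simp only [char_two V]; exact ⟨hy, hyF⟩
    by_cases hyz : y = z
    · subst hyz; simp only [char_two V]; exact ⟨hx, hxF⟩
    exact h2 x hx y hy z hz hxF hyF hzF hxy hxz hyz
  let W₂ : Submodule (ZMod 2) V :=
    { carrier := {v | c + v ∈ E ∧ c + v ∉ flat W a}
      zero_mem' := by rw [Set.mem_ofPred_eq, add_zero]; exact ⟨hc, hcF⟩
      add_mem' := by
        rintro v w ⟨hv, hvF⟩ ⟨hw, hwF⟩
        have := tri _ hc _ hv _ hw hcF hvF hwF
        have e : c + (c + v) + (c + w) = c + (v + w) := by simp only [char_two V]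
        rwa [e] at this
      smul_mem' := by
        rintro k v ⟨hv, hvF⟩
        obtain rfl | rfl : k = 0 ∨ k = 1 := by revert k; decide
        · rw [zero_smul, Set.mem_ofPred_eq, add_zero]; exact ⟨hc, hcF⟩
        · rw [one_smul]; exact ⟨hv, hvF⟩ }
  have mem₂ : ∀ v, v ∈ W₂ ↔ c + v ∈ E ∧ c + v ∉ flat W a := fun v => Iff.rfl
  have mem₂' : ∀ e ∈ E, e ∉ flat W a → e + c ∈ W₂ := fun e he heF => by
    rw [mem₂]
    have : c + (e + c) = e := by simp only [char_two V]
    rw [this]; exact ⟨he, heF⟩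
  have hcW : c ∉ W₂ := fun hh => h.zero_not_mem (by
    have := ((mem₂ c).1 hh).1
    rwa [ZModModule.add_self] at this)
  have hcompl : IsCompl (flat W a) (flat W₂ c) := by
    constructor
    · rw [Submodule.disjoint_def]
      intro v hv hv2
      rcases mem_flat.1 hv2 with hv2 | hv2
      · have := (mem₂ v).1 hv2
        have := eq_of_card_cls_eq_one h1 hc this.1 hcF (by simpa only [char_two V] using hv)
        exact (add_eq_left.1 this.symm)
      · have := ((mem₂ _).1 hv2).2
        exact absurd (by simpa only [char_two V] using hv) this
    · rw [codisjoint_iff, eq_top_iff, ← hspan, Submodule.span_le]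
      intro e he
      by_cases heF : e ∈ flat W a
      · exact le_sup_left (a := flat W a) heF
      · exact le_sup_right (a := flat W a) (mem_flat.2 (Or.inr (mem₂' e he heF)))
  refine ⟨_, _, Submodule.finrank_add_eq_of_isCompl hcompl, flat W a, flat W₂ c,
    ⟨hcompl, ?_⟩, rfl, ?_, rfl, ?_⟩
  · refine (Set.union_subset Set.inter_subset_left Set.inter_subset_left).antisymm' ?_
    intro e he
    by_cases heF : e ∈ flat W a
    · exact Or.inl ⟨he, heF⟩
    · exact Or.inr ⟨he, mem_flat.2 (Or.inr (mem₂' e ((mem e).1 he) heF))⟩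
  · refine isAffineGeometry_restrict_flat h.base_not_mem fun x hx => ?_
    rw [mem]
    refine ⟨h.not_mem_of_mem, fun hxW => ?_⟩
    simpa only [char_two V] using h.affine _ ((mem_flat.1 hx).resolve_left hxW)
  · refine isAffineGeometry_restrict_flat hcW fun x hx => ?_
    rw [mem]
    refine ⟨fun hxE hxW => ?_, fun hxW => ?_⟩
    · exact h.sumFree c hc x hxE ((mem₂ x).1 hxW).1
    · have := ((mem₂ _).1 ((mem_flat.1 hx).resolve_left hxW)).1
      simpa only [char_two V] using this

/-- The structure of a matroid attaining the lower bound. -/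
theorem exists_isSumOfAffineGeometries (h : Frame E W a)
    (hspan : Submodule.span (ZMod 2) (E : Set V) = ⊤) {M : BinMatroid V}
    (hE : (E : Set V) = M.ground) (h3 : NoFreeTriple E (flat W a)) (hM : 4 ≤ (pts W).card)
    (hcard : E.card = minCard (finrank (ZMod 2) V))
    (h1 : ∀ e ∈ E, e ∉ flat W a → (cls E (flat W a) e).card = 1) {c x : V} (hc : c ∈ E)
    (hx : x ∈ E) (hcx : ¬ Hit E (flat W a) (c + x)) :
    ∃ m n, m + n = finrank (ZMod 2) V ∧ M.IsSumOfAffineGeometries m n := by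
  have two : ∀ c ∈ E, ∀ x ∈ E, ¬ Hit E (flat W a) (c + x) →
      ∀ y ∉ ext2 (flat W a) c x, (cls E (ext2 (flat W a) c x) y).card ≤ 2 := by
    intro c hc x hx hcx
    have c1 := h1 c hc (BinMatroid.not_mem_of_not_hit hx hcx)
    exact ((h.minCard_le_card_of_small hspan h3 hM hc hx hcx (by omega) (fun e he f hf _ => by
      rw [c1]; exact hit_iff_card_pos.1 (hit_self he))).2 hcard).2
  have uniq : ∀ e ∈ E, ∀ f ∈ E, e ∉ flat W a → e ≠ f → e + f ∉ flat W a :=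
    fun e he f hf heF hne hh => hne (eq_of_card_cls_eq_one h1 he hf heF hh)
  have hcF := BinMatroid.not_mem_of_not_hit hx hcx
  have part : ∀ c ∈ E, ∀ x ∈ E, ¬ Hit E (flat W a) (c + x) → ∀ y ∈ E, y ∉ flat W a → y ≠ c →
      ¬ Hit E (flat W a) (y + c) := fun c hc x hx hcx y hy hyF hyc =>
    h.not_hit_add_of_partner hM h1 hc hx hcx (two c hc x hx hcx) hy hyF
      (uniq y hy c hc hyF hyc)
  -- Nonadjacency spreads: `c` has the non-neighbour `x`, hence is nonadjacent to every other point;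
  -- so every other point has the non-neighbour `c` and is in turn nonadjacent to all the rest.
  have nonadj : ∀ e ∈ E, ∀ f ∈ E, e ∉ flat W a → f ∉ flat W a → e ≠ f →
      ¬ Hit E (flat W a) (e + f) := by
    intro e he f hf heF hfF hef
    by_cases hfc : f = c
    · subst hfc; exact part f hc x hx hcx e he heF hef
    · exact part f hf c hc (part c hc x hx hcx f hf hfF hfc) e he heF hef
  refine h.isSumOfAffineGeometries hspan hE h1 ?_ hc hcF
  intro x hx y hy z hz hxF hyF hzF hxy hxz hyz
  have n1 := nonadj x hx y hy hxF hyF hxy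
  have n2 := nonadj x hx z hz hxF hzF hxz
  have n3 := nonadj y hy z hz hyF hzF hyz
  have hF : x + y + z ∉ flat W a := fun hh => n1 ⟨z, hz, by rwa [add_comm]⟩
  -- The coset of `x + y + z` contains exactly one point `p` of `E`. If `x + y + z` itself were not
  -- in `E`, then `x`, `y`, `z` and two suitable points of `a + W` would violate `FiveSum`.
  obtain ⟨p, hp, hpF⟩ : Hit E (flat W a) (x + y + z) := by
    have := h3 x hx y hy z hz; tauto
  refine ⟨?_, hF⟩
  have hpu : ∀ q ∈ E, q + (x + y + z) ∈ flat W a → q = p := by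
    intro q hq hqF
    refine eq_of_card_cls_eq_one h1 hq hp (fun hh => hF ?_) ?_
    · simpa only [char_two V] using (flat W a).add_mem hh hqF
    · simpa only [char_two V] using (flat W a).add_mem hqF hpF
  obtain ⟨u, hu, hu0, b, hb, m1, m2, m3⟩ := h.exists_sums_not_mem hM hpu hpF
  have shift : ∀ e ∈ E, e ∉ flat W a → e + u ∉ E := fun e he heF heu =>
    hu0 (add_eq_left.1 (eq_of_card_cls_eq_one h1 he heu heF
      (by simpa only [char_two V] using le_flat W a hu)).symm)
  have huF := le_flat W a hu
  have hbF : b ∈ flat W a := mem_flat.2 (Or.inr hb)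
  have key : ∀ v, ¬ Hit E (flat W a) v → v + u ∉ E ∧ v + b ∉ E ∧ v + b + u ∉ E := by
    intro v hv
    refine ⟨fun hh => hv ⟨_, hh, ?_⟩, fun hh => hv ⟨_, hh, ?_⟩, fun hh => hv ⟨_, hh, ?_⟩⟩
    · simpa only [char_two V] using huF
    · simpa only [char_two V] using hbF
    · simpa only [char_two V] using (flat W a).add_mem hbF huF
  have := h.fiveSum_affine hx hy hz hu hb
  have := shift x hx hxF
  have := shift y hy hyF
  have := shift z hz hzF
  have := key _ n1
  have := key _ n2
  have := key _ n3
  tauto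

end Frame
end BinMatroid

namespace BinMatroid
variable {V : Type*} [AddCommGroup V] [Module (ZMod 2) V] [FiniteDimensional (ZMod 2) V]
variable {E : Finset V} {W : Submodule (ZMod 2) V} {a : V}

namespace Frame

/-! ### No free triples modulo a large affine geometry -/

/-- With weights `1` and `|W|/2` modulo the flat itself, the `|W|` points of `a + W` exceed the
correction `1 + |W|/2`. -/
theorem minCard_lt_card_of_large (h : Frame E W a)
    (hspan : Submodule.span (ZMod 2) (E : Set V) = ⊤) (h3 : NoFreeTriple E (flat W a))
    (hM : 2 ≤ finrank (ZMod 2) W)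
    (hN : ∀ e ∈ E, ∀ f ∈ E, ¬ Hit E (flat W a) (e + f) →
      (pts W).card ≤ 2 * (cls E (flat W a) e).card) :
    minCard (finrank (ZMod 2) V) < E.card := by
  obtain ⟨w, hw⟩ := Nat.exists_eq_add_of_le' hM
  have hfl := h.finrank_flat
  obtain ⟨k, hk⟩ := Nat.exists_eq_add_of_le (Submodule.finrank_le (flat W a))
  have hM' := card_pts (W := W)
  rw [hw, show w + 2 = w + 1 + 1 from rfl, pow_succ] at hM'
  have hw2 : 2 ≤ 2 ^ (w + 1) := by
    calc 2 = 2 ^ 1 := rfl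
      _ ≤ 2 ^ (w + 1) := Nat.pow_le_pow_right (by norm_num) (by omega)
  obtain ⟨α, β, hαβ, hb, -⟩ := weighted_lower_bound hspan k (flat W a) 1 (2 ^ (w + 1)) hk
    h.exists_mem h3 (fun e he _ => hit_iff_card_pos.1 (hit_self he))
    (fun e he f hf hef => by
      have := hN e he f hf hef
      have := hN f hf e he (by rwa [add_comm])
      omega)
  have := minCard_le (r := finrank (ZMod 2) V) (i := α) (j := w + 1 + β) (by omega)
  rw [pow_add 2 (w + 1)] at this
  have := h.card_eq
  omega

theorem minCard_le_card_of_noFreeTriple (h : Frame E W a)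
    (hspan : Submodule.span (ZMod 2) (E : Set V) = ⊤) {M : BinMatroid V}
    (hE : (E : Set V) = M.ground) (h3 : NoFreeTriple E (flat W a))
    (hM : 2 ≤ finrank (ZMod 2) W) :
    minCard (finrank (ZMod 2) V) ≤ E.card ∧ (E.card = minCard (finrank (ZMod 2) V) →
      ∃ m n, m + n = finrank (ZMod 2) V ∧ M.IsSumOfAffineGeometries m n) := by
  classical
  by_cases hex : ∃ c ∈ E, (∃ x ∈ E, ¬ Hit E (flat W a) (c + x)) ∧
      2 * (cls E (flat W a) c).card < (pts W).card
  · obtain ⟨c₀, hc₀, hx₀, hlt⟩ := hex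
    obtain ⟨c, hc, hmin⟩ := Finset.exists_min_image
      {e ∈ E | ∃ x ∈ E, ¬ Hit E (flat W a) (e + x)} (fun e => (cls E (flat W a) e).card)
      ⟨c₀, Finset.mem_filter.2 ⟨hc₀, hx₀⟩⟩
    obtain ⟨hc, x, hx, hcx⟩ := Finset.mem_filter.1 hc
    have hle := hmin c₀ (Finset.mem_filter.2 ⟨hc₀, hx₀⟩)
    have h4 : 4 ≤ (pts W).card := by
      rw [card_pts]
      calc 4 = 2 ^ 2 := rfl
        _ ≤ _ := Nat.pow_le_pow_right (by norm_num) hM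
    have key := h.minCard_le_card_of_small hspan h3 h4 hc hx hcx (by omega)
      (fun e he f hf hef => hmin e (Finset.mem_filter.2 ⟨he, f, hf, hef⟩))
    exact ⟨key.1, fun heq => h.exists_isSumOfAffineGeometries hspan hE h3 h4 heq
      (key.2 heq).1 hc hx hcx⟩
  · push Not at hex
    have := h.minCard_lt_card_of_large hspan h3 hM
      (fun e he f hf hef => hex e he ⟨f, hf, hef⟩)
    exact ⟨this.le, fun heq => absurd heq this.ne'⟩

/-! ### No free triples and no affine planes -/

/-- Otherwise the four points form a coset of a plane, contradicting the maximality of `W`. -/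
theorem add_add_not_mem (h : Frame E W a) (hW : finrank (ZMod 2) W ≤ 1) {x y z : V}
    (hx : x ∈ E) (hy : y ∈ E) (hz : z ∈ E) (hxy : x ≠ y) (hxz : x ≠ z) (hyz : y ≠ z) :
    x + y + z ∉ E := by
  intro hs
  have key : ∀ w ∈ (ZMod 2) ∙ (x + y), w = 0 ∨ w = x + y := by
    intro w hw
    obtain ⟨c, rfl⟩ := Submodule.mem_span_singleton.1 hw
    obtain rfl | rfl : c = 0 ∨ c = 1 := by clear hw; revert c; decide
    · left; simp
    · right; simp
  have h1 : x + z ∉ (ZMod 2) ∙ (x + y) := by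
    intro hh
    rcases key _ hh with h0 | h0
    · exact hxz (add_eq_zero_iff_eq_of_char_two.1 h0)
    · exact hyz (add_left_cancel h0).symm
  have h2 := h.maximal x ((ZMod 2) ∙ (x + y) ⊔ (ZMod 2) ∙ (x + z)) (by
    intro w hw
    rcases mem_sup_span_singleton_iff.1 hw with hw | hw
    · rcases key _ hw with rfl | rfl
      · rwa [add_zero]
      · simpa only [char_two V] using hy
    · rcases key _ hw with h0 | h0
      · rw [add_eq_zero_iff_eq_of_char_two.1 h0]
        simpa only [char_two V] using hz
      · have : w = y + z := by
          have : w = w + (x + z) + (x + z) := by simp only [char_two V]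
          rw [this, h0]; simp only [char_two V]
        rw [this, ← add_assoc]
        exact hs)
  rw [Submodule.finrank_sup_span_singleton h1, finrank_span_singleton
    (fun h0 => hxy (add_eq_zero_iff_eq_of_char_two.1 h0))] at h2
  omega

theorem add_add_mem (h : Frame E W a) (hW : finrank (ZMod 2) W ≤ 1) {x y z : V}
    (hx : x ∈ E) (hy : y ∈ E) (hz : z ∈ E) (hxF : x ∉ flat W a) (hyF : y ∉ flat W a)
    (hzF : z ∉ flat W a) (hF : x + y + z ∈ flat W a) : x + y + z ∈ W := by
  refine (mem_flat.1 hF).resolve_right fun hh => ?_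
  refine h.add_add_not_mem hW hx hy hz ?_ ?_ ?_ (by
    simpa only [char_two V] using h.affine _ hh)
  · rintro rfl; exact hzF (by simpa only [char_two V] using hF)
  · rintro rfl; exact hyF (by simpa only [char_two V] using hF)
  · rintro rfl; exact hxF (by simpa only [char_two V] using hF)

/-- The points `a`, `c`, `e`, `x`, `f` violate `FiveSum`. The cosets of `e + c` and `f + x` do meet
`E`, but only in the half avoiding `a + e + c` and `a + f + x`, since `E` contains no affine plane.
-/
theorem false_of_two_closings (h : Frame E W a) (hW : finrank (ZMod 2) W ≤ 1) {c x e f : V}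
    (hc : c ∈ E) (hx : x ∈ E) (he : e ∈ E) (hf : f ∈ E) (hcx : ¬ Hit E (flat W a) (c + x))
    (hef : ¬ Hit E (ext2 (flat W a) c x) (e + f))
    (hec : Hit E (flat W a) (e + c)) (hex : ¬ Hit E (flat W a) (e + x))
    (hecx : ¬ Hit E (flat W a) (e + c + x)) (hfx : Hit E (flat W a) (f + x))
    (hfc : ¬ Hit E (flat W a) (f + c)) (hfcx : ¬ Hit E (flat W a) (f + c + x)) : False := by
  have hcF := BinMatroid.not_mem_of_not_hit hx hcx
  have hxF := BinMatroid.not_mem_of_not_hit' hc hcx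
  have heU := BinMatroid.not_mem_of_not_hit hf hef
  have hfU := BinMatroid.not_mem_of_not_hit' he hef
  rw [mem_ext2] at heU hfU
  rw [Hit.ext2_iff] at hef
  push Not at hef heU hfU
  obtain ⟨n1, n2, n3, n4⟩ := hef
  obtain ⟨p, hp, hpF⟩ := hec
  obtain ⟨q, hq, hqF⟩ := hfx
  have aF := base_mem_flat W a
  have closing : ∀ p y z, p ∈ E → y ∈ E → z ∈ E → y ∉ flat W a → z ∉ flat W a →
      y + z ∉ flat W a → p + (y + z) ∈ flat W a → a + y + z ∉ E := by
    intro p y z hp hy hz hyF hzF hyz hpF hh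
    have hpF' : p ∉ flat W a := fun hh => hyz (by
      simpa only [char_two V] using (flat W a).add_mem hh hpF)
    have k1 := h.add_add_mem hW hp hy hz hpF' hyF hzF (by rwa [add_assoc])
    have k2 := h.add_mem hh hp (by
      simpa only [char_two V] using (flat W a).add_mem aF hpF)
    exact h.base_not_mem (by simpa only [char_two V] using W.add_mem k1 k2)
  have m1 := closing p e c hp he hc heU.1 hcF heU.2.1 hpF
  have m2 := closing q f x hq hf hx hfU.1 hxF hfU.2.2.1 hqF
  have key : ∀ y, ¬ Hit E (flat W a) y → y ∉ E ∧ a + y ∉ E := fun y hy =>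
    ⟨fun hh => hy (hit_self hh), fun hh => hy ⟨_, hh, by simpa only [char_two V] using aF⟩⟩
  have k1 := key _ hcx
  have k2 := key _ hex
  have k3 := key _ hecx
  have k4 := key _ hfc
  have k5 := key _ hfcx
  have k6 := key _ n1
  have k7 := key _ n2
  have k8 := key _ n3
  have k9 := key _ n4
  have := h.fiveSum a h.base_mem c hc e he x hx f hf
  simp only [char_two V] at this m1 m2 k1 k2 k3 k4 k5 k6 k7 k8 k9
  tauto

/-- If all cosets are adjacent, all are hit and the exponents are `0` and `r - 2`. Otherwise weights
`2`, `3` give `2^(α+1) + 2^(β+1) + (2^β - 1)`; for `β = 0` the exponents `r - 3` and `1` are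
unbalanced once `r ≥ 6`. -/
theorem minCard_le_card_of_finrank_le_one (h : Frame E W a)
    (hspan : Submodule.span (ZMod 2) (E : Set V) = ⊤) (h3 : NoFreeTriple E (flat W a))
    (hW : finrank (ZMod 2) W = 1) :
    minCard (finrank (ZMod 2) V) ≤ E.card ∧
      (6 ≤ finrank (ZMod 2) V → minCard (finrank (ZMod 2) V) < E.card) := by
  have hfl := h.finrank_flat
  have hcard := h.card_eq
  rw [card_pts, hW] at hcard
  by_cases hadj : ∀ e ∈ E, ∀ f ∈ E, Hit E (flat W a) (e + f)
  · obtain ⟨k, hk⟩ := Nat.exists_eq_add_of_le (Submodule.finrank_le (flat W a))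
    have hall := forall_hit_of_forall_hit_add hspan h.exists_mem hadj
    have := mul_le_card_outside hk (fun x _ => hit_iff_card_pos.1 (hall x))
    have h2k : 1 ≤ 2 ^ k := Nat.one_le_two_pow
    have h0 : finrank (ZMod 2) V = 0 + k + 2 := by omega
    constructor
    · have := minCard_le h0.symm
      omega
    · intro h6
      have := minCard_lt h0.symm (by omega) (by omega)
      omega
  · push Not at hadj
    obtain ⟨c, hc, x, hx, hcx⟩ := hadj
    have hcF := BinMatroid.not_mem_of_not_hit hx hcx
    have hxF := BinMatroid.not_mem_of_not_hit' hc hcx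
    have hcxF := add_not_mem_of_not_hit h.exists_mem hcx
    have hfr := finrank_ext2 hcF hxF hcxF
    obtain ⟨k, hk⟩ := Nat.exists_eq_add_of_le (Submodule.finrank_le (ext2 (flat W a) c x))
    rw [card_outside_ext2 h.exists_mem hc hx hcx] at hcard
    have two : ∀ e ∈ E, 2 ≤ (cls E (ext2 (flat W a) c x) e).card := fun e he => by
      have := two_le_card_cls_ext2 h3 h.exists_mem hc hx hcx he
      have := hit_iff_card_pos.1 (hit_self (U := flat W a) he)
      omega
    have three : ∀ e ∈ E, ∀ f ∈ E, ¬ Hit E (ext2 (flat W a) c x) (e + f) →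
        2 + 3 ≤ (cls E (ext2 (flat W a) c x) e).card + (cls E (ext2 (flat W a) c x) f).card := by
      intro e he f hf hef
      by_contra hlt
      have te := two e he
      have tf := two f hf
      have e1 : (cls E (ext2 (flat W a) c x) e).card ≤ 2 := by omega
      have f1 : (cls E (ext2 (flat W a) c x) f).card ≤ 2 := by omega
      have hef' := hef
      rw [Hit.ext2_iff] at hef'
      push Not at hef'
      have t1 := h3 e he f hf c hc
      have t2 := h3 e he f hf x hx
      have e0 := hit_self (U := flat W a) he
      have f0 := hit_self (U := flat W a) hf
      rw [card_cls_ext2 hcF hxF hcxF] at e1 f1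
      -- With only four points in total, each of `e`, `f` has just one further hit coset, and
      -- `NoFreeTriple` with `c` and with `x` forces one of them to close with `c` and the other
      -- with `x`.
      have pe : Hit E (flat W a) (e + c) ∧ ¬ Hit E (flat W a) (e + x) ∧
          ¬ Hit E (flat W a) (e + c + x) ∧ Hit E (flat W a) (f + x) ∧
          ¬ Hit E (flat W a) (f + c) ∧ ¬ Hit E (flat W a) (f + c + x) ∨
          Hit E (flat W a) (e + x) ∧ ¬ Hit E (flat W a) (e + c) ∧
          ¬ Hit E (flat W a) (e + c + x) ∧ Hit E (flat W a) (f + c) ∧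
          ¬ Hit E (flat W a) (f + x) ∧ ¬ Hit E (flat W a) (f + c + x) := by
        simp only [hit_iff_card_pos] at *
        omega
      have hcx' := hcx
      rw [add_comm] at hcx'
      rcases pe with ⟨p1, p2, p3, p4, p5, p6⟩ | ⟨p1, p2, p3, p4, p5, p6⟩
      · exact h.false_of_two_closings hW.le hc hx he hf hcx hef p1 p2 p3 p4 p5 p6
      · rw [add_comm] at hef
        exact h.false_of_two_closings hW.le hc hx hf he hcx hef p4 p5 p6 p1 p2 p3
    have c1 := hit_iff_card_pos.1 (hit_self (U := flat W a) hc)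
    have x1 := hit_iff_card_pos.1 (hit_self (U := flat W a) hx)
    obtain ⟨α, β, hαβ, hb, -⟩ := weighted_lower_bound hspan k _ 2 3 hk
      (by obtain ⟨b, hb, hbF⟩ := h.exists_mem; exact ⟨b, hb, le_ext2 _ _ _ hbF⟩)
      (h3.mono (le_ext2 _ _ _)) (fun e he _ => two e he) three
    have h0 : α + 1 + (β + 1) + 2 = finrank (ZMod 2) V := by omega
    have hβ : 1 ≤ 2 ^ β := Nat.one_le_two_pow
    have hle := minCard_le (i := α + 1) (j := β + 1) h0
    rw [pow_succ, pow_succ] at hle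
    refine ⟨by omega, fun h6 => ?_⟩
    rcases Nat.eq_zero_or_pos β with rfl | hβ'
    · have := minCard_lt (i := α + 1) (j := 1) h0 (by omega) (by omega)
      rw [pow_succ] at this
      omega
    · have : 2 ≤ 2 ^ β := by
        calc 2 = 2 ^ 1 := rfl
          _ ≤ 2 ^ β := Nat.pow_le_pow_right (by norm_num) hβ'
      omega

end Frame
end BinMatroid

namespace BinMatroid
variable {V : Type*} [AddCommGroup V] [Module (ZMod 2) V]
variable {E : Finset V} {W U A B C : Submodule (ZMod 2) V} {a : V}

/-! ### Covers of a subspace by proper subspaces -/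

theorem exists_mem_not_mem_not_mem (hA : ∃ x ∈ W, x ∉ A) (hB : ∃ x ∈ W, x ∉ B) :
    ∃ x ∈ W, x ∉ A ∧ x ∉ B := by
  obtain ⟨x, hx, hxA⟩ := hA
  obtain ⟨y, hy, hyB⟩ := hB
  by_cases hxB : x ∈ B
  · by_cases hyA : y ∈ A
    · refine ⟨x + y, W.add_mem hx hy, fun h => hxA ?_, fun h => hyB ?_⟩
      · simpa only [char_two V] using A.add_mem h hyA
      · simpa only [char_two V] using B.add_mem h hxB
    · exact ⟨y, hy, hyA, hyB⟩
  · exact ⟨x, hx, hxA, hxB⟩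

theorem exists_mem_not_mem_of_cover (hcov : ∀ x ∈ W, x ∈ A ∨ x ∈ B ∨ x ∈ C)
    (hA : ∃ x ∈ W, x ∉ A) (hC : ∃ x ∈ W, x ∉ C) : ∃ x ∈ W, x ∈ B ∧ x ∉ A := by
  obtain ⟨x, hx, hxA, hxC⟩ := exists_mem_not_mem_not_mem hA hC
  exact ⟨x, hx, by have := hcov x hx; tauto, hxA⟩

/-- If `v` were also in `C`, translation by `v` would show that `B` and `C` alone cover `W`. -/
theorem not_mem_of_cover (hcov : ∀ x ∈ W, x ∈ A ∨ x ∈ B ∨ x ∈ C)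
    (hB : ∃ x ∈ W, x ∉ B) (hC : ∃ x ∈ W, x ∉ C) {v : V} (hv : v ∈ W) (hvB : v ∈ B)
    (hvA : v ∉ A) : v ∉ C := by
  intro hvC
  have key : ∀ x ∈ W, x ∉ B → x ∈ C := by
    intro x hx hxB
    by_cases hxA : x ∈ A
    · have h1 : x + v ∉ A := fun h => hvA (by simpa only [char_two V] using A.add_mem h hxA)
      have h2 : x + v ∉ B := fun h => hxB (by simpa only [char_two V] using B.add_mem h hvB)
      have h3 : x + v ∈ C := by have := hcov _ (W.add_mem hx hv); tauto
      simpa only [char_two V] using C.add_mem h3 hvC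
    · have := hcov x hx; tauto
  obtain ⟨x, hx, hxB, hxC⟩ := exists_mem_not_mem_not_mem hB hC
  exact hxC (key x hx hxB)

theorem eq_of_le_of_index_two (hA : ∀ v ∈ W, ∀ w ∈ W, v ∉ A → w ∉ A → v + w ∈ A) (hBW : B ≤ W)
    (hB : ∃ x ∈ W, x ∉ B) (hAB : A ≤ B) : A = B := by
  refine hAB.antisymm fun x hx => ?_
  by_contra hxA
  obtain ⟨y, hy, hyB⟩ := hB
  have := hAB (hA x (hBW hx) y hy hxA fun h => hyB (hAB h))
  exact hyB (by simpa only [char_two V] using B.add_mem this hx)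

theorem card_pts_le_two_mul_sdiff [FiniteDimensional (ZMod 2) V] [DecidableEq V] (hAW : A ≤ W)
    (hA : ∃ x ∈ W, x ∉ A) :
    (pts W).card ≤ 2 * (pts W \ pts A).card ∧ 2 * (pts A).card ≤ (pts W).card := by
  obtain ⟨x, hx, hxA⟩ := hA
  have h1 : (pts A).card ≤ (pts W \ pts A).card := by
    refine Finset.card_le_card_of_injOn (x + ·) ?_ (fun _ _ _ _ h => add_left_cancel h)
    intro y hy
    rw [Finset.mem_coe, mem_pts] at hy
    rw [Finset.mem_coe, Finset.mem_sdiff, mem_pts, mem_pts]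
    exact ⟨W.add_mem hx (hAW hy), fun h => hxA (by
      simpa only [char_two V] using A.add_mem h hy)⟩
  have h2 := Finset.card_sdiff_add_card_eq_card (pts_mono hAW)
  omega

/-! ### Free triples of cosets -/

/-- Modulo `U`, no sum of two or three of the points `c`, `s`, `t` lies in `E`. -/
def FreeTriple (E : Finset V) (U : Submodule (ZMod 2) V) (c s t : V) : Prop :=
  ¬ Hit E U (s + t) ∧ ¬ Hit E U (s + t + c) ∧ ¬ Hit E U (s + c) ∧ ¬ Hit E U (t + c)

namespace FreeTriple
variable {c s t : V}

theorem swap (h : FreeTriple E U c s t) : FreeTriple E U c t s :=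
  ⟨by rw [add_comm]; exact h.1, by rw [add_comm t]; exact h.2.1, h.2.2.2, h.2.2.1⟩

theorem rotate (h : FreeTriple E U c s t) : FreeTriple E U s t c :=
  ⟨h.2.2.2, by rw [add_comm, ← add_assoc]; exact h.2.1, by rw [add_comm]; exact h.1,
    by rw [add_comm]; exact h.2.2.1⟩

theorem mono {U' : Submodule (ZMod 2) V} (h : FreeTriple E U' c s t) (hU : U ≤ U') :
    FreeTriple E U c s t :=
  ⟨fun h' => h.1 (h'.mono hU), fun h' => h.2.1 (h'.mono hU), fun h' => h.2.2.1 (h'.mono hU),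
    fun h' => h.2.2.2 (h'.mono hU)⟩

theorem congr {c' : V} (h : FreeTriple E U c s t) (hc : c + c' ∈ U) : FreeTriple E U c' s t := by
  refine ⟨h.1, fun h' => h.2.1 (h'.congr ?_), fun h' => h.2.2.1 (h'.congr ?_),
    fun h' => h.2.2.2 (h'.congr ?_)⟩ <;> simpa only [char_two V] using hc

end FreeTriple

theorem not_noFreeTriple : ¬ NoFreeTriple E U ↔
    ∃ c ∈ E, ∃ s ∈ E, ∃ t ∈ E, FreeTriple E U c s t := by
  simp only [NoFreeTriple, FreeTriple]
  push Not
  constructor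
  · rintro ⟨c, hc, s, hs, t, ht, h1, h2, h3, h4⟩
    exact ⟨c, hc, s, hs, t, ht, h3, by rwa [add_comm, ← add_assoc], by rwa [add_comm],
      by rwa [add_comm]⟩
  · rintro ⟨c, hc, s, hs, t, ht, h1, h2, h3, h4⟩
    exact ⟨c, hc, s, hs, t, ht, by rwa [add_comm], by rwa [add_comm], h1,
      by rwa [add_assoc, add_comm]⟩

/-- The points of `E` in `c + flat W a` form a coset of a subspace of index two of `W`. -/
structure IsHalf (E : Finset V) (W : Submodule (ZMod 2) V) (a c : V) : Prop where
  mem : c ∈ E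
  not_mem : c ∉ flat W a
  add_mem : ∀ v ∈ W, ∀ w ∈ W, v ∉ stab E W a c → w ∉ stab E W a c → v + w ∈ stab E W a c
  mem_stab : ∀ e ∈ E, e + c ∈ flat W a → ∀ u ∈ W, e + u ∈ E → u ∈ stab E W a c
  proper : ∃ w ∈ W, w ∉ stab E W a c

theorem IsHalf.add_mem_iff {c u : V} (h : IsHalf E W a c) (hu : u ∈ W) :
    c + u ∈ E ↔ u ∈ stab E W a c :=
  ⟨h.mem_stab c h.mem (by simp only [char_two V, zero_mem]) u hu,
    fun hh => hh.2 c h.mem (by simp only [char_two V, zero_mem])⟩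

variable [FiniteDimensional (ZMod 2) V]

namespace Frame

/-- The stabilisers of a free triple are proper and cover `W`, hence have index two. A point `e` of
the coset with `e + u ∈ E` for some `u` outside the stabiliser would give `e + W ⊆ E`, against
maximality. -/
theorem isHalf (h : Frame E W a) {c s t : V} (hc : c ∈ E) (hs : s ∈ E) (ht : t ∈ E)
    (hf : FreeTriple E (flat W a) c s t) : IsHalf E W a c := by
  have hcF := BinMatroid.not_mem_of_not_hit' hs hf.2.2.1
  have hsF := BinMatroid.not_mem_of_not_hit ht hf.1
  have htF := BinMatroid.not_mem_of_not_hit' hs hf.1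
  have hidx : ∀ v ∈ W, ∀ w ∈ W, v ∉ stab E W a c → w ∉ stab E W a c → v + w ∈ stab E W a c :=
    fun v hv w hw hvc hwc => add_mem_of_subset_cover
      (fun u hu => h.stab_cover hf.1 hf.2.1 hf.2.2.1 hf.2.2.2 hu)
      (h.exists_not_mem_stab hs hsF) (h.exists_not_mem_stab ht htF) hv hw hvc hwc
  refine ⟨hc, hcF, hidx, fun e he hec u hu heu => ?_, h.exists_not_mem_stab hc hcF⟩
  by_contra hus
  have heF : e ∉ flat W a := fun hh => hcF (by
    simpa only [char_two V] using (flat W a).add_mem hh hec)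
  obtain ⟨w, hw, hew⟩ := h.exists_add_not_mem heF
  by_cases hws : w ∈ stab E W a c
  · exact hew (hws.2 e he hec)
  · have := (hidx u hu w hw hus hws).2 _ heu (by
      simpa only [char_two V] using (flat W a).add_mem hec (le_flat W a hu))
    exact hew (by simpa only [char_two V] using this)

theorem two_mul_card_of_isHalf (h : Frame E W a) {c : V} (hc : IsHalf E W a c) :
    2 * (cls E (flat W a) c).card = (pts W).card := by
  classical
  have h1 := card_stab_le (W := W) (a := a) hc.mem
  have h2 := card_pts_le_two_mul hc.add_mem
  have h3 := (card_pts_le_two_mul_sdiff (stab_le (E := E) (W := W) (a := a) c) hc.proper).2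
  have h4 : (cls E (flat W a) c).card ≤ (pts (stab E W a c)).card := by
    refine Finset.card_le_card_of_injOn (c + ·) ?_ (fun _ _ _ _ h => add_left_cancel h)
    intro e he
    rw [Finset.mem_coe, mem_cls] at he
    rw [Finset.mem_coe, mem_pts, ← hc.add_mem_iff]
    · simpa only [char_two V] using he.1
    · change c + e ∈ W
      rw [add_comm]; exact h.add_mem he.1 hc.mem he.2
  omega

-- For `v` in the stabiliser of `e`, triangle-freeness puts both `p + e + f` and `p + e + f + v`
-- outside the stabiliser of `p`, which has index two and so contains their sum `v`.
omit [FiniteDimensional (ZMod 2) V] in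
theorem stab_eq_of_add_add_mem (h : Frame E W a) {e f p : V} (he : IsHalf E W a e) (hf : f ∈ E)
    (hp : IsHalf E W a p) (hpef : p + e + f ∈ W) : stab E W a e = stab E W a p := by
  have hu : p + e + f ∉ stab E W a p := fun hh => h.sumFree e he.mem f hf (by
    rw [← hp.add_mem_iff hpef] at hh
    simpa only [char_two V] using hh)
  refine eq_of_le_of_index_two he.add_mem (stab_le _) hp.proper fun v hv => ?_
  have hvW := stab_le _ hv
  rw [← he.add_mem_iff hvW] at hv
  have huv : p + e + f + v ∉ stab E W a p := fun hh => h.sumFree _ hv f hf (by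
    rw [← hp.add_mem_iff (W.add_mem hpef hvW)] at hh
    simpa only [char_two V] using hh)
  simpa only [char_two V] using hp.add_mem _ hpef _ (W.add_mem hpef hvW) hu huv

omit [FiniteDimensional (ZMod 2) V] in
theorem stab_cover' (h : Frame E W a) {c s t : V} (hf : FreeTriple E (flat W a) c s t) :
    ∀ u ∈ W, u ∈ stab E W a c ∨ u ∈ stab E W a s ∨ u ∈ stab E W a t :=
  fun _ hu => h.stab_cover hf.1 hf.2.1 hf.2.2.1 hf.2.2.2 hu

/-- The stabilisers of a free triple are distinct, so a common vector of two of them lies in the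
third. -/
theorem exists_mem_stab_not_mem_stab (h : Frame E W a) {c s t : V} (hc : c ∈ E) (hs : s ∈ E)
    (ht : t ∈ E) (hf : FreeTriple E (flat W a) c s t) :
    (∃ u ∈ W, u ∈ stab E W a s ∧ u ∉ stab E W a c) ∧
    ∀ u ∈ W, u ∈ stab E W a s → u ∉ stab E W a c → u ∉ stab E W a t := by
  have hc' := (h.isHalf hc hs ht hf).proper
  have hs' := (h.isHalf hs ht hc hf.rotate).proper
  have ht' := (h.isHalf ht hc hs hf.rotate.rotate).proper
  exact ⟨exists_mem_not_mem_of_cover (h.stab_cover' hf) hc' ht',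
    fun u hu hus huc => not_mem_of_cover (h.stab_cover' hf) hs' ht' hu hus huc⟩

theorem stab_ne (h : Frame E W a) {c s t : V} (hc : c ∈ E) (hs : s ∈ E)
    (ht : t ∈ E) (hf : FreeTriple E (flat W a) c s t) : stab E W a c ≠ stab E W a s := by
  obtain ⟨u, -, hus, huc⟩ := (h.exists_mem_stab_not_mem_stab hc hs ht hf).1
  exact fun heq => huc (heq ▸ hus)

/-! ### Free triples modulo a larger flat -/

/-- If `s₁, s₂, s₃` are free modulo a flat `U` containing the half coset of `y`, then one of the
sums of `y` with `s₂` or `s₃` meets `E`. -/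
theorem add_add_mem_or (h : Frame E W a) {s₁ s₂ s₃ y u : V} (hU : flat W a ≤ U)
    (h1 : s₁ ∈ E) (h2 : s₂ ∈ E) (h3 : s₃ ∈ E) (hf : FreeTriple E U s₁ s₂ s₃)
    (hy : IsHalf E W a y) (hyU : y ∈ U) (hu : u ∈ W) (hu1 : u ∈ stab E W a s₁)
    (hu2 : u ∉ stab E W a s₂) (hu3 : u ∉ stab E W a s₃) (huy : u ∉ stab E W a y) :
    s₂ + y + u ∈ E ∨ s₃ + y + u ∈ E := by
  have k1 := h.isHalf h1 h2 h3 (hf.mono hU)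
  have k2 := h.isHalf h2 h3 h1 (hf.rotate.mono hU)
  have k3 := h.isHalf h3 h1 h2 (hf.rotate.rotate.mono hU)
  rw [← k1.add_mem_iff hu] at hu1
  rw [← k2.add_mem_iff hu] at hu2
  rw [← k3.add_mem_iff hu] at hu3
  rw [← hy.add_mem_iff hu] at huy
  have huU := hU (le_flat W a hu)
  obtain ⟨f1, f2, f3, f4⟩ := hf
  have key : ∀ v, ¬ Hit E U v → v ∉ E ∧ v + u ∉ E ∧ v + y ∉ E ∧ v + y + u ∉ E := by
    intro v hv
    refine ⟨fun hh => hv (hit_self hh), fun hh => hv ⟨_, hh, ?_⟩, fun hh => hv ⟨_, hh, ?_⟩,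
      fun hh => hv ⟨_, hh, ?_⟩⟩
    · simpa only [char_two V] using huU
    · simpa only [char_two V] using hyU
    · simpa only [char_two V] using U.add_mem hyU huU
  have g1 := key _ f1
  have g2 := key _ f2
  have g3 := key _ f3
  have g4 := key _ f4
  -- The second point is `s₁ + u`; freeness modulo `U` excludes all other sums.
  have := h.fiveSum s₁ h1 _ hu1 s₂ h2 s₃ h3 y hy.mem
  simp only [char_two V] at this hu2 hu3 huy g1 g2 g3 g4 ⊢
  tauto

/-- A point of `E` in `s₂ + y + W` forces the stabilisers of `s₂` and `y` to agree. -/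
theorem stab_eq_stab_of_mem (h : Frame E W a) {s₁ s₂ s₃ y u : V} (hU : flat W a ≤ U)
    (h1 : s₁ ∈ E) (h2 : s₂ ∈ E) (h3 : s₃ ∈ E) (hf : FreeTriple E U s₁ s₂ s₃)
    (hy : IsHalf E W a y) (hyU : y ∈ U) (hu : u ∈ W) (hm : s₁ + y + u ∈ E) :
    IsHalf E W a (s₁ + y + u) ∧ stab E W a s₁ = stab E W a (s₁ + y + u) ∧
      stab E W a y = stab E W a (s₁ + y + u) := by
  have huU := hU (le_flat W a hu)
  have k1 := h.isHalf h1 h2 h3 (hf.mono hU)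
  have kp := h.isHalf hm h2 h3 ((hf.congr (c' := s₁ + y + u) (by
    simpa only [char_two V] using U.add_mem hyU huU)).mono hU)
  exact ⟨kp, h.stab_eq_of_add_add_mem k1 hy.mem kp (by simpa only [char_two V] using hu),
    h.stab_eq_of_add_add_mem hy h1 kp (by simpa only [char_two V] using hu)⟩

/-- Otherwise some `u` stabilises `s₁` but none of `s₂`, `s₃`, `y`. Then `add_add_mem_or` gives a
point over `s₂ + y` or `s₃ + y`, and such a point identifies two stabilisers. -/
theorem exists_stab_eq (h : Frame E W a) {s₁ s₂ s₃ y : V} (hU : flat W a ≤ U)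
    (h1 : s₁ ∈ E) (h2 : s₂ ∈ E) (h3 : s₃ ∈ E) (hf : FreeTriple E U s₁ s₂ s₃)
    (hy : IsHalf E W a y) (hyU : y ∈ U) :
    stab E W a s₁ = stab E W a y ∨ stab E W a s₂ = stab E W a y ∨
      stab E W a s₃ = stab E W a y := by
  by_contra hcon
  push Not at hcon
  have k1 := h.isHalf h1 h2 h3 (hf.mono hU)
  obtain ⟨v, hv, hv1, hv2⟩ := (h.exists_mem_stab_not_mem_stab h2 h1 h3
    (hf.swap.rotate.rotate.mono hU)).1
  obtain ⟨u, hu1, hu2, huy⟩ := exists_mem_not_mem_not_mem (W := stab E W a s₁)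
    (A := stab E W a s₂) (B := stab E W a y) ⟨v, hv1, hv2⟩ (by
      by_contra hle
      push Not at hle
      exact hcon.1 (eq_of_le_of_index_two k1.add_mem (stab_le _) hy.proper hle))
  have hu := stab_le _ hu1
  have hu3 := (h.exists_mem_stab_not_mem_stab h2 h1 h3 (hf.swap.rotate.rotate.mono hU)).2
    u hu hu1 hu2
  rcases h.add_add_mem_or hU h1 h2 h3 hf hy hyU hu hu1 hu2 hu3 huy with hm | hm
  · have := h.stab_eq_stab_of_mem hU h2 h3 h1 hf.rotate hy hyU hu hm
    exact hcon.2.1 (this.2.1.trans this.2.2.symm)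
  · have := h.stab_eq_stab_of_mem hU h3 h1 h2 hf.rotate.rotate hy hyU hu hm
    exact hcon.2.2 (this.2.1.trans this.2.2.symm)

theorem exists_add_add_mem (h : Frame E W a) {s₁ s₂ s₃ y : V} (hU : flat W a ≤ U)
    (h1 : s₁ ∈ E) (h2 : s₂ ∈ E) (h3 : s₃ ∈ E) (hf : FreeTriple E U s₁ s₂ s₃)
    (hy : IsHalf E W a y) (hyU : y ∈ U) (heq : stab E W a s₁ = stab E W a y) :
    ∃ u ∈ W, s₁ + y + u ∈ E := by
  obtain ⟨⟨u, hu, hu2, hu1⟩, hk⟩ := h.exists_mem_stab_not_mem_stab h1 h2 h3 (hf.mono hU)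
  have hu3 := hk u hu hu2 hu1
  rcases h.add_add_mem_or hU h2 h1 h3 hf.swap.rotate.rotate hy hyU hu hu2 hu1 hu3
    (by rwa [← heq]) with hm | hm
  · exact ⟨u, hu, hm⟩
  · have := h.stab_eq_stab_of_mem hU h3 h1 h2 hf.rotate.rotate hy hyU hu hm
    have h31 := h.stab_ne h3 h1 h2 (hf.rotate.rotate.mono hU)
    exact absurd (this.2.1.trans (this.2.2.symm.trans heq.symm)) h31

/-- `FiveSum` fails for `s₁`, `s₂`, `s₃`, `y`, `z`: freeness kills sums with two or three of the
`sᵢ`, and a point at `s₁ + y + z` or `s₂ + y + z` would force `y` and `z` to have equal stabilisers.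
-/
theorem not_stab_eq_and_stab_eq (h : Frame E W a) {s₁ s₂ s₃ y z : V} (hU : flat W a ≤ U)
    (h1 : s₁ ∈ E) (h2 : s₂ ∈ E) (h3 : s₃ ∈ E) (hf : FreeTriple E U s₁ s₂ s₃)
    (hy : IsHalf E W a y) (hyU : y ∈ U) (hz : IsHalf E W a z) (hzU : z ∈ U)
    (hm : s₃ + y + z ∉ E) (heq1 : stab E W a s₁ = stab E W a y)
    (heq2 : stab E W a s₂ = stab E W a z) : False := by
  have hne := h.stab_ne h1 h2 h3 (hf.mono hU)
  rw [heq1, heq2] at hne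
  -- a point of `E` in the coset of `s + y` excludes one in the coset of `s + y + z`
  have key : ∀ {s₁ s₂ s₃ y z : V}, s₁ ∈ E → s₂ ∈ E → s₃ ∈ E → FreeTriple E U s₁ s₂ s₃ →
      IsHalf E W a y → y ∈ U → IsHalf E W a z → z ∈ U → stab E W a s₁ = stab E W a y →
      stab E W a y ≠ stab E W a z → s₁ + y + z ∉ E := by
    intro s₁ s₂ s₃ y z h1 h2 h3 hf hy hyU hz hzU heq hne hm
    obtain ⟨u, hu, hmu⟩ := h.exists_add_add_mem hU h1 h2 h3 hf hy hyU heq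
    obtain ⟨kp, e1, e2⟩ := h.stab_eq_stab_of_mem hU h1 h2 h3 hf hy hyU hu hmu
    have huU := hU (le_flat W a hu)
    have kq := h.isHalf hm h2 h3 ((hf.congr (c' := s₁ + y + z) (by
      simpa only [char_two V] using U.add_mem hyU hzU)).mono hU)
    have e3 := h.stab_eq_of_add_add_mem hz kp.mem kq (by simpa only [char_two V] using hu)
    have e4 := h.stab_eq_of_add_add_mem kp hz.mem kq (by simpa only [char_two V] using hu)
    exact hne (e2.trans (e4.trans e3.symm))
  have m1 := key h1 h2 h3 hf hy hyU hz hzU heq1 hne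
  have m2 := key h2 h1 h3 hf.swap.rotate.rotate hz hzU hy hyU heq2 hne.symm
  obtain ⟨f1, f2, f3, f4⟩ := hf
  have key : ∀ v, ¬ Hit E U v → v ∉ E ∧ v + z ∉ E ∧ v + y ∉ E ∧ v + y + z ∉ E := by
    intro v hv
    refine ⟨fun hh => hv (hit_self hh), fun hh => hv ⟨_, hh, ?_⟩, fun hh => hv ⟨_, hh, ?_⟩,
      fun hh => hv ⟨_, hh, ?_⟩⟩
    · simpa only [char_two V] using hzU
    · simpa only [char_two V] using hyU
    · simpa only [char_two V] using U.add_mem hyU hzU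
  have g1 := key _ f1
  have g2 := key _ f2
  have g3 := key _ f3
  have g4 := key _ f4
  have := h.fiveSum s₁ h1 s₂ h2 s₃ h3 y hy.mem z hz.mem
  simp only [char_two V] at this hm m1 m2 g1 g2 g3 g4
  tauto

omit [FiniteDimensional (ZMod 2) V] in
theorem isHalf_congr {c e : V} (hc : IsHalf E W a c) (he : e ∈ E) (hce : c + e ∈ flat W a) :
    IsHalf E W a e := by
  have hs : stab E W a e = stab E W a c := (stab_congr hce).symm
  refine ⟨he, fun hh => hc.not_mem ?_, ?_, ?_, ?_⟩
  · simpa only [char_two V] using (flat W a).add_mem hh hce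
  · rw [hs]; exact hc.add_mem
  · rw [hs]
    intro f hf hfe
    exact hc.mem_stab f hf (by simpa only [char_two V] using (flat W a).add_mem hfe hce)
  · rw [hs]; exact hc.proper

/-- The condition `s₃ + y + z ∉ E` can be achieved by moving `y` and `z` inside their half cosets,
since the two distinct stabilisers together span `W`. -/
theorem not_stab_eq_and_stab_eq' (h : Frame E W a) {s₁ s₂ s₃ y z : V} (hU : flat W a ≤ U)
    (h1 : s₁ ∈ E) (h2 : s₂ ∈ E) (h3 : s₃ ∈ E) (hf : FreeTriple E U s₁ s₂ s₃)
    (hy : IsHalf E W a y) (hyU : y ∈ U) (hz : IsHalf E W a z) (hzU : z ∈ U)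
    (heq1 : stab E W a s₁ = stab E W a y) (heq2 : stab E W a s₂ = stab E W a z) : False := by
  have k1 := h.isHalf h1 h2 h3 (hf.mono hU)
  have k2 := h.isHalf h2 h3 h1 (hf.rotate.mono hU)
  have hs3 : s₃ + y + z ∉ flat W a := fun hh =>
    BinMatroid.not_mem_of_not_hit h1 hf.2.2.2 (by
      simpa only [char_two V] using U.add_mem (U.add_mem (hU hh) hyU) hzU)
  obtain ⟨w, hw, hsw⟩ := h.exists_add_not_mem hs3
  obtain ⟨v₀, hv₀, hv1, hv2⟩ := (h.exists_mem_stab_not_mem_stab h2 h1 h3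
    (hf.swap.rotate.rotate.mono hU)).1
  obtain ⟨v, hv, hvw⟩ : ∃ v ∈ stab E W a s₁, v + w ∈ stab E W a s₂ := by
    by_cases hw2 : w ∈ stab E W a s₂
    · exact ⟨0, zero_mem _, by rwa [zero_add]⟩
    · exact ⟨v₀, hv1, k2.add_mem v₀ hv₀ w hw hv2 hw2⟩
  have hvF := le_flat W a (stab_le _ hv)
  have hvwF := le_flat W a (stab_le _ hvw)
  have hyv : y + v ∈ E := by rw [hy.add_mem_iff (stab_le _ hv), ← heq1]; exact hv
  have hzv : z + (v + w) ∈ E := by rw [hz.add_mem_iff (stab_le _ hvw), ← heq2]; exact hvw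
  have ey : y + (y + v) ∈ flat W a := by simpa only [char_two V] using hvF
  have ez : z + (z + (v + w)) ∈ flat W a := by simpa only [char_two V] using hvwF
  exact h.not_stab_eq_and_stab_eq hU h1 h2 h3 hf (isHalf_congr hy hyv ey)
    (U.add_mem hyU (hU hvF)) (isHalf_congr hz hzv ez) (U.add_mem hzU (hU hvwF))
    (by simpa only [char_two V] using hsw) (heq1.trans (stab_congr ey))
    (heq2.trans (stab_congr ez))

/-- In a free triple modulo `U`, some member shares its stabiliser with `y` and some member with
`z`. One member for both gives equal stabilisers; two different members are excluded by
`not_stab_eq_and_stab_eq'`. -/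
theorem noFreeTriple_of_isHalf (h : Frame E W a) {y z : V} (hU : flat W a ≤ U)
    (hy : IsHalf E W a y) (hyU : y ∈ U) (hz : IsHalf E W a z) (hzU : z ∈ U)
    (hne : stab E W a y ≠ stab E W a z) : NoFreeTriple E U := by
  by_contra hcon
  obtain ⟨c, hc, s, hs, t, ht, hf⟩ := not_noFreeTriple.1 hcon
  rcases h.exists_stab_eq hU hc hs ht hf hy hyU with h1 | h1 | h1 <;>
    rcases h.exists_stab_eq hU hc hs ht hf hz hzU with h2 | h2 | h2
  · exact hne (h1.symm.trans h2)
  · exact h.not_stab_eq_and_stab_eq' hU hc hs ht hf hy hyU hz hzU h1 h2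
  · exact h.not_stab_eq_and_stab_eq' hU hc ht hs hf.swap hy hyU hz hzU h1 h2
  · exact h.not_stab_eq_and_stab_eq' hU hc hs ht hf hz hzU hy hyU h2 h1
  · exact hne (h1.symm.trans h2)
  · exact h.not_stab_eq_and_stab_eq' hU hs ht hc hf.rotate hy hyU hz hzU h1 h2
  · exact h.not_stab_eq_and_stab_eq' hU hc ht hs hf.swap hz hzU hy hyU h2 h1
  · exact h.not_stab_eq_and_stab_eq' hU hs ht hc hf.rotate hz hzU hy hyU h2 h1
  · exact hne (h1.symm.trans h2)

end Frame
end BinMatroid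

namespace BinMatroid
variable {V : Type*} [AddCommGroup V] [Module (ZMod 2) V]
variable {E : Finset V} {W U : Submodule (ZMod 2) V} {a c s t u : V}

/-! ### Sums with a half coset -/

/-- Some point of `E` differs from `s + c` by a vector of `W`. -/
def EvenSum (E : Finset V) (W : Submodule (ZMod 2) V) (c s : V) : Prop := ∃ p ∈ E, p + s + c ∈ W

namespace Frame

theorem add_add_not_mem_of_evenSum (h : Frame E W a) (hs : EvenSum E W c s) {b : V}
    (hb : b + a ∈ W) : s + c + b ∉ E := by
  obtain ⟨p, hp, hpW⟩ := hs
  intro hh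
  have hbF : b ∈ flat W a := mem_flat.2 (Or.inr hb)
  have := h.add_mem hp hh (by
    simpa only [char_two V] using (flat W a).add_mem (le_flat W a hpW) hbF)
  have hbW : b ∈ W := by simpa only [char_two V] using W.add_mem this hpW
  exact h.base_not_mem (by simpa only [char_two V] using W.add_mem hbW hb)

/-- If `u` is not in the stabiliser, then by index two either `p + s` or `p + s + u` is a point of
the half coset of `c`, completing a triangle with `p` and `s` or with `p` and `s + u`. -/
theorem mem_stab_of_evenSum (h : Frame E W a) (hc : IsHalf E W a c) (hs : s ∈ E)
    (hev : EvenSum E W c s) (hu : u ∈ W) (hsu : s + u ∈ E) : u ∈ stab E W a c := by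
  obtain ⟨p, hp, hpW⟩ := hev
  by_contra hus
  by_cases hq : p + s + c ∈ stab E W a c
  · rw [← hc.add_mem_iff hpW] at hq
    exact h.sumFree s hs _ hq (by simpa only [char_two V] using hp)
  · have := hc.add_mem _ hpW u hu hq hus
    rw [← hc.add_mem_iff (W.add_mem hpW hu)] at this
    exact h.sumFree _ hsu _ this (by simpa only [char_two V] using hp)

theorem evenSum_congr (h : Frame E W a) {s' c' : V} (hev : EvenSum E W c' s') (hs : s ∈ E)
    (hs' : s' ∈ E) (hc : c ∈ E) (hc' : c' ∈ E) (hss : s' + s ∈ flat W a)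
    (hcc : c' + c ∈ flat W a) : EvenSum E W c s := by
  obtain ⟨p, hp, hpW⟩ := hev
  refine ⟨p, hp, ?_⟩
  simpa only [char_two V] using
    W.add_mem hpW (W.add_mem (h.add_mem hs' hs hss) (h.add_mem hc' hc hcc))

variable [FiniteDimensional (ZMod 2) V]

/-- For `u` in `W` outside the stabiliser of `c`, every sum except `s + c + u` and `t + c + u` is
excluded, so two slices cover half of `W`. -/
theorem card_pts_le_of_evenSum (h : Frame E W a) (hc : IsHalf E W a c) (hs : s ∈ E) (ht : t ∈ E)
    (hst : ¬ Hit E (flat W a) (s + t)) (hstc : ¬ Hit E (flat W a) (s + t + c))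
    (hsc : EvenSum E W c s) (htc : EvenSum E W c t) :
    (pts W).card ≤
      2 * (cls E (flat W a) (s + c)).card + 2 * (cls E (flat W a) (t + c)).card := by
  classical
  have hsub : pts W \ pts (stab E W a c) ⊆ slice E W (s + c) ∪ slice E W (t + c) := by
    intro u hu
    rw [Finset.mem_sdiff, mem_pts, mem_pts] at hu
    obtain ⟨hu, huc⟩ := hu
    have k1 := h.add_add_not_mem_of_evenSum hsc (b := a) (by simp only [char_two V, zero_mem])
    have k2 := h.add_add_not_mem_of_evenSum hsc (b := a + u) (by simpa only [char_two V])
    have k3 := h.add_add_not_mem_of_evenSum htc (b := a) (by simp only [char_two V, zero_mem])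
    have k4 := h.add_add_not_mem_of_evenSum htc (b := a + u) (by simpa only [char_two V])
    have k5 := fun hh => huc (h.mem_stab_of_evenSum hc hs hsc hu hh)
    have k6 := fun hh => huc (h.mem_stab_of_evenSum hc ht htc hu hh)
    have := h.fiveSum_of_not_hit hc.mem hs ht hst hstc hu (b := a)
      (by simp only [char_two V, zero_mem])
    rw [← hc.add_mem_iff hu] at huc
    simp only [Finset.mem_union, mem_slice]
    rw [← add_assoc] at k2 k4
    tauto
  have e1 := Finset.card_le_card hsub
  have e2 := Finset.card_union_le (slice E W (s + c)) (slice E W (t + c))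
  have e3 := (card_pts_le_two_mul_sdiff (stab_le (E := E) (W := W) (a := a) c) hc.proper).1
  have e4 := card_slice_le (E := E) (W := W) (a := a) (x := s + c) (y := s + c)
    (by simp only [char_two V, zero_mem])
  have e5 := card_slice_le (E := E) (W := W) (a := a) (x := t + c) (y := t + c)
    (by simp only [char_two V, zero_mem])
  omega

/-- Either some `u` avoids the three stabilisers and `card_pts_le_of_sums` applies, or they cover
`W` and those of `s` and `t` have index two. -/
theorem card_pts_le_of_not_evenSum (h : Frame E W a) (hc : IsHalf E W a c) (hs : s ∈ E)
    (ht : t ∈ E) (hst : ¬ Hit E (flat W a) (s + t)) (hstc : ¬ Hit E (flat W a) (s + t + c))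
    (hsc : ¬ EvenSum E W c s) (htc : ¬ EvenSum E W c t) :
    (pts W).card ≤
      2 * (cls E (flat W a) (s + c)).card + 2 * (cls E (flat W a) (t + c)).card ∨
    ((pts W).card ≤ 2 * (cls E (flat W a) s).card ∧
      (pts W).card ≤ 2 * (cls E (flat W a) t).card) := by
  by_cases hex : ∃ u ∈ W, u ∉ stab E W a c ∧ u ∉ stab E W a s ∧ u ∉ stab E W a t
  · left
    obtain ⟨u, hu, huc, hus, hut⟩ := hex
    obtain ⟨c', hc', hcF, hcu⟩ := exists_of_not_mem_stab hu huc
    obtain ⟨s', hs', hsF, hsu⟩ := exists_of_not_mem_stab hu hus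
    obtain ⟨t', ht', htF, htu⟩ := exists_of_not_mem_stab hu hut
    have hstF := (flat W a).add_mem hsF htF
    have hstcF := (flat W a).add_mem hstF hcF
    have hscF := (flat W a).add_mem hsF hcF
    have htcF := (flat W a).add_mem htF hcF
    have ev : ∀ s s', s ∈ E → s' ∈ E → s' + s ∈ flat W a → ¬ EvenSum E W c s →
        s' + c' + u ∉ E := by
      intro s s' hs hs' hsF hev hh
      exact hev (h.evenSum_congr ⟨_, hh, by simpa only [char_two V] using hu⟩ hs hs' hc.mem hc'
        hsF hcF)
    have := h.card_pts_le_of_sums hc' hs' ht'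
      (fun hh => hst (hh.congr (by simpa only [char_two V] using hstF)))
      (fun hh => hstc (hh.congr (by simpa only [char_two V] using hstcF))) hu hcu hsu htu
      (ev s s' hs hs' hsF hsc) (ev t t' ht ht' htF htc)
    rwa [cls_congr (x := s' + c') (y := s + c) (by simpa only [char_two V] using hscF),
      cls_congr (x := t' + c') (y := t + c) (by simpa only [char_two V] using htcF)] at this
  · right
    push Not at hex
    have hcov : ∀ u ∈ W, u ∈ stab E W a c ∨ u ∈ stab E W a s ∨ u ∈ stab E W a t := by
      intro u hu
      have := hex u hu
      tauto
    have ps := h.exists_not_mem_stab hs (BinMatroid.not_mem_of_not_hit ht hst)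
    have pt := h.exists_not_mem_stab ht (BinMatroid.not_mem_of_not_hit' hs hst)
    have e1 := card_pts_le_two_mul (A := stab E W a s) (fun v hv w hw hvA hwA =>
      add_mem_of_subset_cover (fun x hx => by have := hcov x hx; tauto) hc.proper pt hv hw hvA hwA)
    have e2 := card_pts_le_two_mul (A := stab E W a t) (fun v hv w hw hvA hwA =>
      add_mem_of_subset_cover (fun x hx => by have := hcov x hx; tauto) hc.proper ps hv hw hvA hwA)
    have e3 := card_stab_le (W := W) (a := a) hs
    have e4 := card_stab_le (W := W) (a := a) ht
    omega

-- By `hlt` the two slices of `t + c` at `a` and `a + u` do not cover `W`, so some `b = a + w`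
-- excludes both sums. This forces `t + u` or `s + c + u` into `E` for each `u` outside the
-- stabiliser of `c`.
open Classical in
theorem card_pts_le_of_evenSum_of_not_evenSum (h : Frame E W a) (hc : IsHalf E W a c) (hs : s ∈ E)
    (ht : t ∈ E) (hst : ¬ Hit E (flat W a) (s + t)) (hstc : ¬ Hit E (flat W a) (s + t + c))
    (hsc : EvenSum E W c s) (htc : ¬ EvenSum E W c t)
    (hlt : 2 * (cls E (flat W a) (t + c)).card < (pts W).card) :
    (pts W).card ≤ 2 * ((slice E W t \ pts (stab E W a c)).card +
      (cls E (flat W a) (s + c)).card) := by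
  have hsub : pts W \ pts (stab E W a c) ⊆
      (slice E W t \ pts (stab E W a c)) ∪ slice E W (s + c) := by
    intro u hu
    rw [Finset.mem_sdiff, mem_pts, mem_pts] at hu
    obtain ⟨hu, huc⟩ := hu
    obtain ⟨w, hw, m1, m2⟩ : ∃ w ∈ W, t + c + a + w ∉ E ∧ t + c + (a + u) + w ∉ E := by
      by_contra hcon
      push Not at hcon
      have h1 : pts W ⊆ slice E W (t + c + a) ∪ slice E W (t + c + (a + u)) := by
        intro w hw
        rw [mem_pts] at hw
        have := hcon w hw
        simp only [Finset.mem_union, mem_slice]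
        tauto
      have e1 := Finset.card_le_card h1
      have e2 := Finset.card_union_le (slice E W (t + c + a)) (slice E W (t + c + (a + u)))
      have e3 := card_slice_le (E := E) (W := W) (a := a) (x := t + c) (y := t + c + a)
        (by simpa only [char_two V] using base_mem_flat W a)
      have e4 := card_slice_le (E := E) (W := W) (a := a) (x := t + c) (y := t + c + (a + u))
        (by simpa only [char_two V] using
          (flat W a).add_mem (base_mem_flat W a) (le_flat W a hu))
      omega
    have k1 := h.add_add_not_mem_of_evenSum hsc (b := a + w) (by simpa only [char_two V])
    have k2 := h.add_add_not_mem_of_evenSum hsc (b := a + w + u) (by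
      simpa only [char_two V] using W.add_mem hw hu)
    have k5 := fun hh => huc (h.mem_stab_of_evenSum hc hs hsc hu hh)
    have k6 : t + c + u ∉ E := fun hh => htc ⟨_, hh, by simpa only [char_two V] using hu⟩
    have := h.fiveSum_of_not_hit hc.mem hs ht hst hstc hu (b := a + w)
      (by simpa only [char_two V])
    have huc' := huc
    rw [← hc.add_mem_iff hu] at huc
    simp only [Finset.mem_union, mem_slice, Finset.mem_sdiff, mem_pts]
    simp only [char_two V] at this m1 m2 k1 k2 k5 k6 huc ⊢
    tauto
  have e1 := Finset.card_le_card hsub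
  have e2 := Finset.card_union_le (slice E W t \ pts (stab E W a c)) (slice E W (s + c))
  have e3 := (card_pts_le_two_mul_sdiff (stab_le (E := E) (W := W) (a := a) c) hc.proper).1
  have e4 := card_slice_le (E := E) (W := W) (a := a) (x := s + c) (y := s + c)
    (by simp only [char_two V, zero_mem])
  omega

/-- The previous bound is used for `s` with `t`, and for the partner `p` of `s` with some `t'`. If
`t + t'` can be taken outside the stabiliser of `c`, the two contributions to the coset of `t` are
disjoint; if not, the contribution of `t` is empty. -/
theorem card_pts_le_add_of_evenSum (h : Frame E W a) (hc : IsHalf E W a c) (hs : s ∈ E)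
    (ht : t ∈ E) (hst : ¬ Hit E (flat W a) (s + t)) (hstc : ¬ Hit E (flat W a) (s + t + c))
    (hsc : EvenSum E W c s) (htc : ¬ EvenSum E W c t)
    (hlt : 2 * (cls E (flat W a) (t + c)).card < (pts W).card) :
    (pts W).card ≤ (cls E (flat W a) s).card + (cls E (flat W a) (s + c)).card +
      (cls E (flat W a) t).card := by
  classical
  have e1 := h.card_pts_le_of_evenSum_of_not_evenSum hc hs ht hst hstc hsc htc hlt
  obtain ⟨p, hp, hpW⟩ := hsc
  have key : ∀ t' ∈ E, t' + t ∈ W → (pts W).card ≤ 2 * ((slice E W t' \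
      pts (stab E W a c)).card + (cls E (flat W a) s).card) := by
    intro t' ht' htt
    have e : (cls E (flat W a) (t' + c)).card = (cls E (flat W a) (t + c)).card := by
      rw [cls_congr]; simpa only [char_two V] using le_flat W a htt
    have hpt := le_flat W a (W.add_mem hpW htt)
    have := h.card_pts_le_of_evenSum_of_not_evenSum (s := p) hc hp ht'
      (fun hh => hstc (hh.congr (by simpa only [char_two V] using hpt)))
      (fun hh => hst (hh.congr (by simpa only [char_two V] using hpt)))
      ⟨s, hs, by rwa [add_comm s]⟩ (fun hh => htc (h.evenSum_congr hh ht ht' hc.mem hc.mem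
        (le_flat W a htt) (by simp only [char_two V, zero_mem]))) (by omega)
    rwa [cls_congr (x := p + c) (y := s) (by
      simpa only [char_two V] using le_flat W a hpW)] at this
  by_cases hex : ∃ t' ∈ E, t' + t ∈ W ∧ t' + t ∉ stab E W a c
  · obtain ⟨t', ht', htt, httc⟩ := hex
    have e2 := key t' ht' htt
    have hd : Disjoint ((slice E W t \ pts (stab E W a c)).map (addLeftEmbedding t))
        ((slice E W t' \ pts (stab E W a c)).map (addLeftEmbedding t')) := by
      rw [Finset.disjoint_left]
      intro x hx hx'
      simp only [Finset.mem_map, Finset.mem_sdiff, mem_slice, mem_pts,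
        addLeftEmbedding_apply] at hx hx'
      obtain ⟨u, ⟨⟨hu, -⟩, huc⟩, rfl⟩ := hx
      obtain ⟨v, ⟨⟨hv, -⟩, hvc⟩, hvu⟩ := hx'
      apply httc
      have h1 := hc.add_mem u hu v hv huc hvc
      have h2 : t' + t = t' + v + v + t := by simp only [char_two V]
      rw [h2, hvu]
      simpa only [char_two V] using h1
    have hsub : (slice E W t \ pts (stab E W a c)).map (addLeftEmbedding t) ∪
        (slice E W t' \ pts (stab E W a c)).map (addLeftEmbedding t') ⊆
        cls E (flat W a) t := by
      intro x hx
      simp only [Finset.mem_union, Finset.mem_map, Finset.mem_sdiff, mem_slice, mem_pts,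
        addLeftEmbedding_apply] at hx
      rw [mem_cls]
      rcases hx with ⟨u, ⟨⟨hu, hm⟩, -⟩, rfl⟩ | ⟨u, ⟨⟨hu, hm⟩, -⟩, rfl⟩
      · exact ⟨hm, by simpa only [char_two V] using le_flat W a hu⟩
      · exact ⟨hm, by simpa only [char_two V] using le_flat W a (W.add_mem hu htt)⟩
    have e3 := Finset.card_le_card hsub
    rw [Finset.card_union_of_disjoint hd, Finset.card_map, Finset.card_map] at e3
    omega
  · push Not at hex
    have e2 := key t ht (by simp only [char_two V, zero_mem])
    have e3 : slice E W t \ pts (stab E W a c) = ∅ := by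
      rw [Finset.eq_empty_iff_forall_notMem]
      intro u hu
      simp only [Finset.mem_sdiff, mem_slice, mem_pts] at hu
      exact hu.2 (by simpa only [char_two V] using hex _ hu.1.2 (by
        simpa only [char_two V] using hu.1.1))
    rw [e3, Finset.card_empty] at e1 e2
    omega

/-- Replacing `s` by a point over `s + c` exchanges the two cosets of its pair and preserves the
parity recorded by `EvenSum`. The bounds for all available replacements are combined according to
the parities of `s` and `t`. -/
theorem card_pts_le_sum_of_mem (h : Frame E W a) (hc : IsHalf E W a c) (hs : s ∈ E)
    (ht : t ∈ E) (hst : ¬ Hit E (flat W a) (s + t)) (hstc : ¬ Hit E (flat W a) (s + t + c)) :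
    (pts W).card ≤ (cls E (flat W a) s).card + (cls E (flat W a) (s + c)).card +
      ((cls E (flat W a) t).card + (cls E (flat W a) (t + c)).card) := by
  have swap : ∀ s p : V, p + (s + c) ∈ flat W a →
      cls E (flat W a) p = cls E (flat W a) (s + c) ∧
      cls E (flat W a) (p + c) = cls E (flat W a) s := fun s p hp =>
    ⟨cls_congr hp, cls_congr (by simpa only [char_two V] using hp)⟩
  have hit1 : ∀ s t p : V, ¬ Hit E (flat W a) (s + t) → ¬ Hit E (flat W a) (s + t + c) →
      p + (s + c) ∈ flat W a → ¬ Hit E (flat W a) (p + t) ∧ ¬ Hit E (flat W a) (p + t + c) := by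
    intro s t p hst hstc hp
    exact ⟨fun hh => hstc (hh.congr (by simpa only [char_two V] using hp)),
      fun hh => hst (hh.congr (by simpa only [char_two V] using hp))⟩
  -- the point `s` with an even sum, the point `t` without
  have mixed : ∀ s t : V, s ∈ E → t ∈ E → ¬ Hit E (flat W a) (s + t) →
      ¬ Hit E (flat W a) (s + t + c) → EvenSum E W c s → ¬ EvenSum E W c t →
      (pts W).card ≤ (cls E (flat W a) s).card + (cls E (flat W a) (s + c)).card +
      ((cls E (flat W a) t).card + (cls E (flat W a) (t + c)).card) := by
    intro s t hs ht hst hstc hev hod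
    by_cases hlt : 2 * (cls E (flat W a) (t + c)).card < (pts W).card
    · have := h.card_pts_le_add_of_evenSum hc hs ht hst hstc hev hod hlt
      omega
    · by_cases hlt' : 2 * (cls E (flat W a) t).card < (pts W).card
      · obtain ⟨q, hq, hqF⟩ : Hit E (flat W a) (t + c) := hit_iff_card_pos.2 (by omega)
        obtain ⟨k1, k2⟩ := swap t q hqF
        obtain ⟨n1, n2⟩ := hit1 t s q (by rwa [add_comm]) (by rwa [add_comm t]) hqF
        have := h.card_pts_le_add_of_evenSum hc hs hq (by rwa [add_comm])
          (by rwa [add_comm s]) hev (by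
            rintro ⟨p, hp, hpW⟩
            exact hod ⟨q, hq, by
              have := h.add_mem hp ht (by
                simpa only [char_two V] using (flat W a).add_mem (le_flat W a hpW) hqF)
              simpa only [char_two V] using W.add_mem hpW this⟩) (by rw [k2]; exact hlt')
        rw [k1] at this
        omega
      · omega
  by_cases hse : EvenSum E W c s
  · by_cases hte : EvenSum E W c t
    · have e1 := h.card_pts_le_of_evenSum hc hs ht hst hstc hse hte
      obtain ⟨p, hp, hpW⟩ := hse
      obtain ⟨q, hq, hqW⟩ := hte
      have hpF : p + (s + c) ∈ flat W a := by rw [← add_assoc]; exact le_flat W a hpW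
      have hqF : q + (t + c) ∈ flat W a := by rw [← add_assoc]; exact le_flat W a hqW
      obtain ⟨n1, n2⟩ := hit1 s t p hst hstc hpF
      obtain ⟨n3, n4⟩ := hit1 t p q (by rwa [add_comm]) (by rwa [add_comm t]) hqF
      have e2 := h.card_pts_le_of_evenSum hc hq hp n3 n4 ⟨t, ht, by rwa [add_comm t]⟩
        ⟨s, hs, by rwa [add_comm s]⟩
      rw [(swap s p hpF).2, (swap t q hqF).2] at e2
      omega
    · exact mixed s t hs ht hst hstc hse hte
  · by_cases hte : EvenSum E W c t
    · have := mixed t s ht hs (by rwa [add_comm]) (by rwa [add_comm t]) hte hse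
      omega
    · have od : ∀ s p, s ∈ E → p ∈ E → p + (s + c) ∈ flat W a → ¬ EvenSum E W c s →
          ¬ EvenSum E W c p := by
        rintro s p hs hp hpF hod ⟨q, hq, hqW⟩
        exact hod ⟨p, hp, by
          have := h.add_mem hq hs (by
            simpa only [char_two V] using (flat W a).add_mem (le_flat W a hqW) hpF)
          simpa only [char_two V] using W.add_mem hqW this⟩
      have e1 := h.card_pts_le_of_not_evenSum hc hs ht hst hstc hse hte
      have e2 : 0 < (cls E (flat W a) (s + c)).card →
          (pts W).card ≤ 2 * (cls E (flat W a) s).card + 2 * (cls E (flat W a) (t + c)).card ∨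
          ((pts W).card ≤ 2 * (cls E (flat W a) (s + c)).card ∧ (pts W).card ≤ 2 * (cls E (flat W a) t).card) := fun hpos => by
        obtain ⟨p, hp, hpF⟩ := hit_iff_card_pos.2 hpos
        obtain ⟨n1, n2⟩ := hit1 s t p hst hstc hpF
        have := h.card_pts_le_of_not_evenSum hc hp ht n1 n2 (od s p hs hp hpF hse) hte
        rw [(swap s p hpF).1, (swap s p hpF).2] at this
        exact this
      have e3 : 0 < (cls E (flat W a) (t + c)).card →
          (pts W).card ≤ 2 * (cls E (flat W a) t).card + 2 * (cls E (flat W a) (s + c)).card ∨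
          ((pts W).card ≤ 2 * (cls E (flat W a) (t + c)).card ∧ (pts W).card ≤ 2 * (cls E (flat W a) s).card) := fun hpos => by
        obtain ⟨q, hq, hqF⟩ := hit_iff_card_pos.2 hpos
        obtain ⟨n1, n2⟩ := hit1 t s q (by rwa [add_comm]) (by rwa [add_comm t]) hqF
        have := h.card_pts_le_of_not_evenSum hc hq hs n1 n2 (od t q ht hq hqF hte) hse
        rw [(swap t q hqF).1, (swap t q hqF).2] at this
        exact this
      have e4 : 0 < (cls E (flat W a) (s + c)).card → 0 < (cls E (flat W a) (t + c)).card →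
          (pts W).card ≤ 2 * (cls E (flat W a) t).card + 2 * (cls E (flat W a) s).card ∨
          ((pts W).card ≤ 2 * (cls E (flat W a) (t + c)).card ∧ (pts W).card ≤ 2 * (cls E (flat W a) (s + c)).card) :=
        fun hpos hpos' => by
          obtain ⟨p, hp, hpF⟩ := hit_iff_card_pos.2 hpos
          obtain ⟨q, hq, hqF⟩ := hit_iff_card_pos.2 hpos'
          obtain ⟨n1, n2⟩ := hit1 s t p hst hstc hpF
          obtain ⟨n3, n4⟩ := hit1 t p q (by rwa [add_comm]) (by rwa [add_comm t]) hqF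
          have := h.card_pts_le_of_not_evenSum hc hq hp n3 n4 (od t q ht hq hqF hte)
            (od s p hs hp hpF hse)
          rw [(swap t q hqF).1, (swap t q hqF).2, (swap s p hpF).1, (swap s p hpF).2] at this
          exact this
      omega

/-- Two pairs of cosets that differ by a half coset and are not adjacent contain many points. -/
theorem card_pts_le_sum (h : Frame E W a) (hc : IsHalf E W a c)
    (hst : ¬ Hit E (flat W a) (s + t)) (hstc : ¬ Hit E (flat W a) (s + t + c))
    (hs : 0 < (cls E (flat W a) s).card + (cls E (flat W a) (s + c)).card)
    (ht : 0 < (cls E (flat W a) t).card + (cls E (flat W a) (t + c)).card) :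
    (pts W).card ≤ (cls E (flat W a) s).card + (cls E (flat W a) (s + c)).card +
      ((cls E (flat W a) t).card + (cls E (flat W a) (t + c)).card) := by
  have rep : ∀ s : V, 0 < (cls E (flat W a) s).card + (cls E (flat W a) (s + c)).card →
      ∃ p ∈ E, (p + s ∈ flat W a ∨ p + (s + c) ∈ flat W a) ∧
      (cls E (flat W a) p).card + (cls E (flat W a) (p + c)).card =
      (cls E (flat W a) s).card + (cls E (flat W a) (s + c)).card := by
    intro s hs
    by_cases h0 : 0 < (cls E (flat W a) s).card
    · obtain ⟨p, hp, hpF⟩ := hit_iff_card_pos.2 h0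
      refine ⟨p, hp, Or.inl hpF, ?_⟩
      rw [cls_congr hpF, cls_congr (x := p + c) (y := s + c)]
      simpa only [char_two V] using hpF
    · obtain ⟨p, hp, hpF⟩ : Hit E (flat W a) (s + c) := hit_iff_card_pos.2 (by omega)
      refine ⟨p, hp, Or.inr hpF, ?_⟩
      rw [cls_congr hpF, cls_congr (x := p + c) (y := s), add_comm]
      simpa only [char_two V] using hpF
  obtain ⟨p, hp, hpF, e1⟩ := rep s hs
  obtain ⟨q, hq, hqF, e2⟩ := rep t ht
  rw [← e1, ← e2]
  rcases hpF with hpF | hpF <;> rcases hqF with hqF | hqF <;>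
    have hpq := (flat W a).add_mem hpF hqF <;>
    refine h.card_pts_le_sum_of_mem hc hp hq (fun hh => ?_) (fun hh => ?_)
  · exact hst (hh.congr (by simpa only [char_two V] using hpq))
  · exact hstc (hh.congr (by simpa only [char_two V] using hpq))
  · exact hstc (hh.congr (by simpa only [char_two V] using hpq))
  · exact hst (hh.congr (by simpa only [char_two V] using hpq))
  · exact hstc (hh.congr (by simpa only [char_two V] using hpq))
  · exact hst (hh.congr (by simpa only [char_two V] using hpq))
  · exact hst (hh.congr (by simpa only [char_two V] using hpq))
  · exact hstc (hh.congr (by simpa only [char_two V] using hpq))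

end Frame
end BinMatroid

/-! ### The lower bound in the presence of a free triple -/

namespace BinMatroid

theorem add_two_le_of_pairs {M S₀ S₁ S₂ S₃ T₀ T₁ T₂ T₃ : ℕ} (hM : 4 ≤ M) (hS : 0 < S₀)
    (hT : 0 < T₀) (hS1 : S₁ = 0 → S₂ = 0 → S₃ = 0 → 2 * S₀ = M)
    (hT1 : T₁ = 0 → T₂ = 0 → T₃ = 0 → 2 * T₀ = M)
    (hST : 0 < S₁ + S₂ + S₃ + T₁ + T₂ + T₃)
    (h1 : M ≤ S₀ + S₁ + (T₀ + T₁)) (h2 : 0 < T₂ + T₃ → M ≤ S₀ + S₁ + (T₂ + T₃))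
    (h3 : 0 < S₂ + S₃ → M ≤ S₂ + S₃ + (T₀ + T₁))
    (h5 : M ≤ S₀ + S₂ + (T₀ + T₂)) (h6 : 0 < T₁ + T₃ → M ≤ S₀ + S₂ + (T₁ + T₃))
    (h7 : 0 < S₁ + S₃ → M ≤ S₁ + S₃ + (T₀ + T₂)) :
    M + 2 ≤ S₀ + S₁ + S₂ + S₃ + (T₀ + T₁ + T₂ + T₃) := by
  omega

variable {V : Type*} [AddCommGroup V] [Module (ZMod 2) V] [FiniteDimensional (ZMod 2) V]
variable {E : Finset V} {W : Submodule (ZMod 2) V} {a : V}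

namespace Frame

omit [FiniteDimensional (ZMod 2) V] in
theorem freeTriple_of_card_eq_zero {y z x : V} (hyz : ¬ Hit E (flat W a) (y + z))
    (h1 : (cls E (flat W a) (x + y)).card = 0) (h2 : (cls E (flat W a) (x + z)).card = 0)
    (h3 : (cls E (flat W a) (x + y + z)).card = 0) : FreeTriple E (flat W a) y z x := by
  refine ⟨?_, ?_, by rw [add_comm]; exact hyz, ?_⟩ <;> rw [hit_iff_card_pos]
  · rw [add_comm]; omega
  · rw [add_comm z, add_right_comm]; omega
  · omega

theorem add_two_le_card_cls_add_card_cls (h : Frame E W a) {y z e f : V}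
    (hyH : IsHalf E W a y) (hzH : IsHalf E W a z) (hyz : ¬ Hit E (flat W a) (y + z))
    (hM : 4 ≤ (pts W).card) (hv : ∃ v ∈ W, v ∈ stab E W a z ∧ v ∉ stab E W a y)
    (he : e ∈ E) (hf : f ∈ E) (hef : ¬ Hit E (ext2 (flat W a) y z) (e + f)) :
    (pts W).card + 2 ≤ (cls E (ext2 (flat W a) y z) e).card +
      (cls E (ext2 (flat W a) y z) f).card := by
  obtain ⟨v, hv, hvz, hvy⟩ := hv
  have hy := hyH.mem
  have hz := hzH.mem
  have hyF := hyH.not_mem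
  have hzF := hzH.not_mem
  have hyzF := add_not_mem_of_not_hit h.exists_mem hyz
  have yU : y ∈ ext2 (flat W a) y z :=
    mem_ext2.2 (Or.inr (Or.inl (by simp only [char_two V, zero_mem])))
  have zU : z ∈ ext2 (flat W a) y z :=
    mem_ext2.2 (Or.inr (Or.inr (Or.inl (by simp only [char_two V, zero_mem]))))
  have yzU := Submodule.add_mem _ yU zU
  have zyU := Submodule.add_mem _ zU yU
  have nh : ∀ x, x + (e + f) ∈ ext2 (flat W a) y z → ¬ Hit E (flat W a) x := fun x hx hh =>
    hef ((hh.mono (le_ext2 _ _ _)).congr hx)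
  have e0 := hit_iff_card_pos.1 (hit_self (U := flat W a) he)
  have f0 := hit_iff_card_pos.1 (hit_self (U := flat W a) hf)
  -- Otherwise `y, z, e`, then `y, z, f`, and also `y, e, f` are free triples. By the first two, `v`
  -- stabilises neither `e` nor `f`, nor does it stabilise `y`, against the covering by the third.
  have hST : 0 < (cls E (flat W a) (e + y)).card + (cls E (flat W a) (e + z)).card +
      (cls E (flat W a) (e + y + z)).card + (cls E (flat W a) (f + y)).card +
      (cls E (flat W a) (f + z)).card + (cls E (flat W a) (f + y + z)).card := by
    by_contra hlt
    have fe := freeTriple_of_card_eq_zero (x := e) hyz (by omega) (by omega) (by omega)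
    have ff := freeTriple_of_card_eq_zero (x := f) hyz (by omega) (by omega) (by omega)
    have k1 := (h.exists_mem_stab_not_mem_stab hy hz he fe).2 v hv hvz hvy
    have k2 := (h.exists_mem_stab_not_mem_stab hy hz hf ff).2 v hv hvz hvy
    have k3 := h.stab_cover' (c := y) (s := e) (t := f)
      ⟨nh _ (by simp only [char_two V, zero_mem]), nh _ (by simpa only [char_two V]),
        fe.2.2.2, ff.2.2.2⟩ v hv
    tauto
  have ee : e + z + y = e + y + z := add_right_comm _ _ _
  have ff : f + z + y = f + y + z := add_right_comm _ _ _
  have p1 := h.card_pts_le_sum (s := e) (t := f) hyH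
    (nh _ (by simp only [char_two V, zero_mem])) (nh _ (by simpa only [char_two V]))
  have p2 := h.card_pts_le_sum (s := e) (t := f + z) hyH
    (nh _ (by simpa only [char_two V])) (nh _ (by simpa only [char_two V]))
  have p3 := h.card_pts_le_sum (s := e + z) (t := f) hyH
    (nh _ (by simpa only [char_two V])) (nh _ (by simpa only [char_two V]))
  have q1 := h.card_pts_le_sum (s := e) (t := f) hzH
    (nh _ (by simp only [char_two V, zero_mem])) (nh _ (by simpa only [char_two V]))
  have q2 := h.card_pts_le_sum (s := e) (t := f + y) hzH
    (nh _ (by simpa only [char_two V])) (nh _ (by simpa only [char_two V]))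
  have q3 := h.card_pts_le_sum (s := e + y) (t := f) hzH
    (nh _ (by simpa only [char_two V])) (nh _ (by simpa only [char_two V]))
  rw [ee] at p3
  rw [ff] at p2
  rw [card_cls_ext2 hyF hzF hyzF, card_cls_ext2 hyF hzF hyzF]
  refine add_two_le_of_pairs hM e0 f0
    (fun h1 h2 h3 => h.two_mul_card_of_isHalf
      (h.isHalf he hy hz (freeTriple_of_card_eq_zero hyz h1 h2 h3).rotate.rotate))
    (fun h1 h2 h3 => h.two_mul_card_of_isHalf
      (h.isHalf hf hy hz (freeTriple_of_card_eq_zero hyz h1 h2 h3).rotate.rotate)) hST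
    (p1 (Nat.add_pos_left e0 _) (Nat.add_pos_left f0 _))
    (fun h0 => p2 (Nat.add_pos_left e0 _) h0) (fun h0 => p3 h0 (Nat.add_pos_left f0 _))
    (q1 (Nat.add_pos_left e0 _) (Nat.add_pos_left f0 _))
    (fun h0 => q2 (Nat.add_pos_left e0 _) h0) (fun h0 => q3 h0 (Nat.add_pos_left f0 _))

/-- Matroids with a free triple modulo a largest affine geometry have many points. -/
theorem minCard_lt_card_of_freeTriple (h : Frame E W a)
    (hspan : Submodule.span (ZMod 2) (E : Set V) = ⊤) (h3 : ¬ NoFreeTriple E (flat W a)) :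
    minCard (finrank (ZMod 2) V) < E.card := by
  obtain ⟨y, hy, z, hz, w, hw, hf⟩ := not_noFreeTriple.1 h3
  have hyH := h.isHalf hy hz hw hf
  have hzH := h.isHalf hz hw hy hf.rotate
  have hne := h.stab_ne hy hz hw hf
  have hyz : ¬ Hit E (flat W a) (y + z) := by rw [add_comm]; exact hf.2.2.1
  have hyF := hyH.not_mem
  have hzF := hzH.not_mem
  have hyzF := add_not_mem_of_not_hit h.exists_mem hyz
  have hNy := h.two_mul_card_of_isHalf hyH
  have hNz := h.two_mul_card_of_isHalf hzH
  obtain ⟨v, hv, hvz, hvy⟩ := (h.exists_mem_stab_not_mem_stab hy hz hw hf).1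
  have hM : 4 ≤ (pts W).card := by
    classical
    have e1 := (card_pts_le_two_mul_sdiff (stab_le (E := E) (W := W) (a := a) z) hzH.proper).2
    have e2 : 1 < (pts (stab E W a z)).card := Finset.one_lt_card.2
      ⟨0, mem_pts.2 (zero_mem _), v, mem_pts.2 hvz, fun h0 => hvy (h0 ▸ zero_mem _)⟩
    omega
  have yU : y ∈ ext2 (flat W a) y z :=
    mem_ext2.2 (Or.inr (Or.inl (by simp only [char_two V, zero_mem])))
  have zU : z ∈ ext2 (flat W a) y z :=
    mem_ext2.2 (Or.inr (Or.inr (Or.inl (by simp only [char_two V, zero_mem]))))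
  have hfree := h.noFreeTriple_of_isHalf (le_ext2 (flat W a) y z) hyH yU hzH zU hne
  have two : ∀ e ∈ E, 2 ≤ (cls E (ext2 (flat W a) y z) e).card := by
    intro e he
    rw [card_cls_ext2 hyF hzF hyzF]
    have h0 := hit_iff_card_pos.1 (hit_self (U := flat W a) he)
    by_contra hlt
    have := h.two_mul_card_of_isHalf (h.isHalf he hy hz
      (freeTriple_of_card_eq_zero hyz (by omega) (by omega) (by omega)).rotate.rotate)
    omega
  have hfr := finrank_ext2 hyF hzF hyzF
  have hfl := h.finrank_flat
  obtain ⟨k, hk⟩ := Nat.exists_eq_add_of_le (Submodule.finrank_le (ext2 (flat W a) y z))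
  -- The half cosets of `y` and `z` contribute `|W|` points instead of the two needed, so the bound
  -- is strict.
  obtain ⟨α, β, hαβ, hb, -⟩ := weighted_lower_bound hspan k _ 2 (pts W).card hk
    (by obtain ⟨b, hb, hbF⟩ := h.exists_mem; exact ⟨b, hb, le_ext2 _ _ _ hbF⟩)
    hfree (fun e he _ => two e he) (fun e he f hf hef => by
      rw [add_comm 2]
      exact h.add_two_le_card_cls_add_card_cls hyH hzH hyz hM ⟨v, hv, hvz, hvy⟩ he hf hef)
  have hcard := h.card_eq
  rw [card_outside_ext2 h.exists_mem hy hz hyz] at hcard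
  have := minCard_le (r := finrank (ZMod 2) V) (i := α + 1)
    (j := finrank (ZMod 2) W + β) (by omega)
  rw [pow_succ, pow_add, ← card_pts (W := W)] at this
  omega

end Frame
end BinMatroid

namespace BinMatroid
variable {V : Type*} [AddCommGroup V] [Module (ZMod 2) V] [FiniteDimensional (ZMod 2) V]
variable {E : Finset V} {W : Submodule (ZMod 2) V} {a : V}

/-! ### The main theorem -/

/-- Any two points of `E` form a coset of a line's direction, so a largest coset has dimension at
least one. -/
theorem exists_frame (hS : SumFree E) (hF : FiveSum E)
    (hspan : Submodule.span (ZMod 2) (E : Set V) = ⊤) (hr : 2 ≤ finrank (ZMod 2) V) :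
    ∃ W a, Frame E W a ∧ 1 ≤ finrank (ZMod 2) W := by
  have : Finite V := Module.finite_of_finite (ZMod 2)
  have hcard : 2 ≤ E.card := by
    have := finrank_span_finset_le_card (R := ZMod 2) E
    rw [Set.finrank, hspan, finrank_top] at this
    omega
  obtain ⟨b, hb, c, hc, hbc⟩ := Finset.one_lt_card.1 (show 1 < E.card by omega)
  have hb2 : ∀ w ∈ (ZMod 2) ∙ (b + c), b + w ∈ E := by
    intro w hw
    obtain ⟨k, rfl⟩ := Submodule.mem_span_singleton.1 hw
    obtain rfl | rfl : k = 0 ∨ k = 1 := by clear hw; revert k; decide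
    · simpa using hb
    · simpa only [one_smul, char_two V] using hc
  obtain ⟨⟨a, W⟩, haW, hmax⟩ := Set.exists_max_image
    {p : V × Submodule (ZMod 2) V | ∀ w ∈ p.2, p.1 + w ∈ E} (fun p => finrank (ZMod 2) p.2)
    (Set.toFinite _) ⟨(b, _), hb2⟩
  refine ⟨W, a, ⟨hS, hF, haW, fun b W' hW' => hmax (b, W') hW'⟩, ?_⟩
  have : finrank (ZMod 2) ((ZMod 2) ∙ (b + c)) ≤ finrank (ZMod 2) W := hmax (b, _) hb2
  rwa [finrank_span_singleton (fun h0 => hbc (add_eq_zero_iff_eq_of_char_two.1 h0))] at this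

/-- By strict convexity, `2^(m-1) + 2^(n-1)` attains the minimum only for balanced dimensions. -/
theorem IsSumOfAffineGeometries.of_card_eq {M : BinMatroid V} {m n : ℕ}
    (h : M.IsSumOfAffineGeometries m n) (hmn : m + n = finrank (ZMod 2) V)
    (hcard : M.ground.ncard = minCard (finrank (ZMod 2) V)) :
    M.IsSumOfAffineGeometries (finrank (ZMod 2) V / 2) ((finrank (ZMod 2) V + 1) / 2) := by
  obtain ⟨hm, hn, hc⟩ := h.ncard
  by_cases h1 : m = finrank (ZMod 2) V / 2 ∧ n = (finrank (ZMod 2) V + 1) / 2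
  · rwa [← h1.1, ← h1.2]
  by_cases h2 : n = finrank (ZMod 2) V / 2 ∧ m = (finrank (ZMod 2) V + 1) / 2
  · rw [← h2.1, ← h2.2]; exact h.symm
  have := minCard_lt (r := finrank (ZMod 2) V) (i := m - 1) (j := n - 1) (by omega) (by omega)
    (by omega)
  omega

end BinMatroid

theorem mainTheorem1 {V : Type*} [AddCommGroup V] [Module (ZMod 2) V]
    [FiniteDimensional (ZMod 2) V] (M : BinMatroid V) (r : ℕ)
    (hr : Module.finrank (ZMod 2) V = r) (hr2 : 2 ≤ r)
    (hfull : M.FullRank) (hI : M.IsFree (BinMatroid.indep 5)) (hT : M.TriangleFree) :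
    2 ^ (r / 2 - 1) + 2 ^ ((r + 1) / 2 - 1) ≤ M.ground.ncard ∧
      (6 ≤ r →
        (M.ground.ncard = 2 ^ (r / 2 - 1) + 2 ^ ((r + 1) / 2 - 1) ↔
          M.IsSumOfAffineGeometries (r / 2) ((r + 1) / 2))) := by
  have : Finite V := Module.finite_of_finite (ZMod 2)
  obtain ⟨E, hE⟩ : ∃ E : Finset V, (E : Set V) = M.ground :=
    ⟨(Set.toFinite M.ground).toFinset, Set.Finite.coe_toFinset _⟩
  have hspan : Submodule.span (ZMod 2) (E : Set V) = ⊤ := by rw [hE]; exact hfull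
  have hcard : M.ground.ncard = E.card := by rw [← hE, Set.ncard_coe_finset]
  subst hr
  obtain ⟨W, a, h, hW⟩ := BinMatroid.exists_frame (hT.sumFree hE) (hI.fiveSum hT hE) hspan hr2
  change BinMatroid.minCard _ ≤ _ ∧ (_ → (_ = BinMatroid.minCard _ ↔ _))
  have key : BinMatroid.minCard (Module.finrank (ZMod 2) V) ≤ E.card ∧
      (6 ≤ Module.finrank (ZMod 2) V → E.card = BinMatroid.minCard (Module.finrank (ZMod 2) V) →
        ∃ m n, m + n = Module.finrank (ZMod 2) V ∧ M.IsSumOfAffineGeometries m n) := by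
    by_cases h3 : BinMatroid.NoFreeTriple E (BinMatroid.flat W a)
    -- The assumption `6 ≤ r` is needed only when the largest coset has dimension one.
    · rcases hW.eq_or_lt' with hW | hW
      · have := h.minCard_le_card_of_finrank_le_one hspan h3 hW
        exact ⟨this.1, fun h6 heq => absurd heq (this.2 h6).ne'⟩
      · have := h.minCard_le_card_of_noFreeTriple hspan hE h3 hW
        exact ⟨this.1, fun _ => this.2⟩
    · have := h.minCard_lt_card_of_freeTriple hspan h3
      exact ⟨this.le, fun _ heq => absurd heq this.ne'⟩
  rw [hcard]
  refine ⟨key.1, fun h6 => ⟨fun heq => ?_, fun hs => ?_⟩⟩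
  · obtain ⟨m, n, hmn, hs⟩ := key.2 h6 heq
    exact hs.of_card_eq hmn (by rw [hcard, heq])
  · rw [← hcard, hs.ncard.2.2]
    rfl
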